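/- Let $\mathbb{R}^{4,2}$ be $\mathbb{R}^6$ with a symmetric bilinear form $(\,,)$ of signature $(4,2)$; identify $a\wedge b$ with the skew endomorphism $c\mapsto (a,c)b-(b,c)a$. Let $\Sigma$ be a connected smooth $2$-manifold. A \emph{Legendre map} is a smooth rank $2$ subbundle $f$ of $\Sigma\times\mathbb{R}^{4,2}$ with isotropic fibres such that $d_X\sigma\perp f$ for all local sections $\sigma$ of $f$ and all tangent vectors $X$, and such that $X=0$ whenever $d_X\sigma\in f$ for all local sections $\sigma$. A line $s\le f(x)$ is a \emph{curvature sphere} at $x$ if $d_X\sigma\in f(x)$ for all $X$ in a non-zero subspace of $T_x\Sigma$ and all local sections $\sigma$ of $f$ with $\sigma(x)\in s$; $f$ is \emph{umbilic-free} if it has no point with exactly one curvature sphere. Then there are, locally, two curvature sphere congruences $s_1,s_2$ with curvature line fields $T_1,T_2$; for local non-vanishing sections $\sigma_i$ of $s_i$, $X$ of $T_1$, $Y$ of $T_2$ put $S_1=\langle\sigma_1,d_Y\sigma_1,d_Yd_Y\sigma_1\rangle$, $S_2=\langle\sigma_2,d_X\sigma_2,d_Xd_X\sigma_2\rangle$,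 so that $\wedge^2\mathbb{R}^{4,2}=(\wedge^2S_1\oplus\wedge^2S_2)\oplus (S_1\wedge S_2)$. An umbilic-free Legendre map $f$ is a \emph{special $\Omega$-surface of type $1$ with linear conserved quantity $p$} if there is a smooth closed $1$-form $\eta$ with values in $f\wedge f^\perp$, with $[\eta\wedge\eta]=0$, whose quadratic differential $(X,Y)\mapsto \mathrm{tr}(\sigma\mapsto\eta(X)d_Y\sigma:f\to f)$ is non-degenerate at every point, whose $S_1\wedge S_2$-part takes values in $\wedge^2f$ (i.e. $\eta$ is a middle potential), and if $p(t)=p_0+tp_1$ with smooth $p_0,p_1:\Sigma\to\mathbb{R}^{4,2}$, $p_1\not\equiv0$, satisfies $dp(t)+t\,\eta\,p(t)=0$ for all $t\in\mathbb{R}$. Let $\mathfrak{q}_\infty$ be a non-zero lightlike vector. A \emph{Euclidean frame} of the Laguerre geometry defined by $\mathfrak{q}_\infty$ is a pair $(\mathfrak{q}_0,\mathfrak{p})$ with $(\mathfrak{q}_0,\mathfrak{q}_0)=0$, $(\mathfrak{q}_0,\mathfrak{q}_\infty)=-1$, $\mathfrak{p}\perp\mathfrak{q}_0,\mathfrak{q}_\infty$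 and $(\mathfrak{p},\mathfrak{p})=-1$; then $\mathbb{R}^3\cong\langle\mathfrak{q}_\infty,\mathfrak{q}_0,\mathfrak{p}\rangle^\perp$. We say that $f$ \emph{projects to an $L$-isothermic surface} with respect to it if there are smooth maps $x,n:\Sigma\to\mathbb{R}^3$, $(n,n)=1$, such that $x+\mathfrak{q}_0+\frac12(x,x)\mathfrak{q}_\infty$ and $n+\mathfrak{p}+(n,x)\mathfrak{q}_\infty$ are sections of $f$ (so $x$ is a surface, possibly not immersed, with unit normal $n$), and a quadratic differential $q$ on $\Sigma$ that is holomorphic for $I\!I\!I=(dn,dn)$ and commutes with $I\!I=-(dx,dn)$. Here \emph{holomorphic} means that locally there is a complex coordinate $z$ with $I\!I\!I=e^{2u}dz\,d\bar z$ and $q=dz^2+d\bar z^2$ (that is, $q^{1,1}=0$ and $q^{2,0}=dz^2$), and \emph{commutes} means that $I\!I^{2,0}=\mu\,q^{2,0}$ for some function $\mu:\Sigma\to\mathbb{R}$, bidegrees being taken for the complex structure of $I\!I\!I$. \textbf{Theorem.} (1) If $f$ is a special $\Omega$-surface of type $1$ with linear conserved quantity $p$ such that $(p(t),p(t))=0$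 for all $t$, then $p(0)$ is a constant non-zero lightlike vector $\mathfrak{q}_\infty$, and $f$ projects to an $L$-isothermic surface with respect to every Euclidean frame of the Laguerre geometry defined by $\mathfrak{q}_\infty$. (2) Conversely, if $f$ is an umbilic-free Legendre map that projects to an $L$-isothermic surface with respect to some Euclidean frame of the Laguerre geometry defined by a non-zero lightlike vector $\mathfrak{q}_\infty$, then $f$ is a special $\Omega$-surface of type $1$ with a linear conserved quantity $p$ satisfying $(p(t),p(t))=0$ for all $t$ and $p(0)=\mathfrak{q}_\infty$. -/

import Mathlib

open scoped Manifold ContDiff Topology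

noncomputable section

namespace LieSphere

/-- The vector space underlying `ℝ^{4,2}`. -/
abbrev R42 : Type := Fin 6 → ℝ

/-- The symmetric bilinear form `( , )` of signature `(4,2)` on `ℝ^{4,2}`. -/
def form : LinearMap.BilinForm ℝ R42 :=
  LinearMap.mk₂ ℝ
    (fun x y => x 0 * y 0 + x 1 * y 1 + x 2 * y 2 + x 3 * y 3 - x 4 * y 4 - x 5 * y 5)
    (by intro x x' y; simp only [Pi.add_apply]; ring)
    (by intro c x y; simp only [Pi.smul_apply, smul_eq_mul]; ring)
    (by intro x y y'; simp only [Pi.add_apply]; ring)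
    (by intro c x y; simp only [Pi.smul_apply, smul_eq_mul]; ring)

/-- `W^⊥` with respect to `( , )`. -/
def perp (W : Submodule ℝ R42) : Submodule ℝ R42 := form.orthogonal W

/-- `a ∧ b`, regarded as the skew endomorphism `c ↦ (a,c) b - (b,c) a`. -/
def wedge (a b : R42) : R42 →L[ℝ] R42 :=
  LinearMap.toContinuousLinearMap ((form a).smulRight b - (form b).smulRight a)

/-- `A ∧ B`, the subspace of `∧² ℝ^{4,2}` spanned by the `a ∧ b` with `a ∈ A`, `b ∈ B`. -/
def wedgeSpan (A B : Submodule ℝ R42) : Submodule ℝ (R42 →L[ℝ] R42) :=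
  Submodule.span ℝ {T | ∃ a ∈ A, ∃ b ∈ B, T = wedge a b}

/-- The model plane of a surface. -/
abbrev Plane : Type := EuclideanSpace ℝ (Fin 2)

section Surface

variable {M : Type*} [TopologicalSpace M] [ChartedSpace Plane M]

/-- The derivative `d_X σ` at `p` of a map `σ` into a normed space. -/
def dd {F : Type*} [NormedAddCommGroup F] [NormedSpace ℝ F] (σ : M → F) (p : M)
    (X : TangentSpace (𝓡 2) p) : F :=
  mfderiv (𝓡 2) 𝓘(ℝ, F) σ p X

/-- `σ` is a smooth section over `U` of the family of subspaces `f` of `ℝ^{4,2}`. -/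
def IsSectionOn (f : M → Submodule ℝ R42) (U : Set M) (σ : M → R42) : Prop :=
  ContMDiffOn (𝓡 2) 𝓘(ℝ, R42) ∞ σ U ∧ ∀ x ∈ U, σ x ∈ f x

/-- The fibre at `p` of the derived bundle `f^{(1)}`: the values at `p` of the local sections
of `f` and of their derivatives. -/
def derivedAt (f : M → Submodule ℝ R42) (p : M) : Set R42 :=
  {w | ∃ U : Set M, IsOpen U ∧ p ∈ U ∧ ∃ σ : M → R42, IsSectionOn f U σ ∧
    (w = σ p ∨ ∃ X : TangentSpace (𝓡 2) p, w = dd σ p X)}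

/-- `β(X) v = 0`, where `v ∈ f p` and `β(X) : f p → f^{(1)} / f`, `σ ↦ d_X σ mod f`. -/
def SolderKills (f : M → Submodule ℝ R42) (p : M) (X : TangentSpace (𝓡 2) p)
    (v : R42) : Prop :=
  ∀ U : Set M, IsOpen U → p ∈ U → ∀ σ : M → R42, IsSectionOn f U σ → σ p = v →
    dd σ p X ∈ f p

/-- Legendre maps: smooth maps into the Grassmannian of isotropic planes of `ℝ^{4,2}` that
satisfy the contact condition and the immersion condition. -/
structure IsLegendre (f : M → Submodule ℝ R42) : Prop where
  isotropic : ∀ p, ∀ v ∈ f p, ∀ w ∈ f p, form v w = 0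
  rank_two : ∀ p, Module.finrank ℝ (f p) = 2
  smooth : ∀ p, ∃ U : Set M, IsOpen U ∧ p ∈ U ∧ ∃ σ τ : M → R42,
    ContMDiffOn (𝓡 2) 𝓘(ℝ, R42) ∞ σ U ∧ ContMDiffOn (𝓡 2) 𝓘(ℝ, R42) ∞ τ U ∧
    ∀ x ∈ U, f x = Submodule.span ℝ {σ x, τ x}
  contact : ∀ p, ∀ w ∈ derivedAt f p, w ∈ perp (f p)
  immersion : ∀ p, ∀ X : TangentSpace (𝓡 2) p, (∀ v ∈ f p, SolderKills f p X v) → X = 0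

/-- The line `s ≤ f p` is a curvature sphere of `f` at `p`. -/
def IsCurvatureSphere (f : M → Submodule ℝ R42) (p : M) (s : Submodule ℝ R42) : Prop :=
  s ≤ f p ∧ Module.finrank ℝ s = 1 ∧
    ∃ T : Submodule ℝ (TangentSpace (𝓡 2) p), T ≠ ⊥ ∧
      ∀ X ∈ T, ∀ v ∈ s, SolderKills f p X v

/-- `p` is an umbilic point: there is exactly one curvature sphere at `p`. -/
def IsUmbilic (f : M → Submodule ℝ R42) (p : M) : Prop :=
  ∃! s : Submodule ℝ R42, IsCurvatureSphere f p s

def UmbilicFree (f : M → Submodule ℝ R42) : Prop := ∀ p, ¬ IsUmbilic f p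

/-! ### One-forms with values in `∧² ℝ^{4,2}` -/

variable (M) in
/-- Families of covectors with values in the endomorphisms of `ℝ^{4,2}`. -/
abbrev OneForm : Type _ := (p : M) → TangentSpace (𝓡 2) p →L[ℝ] (R42 →L[ℝ] R42)

/-- The expression of `η` in the preferred chart at `p`. -/
def localExpr (η : OneForm M) (p : M) (y : Plane) : Plane →L[ℝ] (R42 →L[ℝ] R42) :=
  (η ((extChartAt (𝓡 2) p).symm y)).comp
    (mfderiv 𝓘(ℝ, Plane) (𝓡 2) (extChartAt (𝓡 2) p).symm y)

def IsSmoothForm (η : OneForm M) : Prop :=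
  ∀ p : M, ContDiffOn ℝ ∞ (localExpr η p) (extChartAt (𝓡 2) p).target

/-- The exterior derivative `dη (X, Y)` at `p`, computed in the preferred chart at `p`
(in which the tangent space at `p` is identified with the model plane by the identity). -/
def extDer (η : OneForm M) (p : M) (X Y : TangentSpace (𝓡 2) p) : R42 →L[ℝ] R42 :=
  fderiv ℝ (localExpr η p) (extChartAt (𝓡 2) p p) (X : Plane) (Y : Plane) -
    fderiv ℝ (localExpr η p) (extChartAt (𝓡 2) p p) (Y : Plane) (X : Plane)

variable (M) in
/-- Real-valued functions of a point and two tangent vectors at that point. -/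
abbrev TwoTensor : Type _ :=
  (p : M) → TangentSpace (𝓡 2) p → TangentSpace (𝓡 2) p → ℝ

/-- `q (X, Y) = tr (σ ↦ η(X) d_Y σ : f → f)`. -/
def IsQuadDiffOf (f : M → Submodule ℝ R42) (η : OneForm M) (q : TwoTensor M) : Prop :=
  ∀ (p : M) (X Y : TangentSpace (𝓡 2) p), ∃ L : f p →ₗ[ℝ] f p,
    (∀ U : Set M, IsOpen U → p ∈ U → ∀ σ : M → R42, IsSectionOn f U σ →
      ∀ v : f p, (v : R42) = σ p → (L v : R42) = η p X (dd σ p Y)) ∧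
    q p X Y = LinearMap.trace ℝ (f p) L

/-- `η` is a closed one-form with values in `f ∧ f^⊥`, with `[η ∧ η] = 0`, whose quadratic
differential is non-degenerate at every point (non-degenerate on a dense open set and of
constant signature). -/
structure IsOmegaPotential (f : M → Submodule ℝ R42) (η : OneForm M) : Prop where
  smooth : IsSmoothForm η
  values : ∀ (p : M) (X : TangentSpace (𝓡 2) p), η p X ∈ wedgeSpan (f p) (perp (f p))
  closed : ∀ (p : M) (X Y : TangentSpace (𝓡 2) p), extDer η p X Y = 0
  bracket : ∀ (p : M) (X Y : TangentSpace (𝓡 2) p),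
    ⁅η p X, η p Y⁆ - ⁅η p Y, η p X⁆ = 0
  nondegenerate : ∃ q : TwoTensor M, IsQuadDiffOf f η q ∧
    ∀ (p : M) (X : TangentSpace (𝓡 2) p), (∀ Y, q p X Y = 0) → X = 0

/-! ### The middle potential -/

/-- Over the open set `U`, the sections `σ₁`, `σ₂` are lifts of two distinct curvature sphere
congruences of `f`, and `X`, `Y` are nowhere zero sections of their respective curvature
subbundles. -/
structure IsCurvatureFrame [IsManifold (𝓡 2) ∞ M] (f : M → Submodule ℝ R42) (U : Set M) (σ₁ σ₂ : M → R42)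
    (X Y : (p : M) → TangentSpace (𝓡 2) p) : Prop where
  isOpen : IsOpen U
  section₁ : IsSectionOn f U σ₁
  section₂ : IsSectionOn f U σ₂
  indep : ∀ p ∈ U, LinearIndependent ℝ ![σ₁ p, σ₂ p]
  smoothX : ContMDiffOn (𝓡 2) (𝓡 2).tangent ∞ (fun p => (⟨p, X p⟩ : TangentBundle (𝓡 2) M)) U
  smoothY : ContMDiffOn (𝓡 2) (𝓡 2).tangent ∞ (fun p => (⟨p, Y p⟩ : TangentBundle (𝓡 2) M)) U
  neX : ∀ p ∈ U, X p ≠ 0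
  neY : ∀ p ∈ U, Y p ≠ 0
  killsX : ∀ p ∈ U, SolderKills f p (X p) (σ₁ p)
  killsY : ∀ p ∈ U, SolderKills f p (Y p) (σ₂ p)

/-- The fibre at `p` of `⟨σ, d_Z σ, d_Z d_Z σ⟩`. -/
def cyclideSpace (σ : M → R42) (Z : (p : M) → TangentSpace (𝓡 2) p) (p : M) :
    Submodule ℝ R42 :=
  Submodule.span ℝ {σ p, dd σ p (Z p), dd (fun x => dd σ x (Z x)) p (Z p)}

/-- The `𝔪`-part of `η` takes values in `∧² f`, where `𝔥 = S₁∧S₁ ⊕ S₂∧S₂` and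
`𝔪 = S₁∧S₂` are formed from the Lie cyclide splitting `S₁ ⊕ S₂`
(which does not depend on the curvature frame). -/
def IsMiddle [IsManifold (𝓡 2) ∞ M] (f : M → Submodule ℝ R42) (η : OneForm M) : Prop :=
  ∀ p : M, ∃ (U : Set M) (σ₁ σ₂ : M → R42) (X Y : (p : M) → TangentSpace (𝓡 2) p),
    p ∈ U ∧ IsCurvatureFrame f U σ₁ σ₂ X Y ∧
    ∀ x ∈ U, ∀ Z : TangentSpace (𝓡 2) x,
      ∃ h ∈ wedgeSpan (cyclideSpace σ₁ Y x) (cyclideSpace σ₁ Y x) ⊔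
          wedgeSpan (cyclideSpace σ₂ X x) (cyclideSpace σ₂ X x),
      ∃ m ∈ wedgeSpan (cyclideSpace σ₁ Y x) (cyclideSpace σ₂ X x),
        η x Z = h + m ∧ m ∈ wedgeSpan (f x) (f x)

/-! ### Polynomial conserved quantities -/

/-- The value `p(t)` of the polynomial with coefficients `p 0, …, p d`. -/
def polyEval (d : ℕ) (p : ℕ → M → R42) (t : ℝ) (x : M) : R42 :=
  ∑ k ∈ Finset.range (d + 1), t ^ k • p k x

/-- `p` is a polynomial conserved quantity of degree `d` of the pencil `d + t η`. -/
structure IsConservedQuantity (η : OneForm M) (d : ℕ) (p : ℕ → M → R42) : Prop where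
  smooth : ∀ k, ContMDiff (𝓡 2) 𝓘(ℝ, R42) ∞ (p k)
  degree_le : ∀ k, d < k → p k = 0
  leading : p d ≠ 0
  parallel : ∀ (t : ℝ) (x : M) (X : TangentSpace (𝓡 2) x),
    dd (polyEval d p t) x X + t • η x X (polyEval d p t x) = 0

/-- `f` is a special `Ω`-surface of type `d`, and `p` is a polynomial conserved quantity of
degree `d` of its middle pencil. -/
def IsSpecialOmega [IsManifold (𝓡 2) ∞ M] (f : M → Submodule ℝ R42) (d : ℕ)
    (p : ℕ → M → R42) : Prop :=
  IsLegendre f ∧ UmbilicFree f ∧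
    ∃ η : OneForm M, IsOmegaPotential f η ∧ IsMiddle f η ∧ IsConservedQuantity η d p

/-! ### Laguerre geometry and `L`-isothermic surfaces -/

/-- The choices that identify the Laguerre geometry of the lightlike vector `qinf` with that
of Euclidean space `⟨qinf, q0, pt⟩^⊥ ≅ ℝ³`. -/
structure IsLaguerreFrame (qinf q0 pt : R42) : Prop where
  null_inf : form qinf qinf = 0
  null_zero : form q0 q0 = 0
  pairing : form q0 qinf = -1
  perp_inf : form pt qinf = 0
  perp_zero : form pt q0 = 0
  timelike : form pt pt = -1

/-- `f` projects to `x : M → ℝ³` with unit normal `n`: the space form projection of `f` is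
`x + q0 + (x,x)/2 qinf` and its tangent plane congruence is `n + pt + (n,x) qinf`. -/
structure IsEuclideanProjection (f : M → Submodule ℝ R42) (qinf q0 pt : R42)
    (x n : M → R42) : Prop where
  smooth_x : ContMDiff (𝓡 2) 𝓘(ℝ, R42) ∞ x
  smooth_n : ContMDiff (𝓡 2) 𝓘(ℝ, R42) ∞ n
  x_mem : ∀ p, x p ∈ perp (Submodule.span ℝ {qinf, q0, pt})
  n_mem : ∀ p, n p ∈ perp (Submodule.span ℝ {qinf, q0, pt})
  unit : ∀ p, form (n p) (n p) = 1
  point_mem : ∀ p, x p + q0 + (form (x p) (x p) / 2) • qinf ∈ f p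
  plane_mem : ∀ p, n p + pt + form (n p) (x p) • qinf ∈ f p

/-- The second fundamental form `-(dx, dn)`. -/
def secondFF (x n : M → R42) : TwoTensor M := fun p X Y => -form (dd x p X) (dd n p Y)

/-- The third fundamental form `(dn, dn)`. -/
def thirdFF (n : M → R42) : TwoTensor M := fun p X Y => form (dd n p X) (dd n p Y)

/-- `z` is a complex coordinate on the open set `U` with `g = e^{2u} dz dz̄`. -/
structure IsConformalCoordinate (g : TwoTensor M) (U : Set M) (z : M → ℂ) : Prop where
  isOpen : IsOpen U
  smooth : ContMDiffOn (𝓡 2) 𝓘(ℝ, ℂ) ∞ z U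
  injOn : Set.InjOn z U
  bijective : ∀ p ∈ U, Function.Bijective (fun X : TangentSpace (𝓡 2) p => dd z p X)
  conformal : ∃ u : M → ℝ, ∀ p ∈ U, ∀ X Y : TangentSpace (𝓡 2) p,
    g p X Y = Real.exp (2 * u p) * (dd z p X * (starRingEnd ℂ) (dd z p Y)).re

/-- The quadratic differential `q` is holomorphic for `g`: locally there is a complex
coordinate `z` with `g = e^{2u} dz dz̄`, `q^{1,1} = 0` and `q^{2,0} = dz²`,
that is, `q = dz² + dz̄²`. -/
def IsHolomorphicFor (g q : TwoTensor M) : Prop :=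
  ∀ p : M, ∃ (U : Set M) (z : M → ℂ), p ∈ U ∧ IsConformalCoordinate g U z ∧
    ∀ x ∈ U, ∀ X Y : TangentSpace (𝓡 2) x, q x X Y = 2 * (dd z x X * dd z x Y).re

/-- `B (∂/∂z, ∂/∂z)`, where `∂/∂z = (a - i b) / 2` and `B` is extended complex bilinearly. -/
def coeffZZ (B : TwoTensor M) (p : M) (a b : TangentSpace (𝓡 2) p) : ℂ :=
  (((B p a a - B p b b : ℝ) : ℂ) - Complex.I * ((B p a b + B p b a : ℝ) : ℂ)) / 4

/-- `B^{2,0} = μ q^{2,0}` for a real-valued function `μ`, the bidegrees being those of the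
complex structure induced by `g`; here `a = ∂/∂(Re z)` and `b = ∂/∂(Im z)`. -/
def CommutesWith (g q B : TwoTensor M) : Prop :=
  ∃ μ : M → ℝ, ∀ (U : Set M) (z : M → ℂ), IsConformalCoordinate g U z →
    ∀ x ∈ U, ∀ a b : TangentSpace (𝓡 2) x, dd z x a = 1 → dd z x b = Complex.I →
      coeffZZ B x a b = (μ x : ℂ) * coeffZZ q x a b

/-- `f` projects to an `L`-isothermic surface in the Euclidean space of the frame. -/
def IsLIsothermic (f : M → Submodule ℝ R42) (qinf q0 pt : R42) : Prop :=
  ∃ x n : M → R42, IsEuclideanProjection f qinf q0 pt x n ∧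
    ∃ q : TwoTensor M, IsHolomorphicFor (thirdFF n) q ∧
      CommutesWith (thirdFF n) q (secondFF x n)

end Surface

end LieSphere

end

noncomputable section

namespace LieSphere

/-! Write `β₁ = (dσ₁, E₁)` and `β₂ = (dσ₂, E₂)`, where `σ₁`, `σ₂` lift the curvature spheres and
`E₁`, `E₂` are unit vectors of `f^⊥` along the derivatives of `σ₁`, `σ₂` modulo `f`. Since `f^⊥/f`
is positive definite, lightlike vectors of `f^⊥` lie in `f`, and derivatives of sections modulo `f`
are tensorial; most pointwise arguments rest on these two facts.

From conserved quantity to `L`-isothermic. The Lie cyclides `S₁`, `S₂` are orthogonal, so a middle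
potential maps `Eᵢ` to a multiple of `σᵢ`. Differentiating `η σᵢ = 0`, closedness forces that
multiple to be proportional to `βᵢ` (Cartan's lemma), and non-degeneracy makes the factor non-zero.
Rescaling `σᵢ` gives `η = ε₁ β₁ σ₁∧E₁ + ε₂ β₂ σ₂∧E₂ + c σ₁∧σ₂` with signs `εᵢ` and a scalar one-form
`c` (`exists_normalFrame`). Closedness of `η` then makes `β₁` and `β₂` closed, so `dz = β₂ + i β₁`
defines curvature line coordinates.

Let `q = p₀`, which is constant. Nullity of `p(t)` gives `(q,q) = (p₁,q) = (p₁,p₁) = 0`; with `η p₁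
= 0` this puts `p₁` in `f`, and `dp₁ = -η q` gives `p₁ = -ε₁(σ₁,q)σ₁ - ε₂(σ₂,q)σ₂`. In particular `q
≠ 0`, since otherwise `p₁ = 0`. Pairing with `q` yields `ε₁(σ₁,q)² + ε₂(σ₂,q)² = 0`. Equal signs
would put the constant `q` in `f` on an open set, which the immersion condition forbids; so the
signs are opposite and `(σ₁,q)² = (σ₂,q)²`. This function satisfies `|dF| ≤ K F`, so a single zero
would spread to an open set; hence `q` is never in `f` (`not_mem_of_sq_eq`) and `f` projects to
Euclidean space. The section `τ` of `f` representing the tangent planes is orthogonal to `q`, so its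
coefficients in `σ₁`, `σ₂` have equal squares: the third fundamental form is a multiple of `|dz|²`,
the second one is diagonal, and the quadratic differential of `η` is `Re dz²`.

From `L`-isothermic to conserved quantity. Let `ρ`, `τ` be the sections representing points and
tangent planes, `z` the given coordinate with partial derivatives `u`, `v`, and `E = e^{2u}` the
conformal factor of the third fundamental form (here `u` is its logarithmic exponent). The commuting
condition gives `ρ_u = -r₁ τ_u` and `ρ_v = -r₂ τ_v`, and umbilic-freeness gives `r₁ ≠ r₂`. With `C =
1/(E(r₁-r₂))`, the form `η = d(C ρ∧τ) - τ ∧ E⁻¹(τ_u du - τ_v dv)` is closed, because the bracketed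
form is the closed Christoffel dual of `dτ` (`mixed_deriv`, `closed_isothermicForm`). Expanding it
in `ρ + r₁τ`, `ρ + r₂τ` shows that it is a middle potential, and `η q = -d(Cτ)`, `η τ = 0` make `q +
t C τ` a conserved quantity. Both `C` and `η` have coordinate-free descriptions, so they are global.
-/

theorem form_apply (x y : R42) :
    form x y = x 0 * y 0 + x 1 * y 1 + x 2 * y 2 + x 3 * y 3 - x 4 * y 4 - x 5 * y 5 := rfl

theorem form_comm (x y : R42) : form x y = form y x := by
  simp only [form_apply]; ring

theorem wedge_apply (a b c : R42) : wedge a b c = form a c • b - form b c • a := rfl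

/-- `form` as a continuous bilinear map. -/
def formL : R42 →L[ℝ] R42 →L[ℝ] ℝ :=
  LinearMap.toContinuousLinearMap
    ((LinearMap.toContinuousLinearMap (𝕜 := ℝ) (E := R42) (F' := ℝ)).toLinearMap ∘ₗ form)

@[simp] theorem formL_apply (x y : R42) : formL x y = form x y := rfl

theorem wedge_add_left (a a' b : R42) : wedge (a + a') b = wedge a b + wedge a' b := by
  ext c i; simp [wedge_apply]; ring

theorem wedge_add_right (a b b' : R42) : wedge a (b + b') = wedge a b + wedge a b' := by
  ext c i; simp [wedge_apply]; ring

theorem wedge_smul_left (r : ℝ) (a b : R42) : wedge (r • a) b = r • wedge a b := by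
  ext c i; simp [wedge_apply]; ring

theorem wedge_smul_right (r : ℝ) (a b : R42) : wedge a (r • b) = r • wedge a b := by
  ext c i; simp [wedge_apply]; ring

theorem wedge_swap (a b : R42) : wedge a b = -wedge b a := by
  ext c i; simp [wedge_apply]

theorem wedge_self (a : R42) : wedge a a = 0 := by
  ext c i; simp [wedge_apply]

/-- `wedge` as a continuous bilinear map. -/
def wedgeL : R42 →L[ℝ] R42 →L[ℝ] (R42 →L[ℝ] R42) :=
  LinearMap.toContinuousLinearMap (𝕜 := ℝ) (E := R42) (F' := R42 →L[ℝ] (R42 →L[ℝ] R42))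
    { toFun := fun a => LinearMap.toContinuousLinearMap (𝕜 := ℝ) (E := R42) (F' := R42 →L[ℝ] R42)
        { toFun := wedge a
          map_add' := wedge_add_right a
          map_smul' := fun r b => wedge_smul_right r a b }
      map_add' := fun a a' => by ext1 b; exact wedge_add_left a a' b
      map_smul' := fun r a => by ext1 b; exact wedge_smul_left r a b }

@[simp] theorem wedgeL_apply (a b : R42) : wedgeL a b = wedge a b := rfl

theorem mem_perp {W : Submodule ℝ R42} {v : R42} : v ∈ perp W ↔ ∀ w ∈ W, form w v = 0 :=
  LinearMap.BilinForm.mem_orthogonal_iff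

theorem form_nondegenerate : form.Nondegenerate := by
  have key : ∀ x : R42, (∀ y, form x y = 0) → x = 0 := by
    intro x hx
    ext i
    have := hx (Pi.single i 1)
    rw [form_apply] at this
    fin_cases i <;> simpa [Pi.single_apply] using this
  exact ⟨key, fun y hy => key y fun x => by rw [form_comm]; exact hy x⟩

/-! ### Linear algebra of isotropic planes and of `f ∧ f^⊥` -/

/-- An isotropic plane of `ℝ^{4,2}`, that is, a contact element. -/
structure IsotropicPlane (f : Submodule ℝ R42) : Prop where
  isotropic : ∀ v ∈ f, ∀ w ∈ f, form v w = 0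
  rank_two : Module.finrank ℝ f = 2

namespace IsotropicPlane

variable {f : Submodule ℝ R42}

theorem le_perp (h : IsotropicPlane f) : f ≤ perp f := fun _ hv =>
  mem_perp.2 fun _ hw => h.isotropic _ hw _ hv

/-- The timelike coordinates identify an isotropic plane with `ℝ²`. -/
theorem exists_timelike_eq (h : IsotropicPlane f) (v : R42) : ∃ w ∈ f, w 4 = v 4 ∧ w 5 = v 5 := by
  let π : f →ₗ[ℝ] (Fin 2 → ℝ) :=
    LinearMap.pi ![(LinearMap.proj 4).comp f.subtype, (LinearMap.proj 5).comp f.subtype]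
  have h4 (w : f) : π w 0 = (w : R42) 4 := rfl
  have h5 (w : f) : π w 1 = (w : R42) 5 := rfl
  have hinj : Function.Injective π := by
    rw [injective_iff_map_eq_zero]
    intro w hw
    have e4 : (w : R42) 4 = 0 := by rw [← h4, hw]; rfl
    have e5 : (w : R42) 5 = 0 := by rw [← h5, hw]; rfl
    have := h.isotropic w w.2 w w.2
    rw [form_apply, e4, e5] at this
    have e0 : (w : R42) 0 = 0 := by
      nlinarith [sq_nonneg ((w : R42) 0), sq_nonneg ((w : R42) 1), sq_nonneg ((w : R42) 2),
        sq_nonneg ((w : R42) 3)]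
    have e1 : (w : R42) 1 = 0 := by
      nlinarith [sq_nonneg ((w : R42) 0), sq_nonneg ((w : R42) 1), sq_nonneg ((w : R42) 2),
        sq_nonneg ((w : R42) 3)]
    have e2 : (w : R42) 2 = 0 := by
      nlinarith [sq_nonneg ((w : R42) 0), sq_nonneg ((w : R42) 1), sq_nonneg ((w : R42) 2),
        sq_nonneg ((w : R42) 3)]
    have e3 : (w : R42) 3 = 0 := by
      nlinarith [sq_nonneg ((w : R42) 0), sq_nonneg ((w : R42) 1), sq_nonneg ((w : R42) 2),
        sq_nonneg ((w : R42) 3)]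
    ext i
    fin_cases i <;> simp [e0, e1, e2, e3, e4, e5]
  have hsurj : Function.Surjective π :=
    (LinearMap.injective_iff_surjective_of_finrank_eq_finrank (by simp [h.rank_two])).1 hinj
  obtain ⟨w, hw⟩ := hsurj ![v 4, v 5]
  exact ⟨w, w.2, by rw [← h4, hw]; rfl, by rw [← h5, hw]; rfl⟩

/-- Subtract from `v` the element `w` of `f` with the same two timelike coordinates. Since `w` is
null and orthogonal to `v`, the difference has the same square as `v`, and it is purely spacelike.
-/
theorem exists_form_self_eq (h : IsotropicPlane f) {v : R42} (hv : v ∈ perp f) :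
    ∃ w ∈ f, form v v = (v 0 - w 0) ^ 2 + (v 1 - w 1) ^ 2 + (v 2 - w 2) ^ 2 + (v 3 - w 3) ^ 2 ∧
      w 4 = v 4 ∧ w 5 = v 5 := by
  obtain ⟨w, hw, e4, e5⟩ := h.exists_timelike_eq v
  refine ⟨w, hw, ?_, e4, e5⟩
  have h1 := h.isotropic w hw w hw
  have h2 := mem_perp.1 hv w hw
  rw [form_apply] at *
  rw [e4, e5] at h1 h2
  linear_combination 2 * h2 - h1

theorem form_self_nonneg (h : IsotropicPlane f) {v : R42} (hv : v ∈ perp f) : 0 ≤ form v v := by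
  obtain ⟨w, -, e, -⟩ := h.exists_form_self_eq hv
  rw [e]; positivity

/-- The form induced on `f^⊥/f` is definite. This is the standard means, in what follows, of showing
that a vector lies in `f`. -/
theorem mem_of_form_self_eq_zero (h : IsotropicPlane f) {v : R42} (hv : v ∈ perp f)
    (h0 : form v v = 0) : v ∈ f := by
  obtain ⟨w, hw, e, e4, e5⟩ := h.exists_form_self_eq hv
  rw [h0] at e
  have e0 : v 0 - w 0 = 0 := by
    nlinarith [sq_nonneg (v 0 - w 0), sq_nonneg (v 1 - w 1), sq_nonneg (v 2 - w 2),
      sq_nonneg (v 3 - w 3)]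
  have e1 : v 1 - w 1 = 0 := by
    nlinarith [sq_nonneg (v 0 - w 0), sq_nonneg (v 1 - w 1), sq_nonneg (v 2 - w 2),
      sq_nonneg (v 3 - w 3)]
  have e2 : v 2 - w 2 = 0 := by
    nlinarith [sq_nonneg (v 0 - w 0), sq_nonneg (v 1 - w 1), sq_nonneg (v 2 - w 2),
      sq_nonneg (v 3 - w 3)]
  have e3 : v 3 - w 3 = 0 := by
    nlinarith [sq_nonneg (v 0 - w 0), sq_nonneg (v 1 - w 1), sq_nonneg (v 2 - w 2),
      sq_nonneg (v 3 - w 3)]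
  have : v = w := by
    ext i
    fin_cases i <;> simp <;> linarith
  rwa [this]

theorem form_self_pos (h : IsotropicPlane f) {v : R42} (hv : v ∈ perp f) (hf : v ∉ f) :
    0 < form v v :=
  lt_of_le_of_ne (h.form_self_nonneg hv) fun e => hf (h.mem_of_form_self_eq_zero hv e.symm)

theorem finrank_perp (h : IsotropicPlane f) : Module.finrank ℝ (perp f) = 4 := by
  have := LinearMap.BilinForm.finrank_orthogonal form_nondegenerate f
  rw [perp, this, h.rank_two]; simp

/-- `f^⊥ / f` is spanned by two orthogonal non-null vectors. -/
theorem sub_proj_mem (h : IsotropicPlane f) {A B v : R42} (hA : A ∈ perp f) (hB : B ∈ perp f)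
    (hv : v ∈ perp f) (hAA : form A A ≠ 0) (hBB : form B B ≠ 0) (hAB : form A B = 0) :
    v - (form v A / form A A) • A - (form v B / form B B) • B ∈ f := by
  have hind : LinearIndependent ℝ ![A, B] := by
    rw [LinearIndependent.pair_iff]
    intro a b hab
    constructor
    · have := congrArg (form A) hab
      simpa [hAB, hAA] using this
    · have := congrArg (form B) hab
      simpa [form_comm B A, hAB, hBB] using this
  have hfin : Module.finrank ℝ (Submodule.span ℝ (Set.range ![A, B])) = 2 := by
    rw [finrank_span_eq_card hind]; rfl
  have hr : Set.range ![A, B] = {A, B} := by simp [Set.pair_comm]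
  rw [hr] at hfin
  have hfA : ∀ w ∈ f, form w A = 0 := mem_perp.1 hA
  have hfB : ∀ w ∈ f, form w B = 0 := mem_perp.1 hB
  -- `f` and `⟨A, B⟩` meet trivially, so by dimension, `2 + 2 = 4`, they fill `f^⊥`.
  have hinf : f ⊓ Submodule.span ℝ {A, B} = ⊥ := by
    rw [Submodule.eq_bot_iff]
    rintro x ⟨hx, hx'⟩
    obtain ⟨a, b, rfl⟩ := Submodule.mem_span_pair.1 hx'
    have h1 := hfA _ hx
    have h2 := hfB _ hx
    simp only [map_add, map_smul, LinearMap.add_apply, LinearMap.smul_apply, smul_eq_mul, hAB,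
      form_comm B A, mul_zero, add_zero, zero_add, mul_eq_zero, hAA, hBB, or_false] at h1 h2
    simp [h1, h2]
  have hle : f ⊔ Submodule.span ℝ {A, B} ≤ perp f := by
    refine sup_le h.le_perp (Submodule.span_le.2 ?_)
    rintro x (rfl | rfl) <;> assumption
  have hsup := Submodule.finrank_sup_add_finrank_inf_eq f (Submodule.span ℝ {A, B})
  rw [hinf, hfin, h.rank_two, finrank_bot] at hsup
  have heq := Submodule.eq_of_le_of_finrank_eq hle (by rw [h.finrank_perp]; omega)
  rw [← heq] at hv
  obtain ⟨w, hw, u, hu, rfl⟩ := Submodule.mem_sup.1 hv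
  obtain ⟨a, b, rfl⟩ := Submodule.mem_span_pair.1 hu
  convert! hw using 1
  simp only [map_add, map_smul, LinearMap.add_apply, LinearMap.smul_apply, smul_eq_mul, hAB,
    form_comm B A, hfA w hw, hfB w hw, mul_zero, add_zero, zero_add, mul_div_cancel_right₀ _ hAA,
    mul_div_cancel_right₀ _ hBB]
  abel

/-- An element of `f ∧ f^⊥` pairs vectors of `f` only with vectors orthogonal to them. Its action on
`f^⊥` therefore depends on classes modulo `f` only. -/
theorem wedgeSpan_apply_eq_zero {T : R42 →L[ℝ] R42} (h : IsotropicPlane f)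
    (hT : T ∈ wedgeSpan f (perp f)) {v : R42} (hv : v ∈ f) : T v = 0 := by
  induction hT using Submodule.span_induction with
  | mem T hT =>
    obtain ⟨a, ha, b, hb, rfl⟩ := hT
    rw [wedge_apply, h.isotropic _ ha _ hv, form_comm, mem_perp.1 hb _ hv]; simp
  | zero => rfl
  | add T S _ _ hT hS => simp [hT, hS]
  | smul r T _ hT => simp [hT]

theorem wedgeSpan_apply_mem {T : R42 →L[ℝ] R42}
    (hT : T ∈ wedgeSpan f (perp f)) {v : R42} (hv : v ∈ perp f) : T v ∈ f := by
  induction hT using Submodule.span_induction with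
  | mem T hT =>
    obtain ⟨a, ha, b, hb, rfl⟩ := hT
    rw [wedge_apply, mem_perp.1 hv _ ha, zero_smul, zero_sub]
    exact f.neg_mem (f.smul_mem _ ha)
  | zero => exact f.zero_mem
  | add T S _ _ hT hS => exact f.add_mem hT hS
  | smul r T _ hT => exact f.smul_mem _ hT

theorem wedgeSpan_self_apply_eq_zero {T : R42 →L[ℝ] R42}
    (hT : T ∈ wedgeSpan f f) {v : R42} (hv : v ∈ perp f) : T v = 0 := by
  induction hT using Submodule.span_induction with
  | mem T hT =>
    obtain ⟨a, ha, b, hb, rfl⟩ := hT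
    rw [wedge_apply, mem_perp.1 hv _ ha, mem_perp.1 hv _ hb]; simp
  | zero => rfl
  | add T S _ _ hT hS => simp [hT, hS]
  | smul r T _ hT => simp [hT]

theorem of_span {a b : R42} (haa : form a a = 0) (hab : form a b = 0) (hbb : form b b = 0)
    (hind : LinearIndependent ℝ ![a, b]) : IsotropicPlane (Submodule.span ℝ {a, b}) := by
  constructor
  · intro v hv w hw
    obtain ⟨x, y, rfl⟩ := Submodule.mem_span_pair.1 hv
    obtain ⟨x', y', rfl⟩ := Submodule.mem_span_pair.1 hw
    simp [haa, hab, hbb, form_comm b a]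
  · have hr : Set.range ![a, b] = {a, b} := by simp [Set.pair_comm]
    rw [← hr, finrank_span_eq_card hind]; rfl

theorem span_eq (h : IsotropicPlane f) {a b : R42} (ha : a ∈ f) (hb : b ∈ f)
    (hind : LinearIndependent ℝ ![a, b]) : f = Submodule.span ℝ {a, b} := by
  symm
  apply Submodule.eq_of_le_of_finrank_eq
  · rw [Submodule.span_le]; rintro x (rfl | rfl) <;> assumption
  · rw [h.rank_two, (of_span (h.isotropic _ ha _ ha) (h.isotropic _ ha _ hb)
      (h.isotropic _ hb _ hb) hind).rank_two]

theorem mem_perp_span_pair {a b v : R42} :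
    v ∈ perp (Submodule.span ℝ {a, b}) ↔ form a v = 0 ∧ form b v = 0 := by
  rw [mem_perp]
  constructor
  · exact fun h => ⟨h _ (Submodule.subset_span (by simp)), h _ (Submodule.subset_span (by simp))⟩
  · rintro ⟨h1, h2⟩ w hw
    obtain ⟨x, y, rfl⟩ := Submodule.mem_span_pair.1 hw
    simp [h1, h2]

/-- Normal form of an element of `f ∧ f^⊥` with prescribed values on an orthonormal basis of
`f^⊥ / f`. -/
theorem eq_of_wedgeSpan (h : IsotropicPlane f) {T : R42 →L[ℝ] R42}
    (hT : T ∈ wedgeSpan f (perp f)) {σ₁ σ₂ E₁ E₂ : R42} (h₁ : σ₁ ∈ f) (h₂ : σ₂ ∈ f)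
    (hind : LinearIndependent ℝ ![σ₁, σ₂]) (hE₁ : E₁ ∈ perp f) (hE₂ : E₂ ∈ perp f)
    (h11 : form E₁ E₁ = 1) (h22 : form E₂ E₂ = 1) (h12 : form E₁ E₂ = 0) {a b : ℝ}
    (ha : T E₁ = -a • σ₁) (hb : T E₂ = -b • σ₂) :
    ∃ c : ℝ, T = a • wedge σ₁ E₁ + b • wedge σ₂ E₂ + c • wedge σ₁ σ₂ := by
  -- `f ∧ f^⊥` is spanned by five wedges of basis vectors. The prescribed values on `E₁`, `E₂` fix
  -- every coefficient except that of `σ₁ ∧ σ₂`, which annihilates `f^⊥`.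
  have key : ∃ x₁ x₂ y₁ y₂ c : ℝ, T = x₁ • wedge σ₁ E₁ + x₂ • wedge σ₂ E₁ + y₁ • wedge σ₁ E₂ +
      y₂ • wedge σ₂ E₂ + c • wedge σ₁ σ₂ := by
    clear ha hb
    induction hT using Submodule.span_induction with
    | mem T hT =>
      obtain ⟨u, hu, v, hv, rfl⟩ := hT
      have hm := h.sub_proj_mem hE₁ hE₂ hv (by simp [h11]) (by simp [h22]) h12
      rw [h.span_eq h₁ h₂ hind] at hm hu
      obtain ⟨r, s, hrs⟩ := Submodule.mem_span_pair.1 hm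
      obtain ⟨k, l, rfl⟩ := Submodule.mem_span_pair.1 hu
      rw [h11, h22, div_one, div_one] at hrs
      have : v = r • σ₁ + s • σ₂ + form v E₁ • E₁ + form v E₂ • E₂ := by rw [hrs]; abel
      refine ⟨k * form v E₁, l * form v E₁, k * form v E₂, l * form v E₂, k * s - l * r, ?_⟩
      generalize form v E₁ = m at this ⊢
      generalize form v E₂ = n at this ⊢
      rw [this]
      simp only [wedge_add_left, wedge_add_right, wedge_smul_left, wedge_smul_right, wedge_self,
        wedge_swap σ₂ σ₁]
      module
    | zero => exact ⟨0, 0, 0, 0, 0, by simp⟩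
    | add T S _ _ hT hS =>
      obtain ⟨x₁, x₂, y₁, y₂, c, rfl⟩ := hT
      obtain ⟨x₁', x₂', y₁', y₂', c', rfl⟩ := hS
      exact ⟨x₁ + x₁', x₂ + x₂', y₁ + y₁', y₂ + y₂', c + c', by module⟩
    | smul r T _ hT =>
      obtain ⟨x₁, x₂, y₁, y₂, c, rfl⟩ := hT
      exact ⟨r * x₁, r * x₂, r * y₁, r * y₂, r * c, by module⟩
  obtain ⟨x₁, x₂, y₁, y₂, c, hT'⟩ := key
  have hp : ∀ s ∈ f, form s E₁ = 0 ∧ form s E₂ = 0 := fun s hs =>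
    ⟨mem_perp.1 hE₁ _ hs, mem_perp.1 hE₂ _ hs⟩
  rw [LinearIndependent.pair_iff] at hind
  have e1 : x₁ = a ∧ x₂ = 0 := by
    rw [hT'] at ha
    simp only [_root_.add_apply, _root_.smul_apply, wedge_apply,
      (hp _ h₁).1, (hp _ h₂).1, h11, form_comm E₂ E₁, h12] at ha
    have := hind (a - x₁) (-x₂) (by linear_combination (norm := module) ha)
    constructor <;> linarith [this.1, this.2]
  have e2 : y₁ = 0 ∧ y₂ = b := by
    rw [hT'] at hb
    simp only [_root_.add_apply, _root_.smul_apply, wedge_apply,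
      (hp _ h₁).2, (hp _ h₂).2, h22, h12] at hb
    have := hind (-y₁) (b - y₂) (by linear_combination (norm := module) hb)
    constructor <;> linarith [this.1, this.2]
  refine ⟨c, ?_⟩
  rw [hT', e1.1, e1.2, e2.1, e2.2]
  module

end IsotropicPlane

/-- In a Laguerre geometry, the lightlike vectors orthogonal to the point sphere complex are
multiples of the vector at infinity. -/
theorem IsLaguerreFrame.exists_eq_smul {qinf q0 pt v : R42} (h : IsLaguerreFrame qinf q0 pt)
    (hv : form v v = 0) (hq : form v qinf = 0) (hp : form v pt = 0) : ∃ c : ℝ, v = c • qinf := by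
  by_contra! hne
  have hind : LinearIndependent ℝ ![v, qinf] := by
    rw [LinearIndependent.pair_iff]
    intro s t hst
    have hs : s = 0 := by
      by_contra hs
      apply hne (-t / s)
      have : v = s⁻¹ • (s • v) := by rw [smul_smul, inv_mul_cancel₀ hs, one_smul]
      rw [this, eq_neg_of_add_eq_zero_left hst, smul_neg, smul_smul, ← neg_smul]
      congr 1; field_simp
    refine ⟨hs, ?_⟩
    have := congrArg (form q0) hst
    simpa [hs, h.pairing] using this
  -- If `v` were independent of `qinf`, the two would span an isotropic plane with the timelike
  -- vector `pt` in its orthogonal complement, where the form is non-negative.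
  have hpl := IsotropicPlane.of_span hv hq h.null_inf hind
  have := hpl.form_self_nonneg (v := pt)
    (IsotropicPlane.mem_perp_span_pair.2 ⟨hp, by rw [form_comm]; exact h.perp_inf⟩)
  rw [h.timelike] at this
  linarith

/-! ### Charts, derivatives and closed one-forms -/

theorem isOpen_chart_inter {M E : Type*} [TopologicalSpace M] [TopologicalSpace E] {U : Set M}
    (e : OpenPartialHomeomorph M E)
    (hU : IsOpen U) : IsOpen (e.target ∩ e.symm ⁻¹' U) :=
  e.symm.continuousOn.isOpen_inter_preimage e.open_target hU

theorem mem_chart_inter {M E : Type*} [TopologicalSpace M] [TopologicalSpace E] {U : Set M}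
    (e : OpenPartialHomeomorph M E) {x : M}
    (hx : x ∈ e.source) (hxU : x ∈ U) : e x ∈ e.target ∩ e.symm ⁻¹' U :=
  ⟨e.map_source hx, by rwa [Set.mem_preimage, e.left_inv hx]⟩

section Pullback

variable {E E' F : Type*} [NormedAddCommGroup E] [NormedSpace ℝ E] [NormedAddCommGroup E']
  [NormedSpace ℝ E'] [NormedAddCommGroup F] [NormedSpace ℝ F]

theorem fderiv_fderiv_symm {g : E → F} {y : E} (hg : ContDiffAt ℝ ∞ g y) (v w : E) :
    fderiv ℝ (fderiv ℝ g) y v w = fderiv ℝ (fderiv ℝ g) y w v :=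
  (hg.isSymmSndFDerivAt (by
    rw [minSmoothness_of_isRCLikeNormedField]; exact WithTop.coe_le_coe.2 le_top)) v w

/-- The pull-back of a closed one-form is closed. -/
theorem closed_pullback {g : E → E'} {θ : E' → E' →L[ℝ] F} {θ' : E → E →L[ℝ] F} {y : E}
    (hg : ContDiffAt ℝ ∞ g y) (hθ : DifferentiableAt ℝ θ (g y))
    (hclosed : ∀ X Y, fderiv ℝ θ (g y) X Y = fderiv ℝ θ (g y) Y X)
    (hθ' : θ' =ᶠ[𝓝 y] fun y => (θ (g y)).comp (fderiv ℝ g y)) (X Y : E) :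
    fderiv ℝ θ' y X Y = fderiv ℝ θ' y Y X := by
  have hd : DifferentiableAt ℝ (fderiv ℝ g) y :=
    (hg.fderiv_right (m := ∞) le_rfl).differentiableAt (by simp)
  have hgd : DifferentiableAt ℝ g y := hg.differentiableAt (by simp)
  have h1 : HasFDerivAt (fun y => θ (g y)) ((fderiv ℝ θ (g y)).comp (fderiv ℝ g y)) y :=
    hθ.hasFDerivAt.comp y hgd.hasFDerivAt
  have h2 := h1.clm_comp hd.hasFDerivAt
  rw [hθ'.fderiv_eq, h2.fderiv]
  simp [fderiv_fderiv_symm hg X Y, hclosed (fderiv ℝ g y X)]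

theorem hasFDerivAt_form {a b : E → R42} {y : E} (ha : DifferentiableAt ℝ a y)
    (hb : DifferentiableAt ℝ b y) (v : E) :
    fderiv ℝ (fun y => form (a y) (b y)) y v =
      form (fderiv ℝ a y v) (b y) + form (a y) (fderiv ℝ b y v) := by
  have := (formL.hasFDerivAt_of_bilinear ha.hasFDerivAt hb.hasFDerivAt).fderiv
  simp only [formL_apply] at this
  rw [this]
  simp [add_comm]

end Pullback

section Charts

variable {M : Type*} [TopologicalSpace M] [ChartedSpace Plane M]
variable {E : Type*} [NormedAddCommGroup E] [NormedSpace ℝ E]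
variable {F : Type*} [NormedAddCommGroup F] [NormedSpace ℝ F]

/-- A diffeomorphism between an open subset of a surface and an open subset of a normed space. -/
structure IsSmoothChart (e : OpenPartialHomeomorph M E) : Prop where
  smooth : ContMDiffOn (𝓡 2) 𝓘(ℝ, E) ∞ e e.source
  smooth_symm : ContMDiffOn 𝓘(ℝ, E) (𝓡 2) ∞ e.symm e.target

theorem isSmoothChart_chartAt [IsManifold (𝓡 2) ∞ M] (p : M) :
    IsSmoothChart (chartAt Plane p) :=
  ⟨contMDiffOn_chart, contMDiffOn_chart_symm⟩

namespace IsSmoothChart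

variable {e : OpenPartialHomeomorph M E}

theorem mdifferentiable (he : IsSmoothChart e) : e.MDifferentiable (𝓡 2) 𝓘(ℝ, E) :=
  ⟨he.smooth.mdifferentiableOn (by simp), he.smooth_symm.mdifferentiableOn (by simp)⟩

theorem dd_bijective (he : IsSmoothChart e) {x : M} (hx : x ∈ e.source) :
    Function.Bijective (fun X : TangentSpace (𝓡 2) x => dd e x X) :=
  he.mdifferentiable.mfderiv_bijective hx

theorem fderiv_comp_symm (he : IsSmoothChart e) {σ : M → F} {y : E} (hy : y ∈ e.target)
    (hσ : MDifferentiableAt (𝓡 2) 𝓘(ℝ, F) σ (e.symm y)) (v : E) :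
    fderiv ℝ (σ ∘ e.symm) y v =
      dd σ (e.symm y) (mfderiv 𝓘(ℝ, E) (𝓡 2) e.symm y v) := by
  rw [← mfderiv_eq_fderiv, mfderiv_comp y hσ (he.mdifferentiable.mdifferentiableAt_symm hy)]
  rfl

theorem dd_eq_fderiv (he : IsSmoothChart e) {σ : M → F} {x : M} (hx : x ∈ e.source)
    (hσ : MDifferentiableAt (𝓡 2) 𝓘(ℝ, F) σ x) (X : TangentSpace (𝓡 2) x) :
    dd σ x X = fderiv ℝ (σ ∘ e.symm) (e x) (dd e x X) := by
  have hσ' : MDifferentiableAt (𝓡 2) 𝓘(ℝ, F) σ (e.symm (e x)) := by rwa [e.left_inv hx]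
  have hc : MDifferentiableAt 𝓘(ℝ, E) 𝓘(ℝ, F) (σ ∘ e.symm) (e x) :=
    hσ'.comp _ (he.mdifferentiable.mdifferentiableAt_symm (e.map_source hx))
  have h1 : mfderiv (𝓡 2) 𝓘(ℝ, F) ((σ ∘ e.symm) ∘ e) x = mfderiv (𝓡 2) 𝓘(ℝ, F) σ x := by
    apply Filter.EventuallyEq.mfderiv_eq
    filter_upwards [e.open_source.mem_nhds hx] with x' hx'
    simp [e.left_inv hx']
  rw [dd, ← h1, mfderiv_comp x hc (he.mdifferentiable.mdifferentiableAt hx), mfderiv_eq_fderiv]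
  rfl

theorem dd_mfderiv_symm (he : IsSmoothChart e) {y : E} (hy : y ∈ e.target) (v : E) :
    dd e (e.symm y) (mfderiv 𝓘(ℝ, E) (𝓡 2) e.symm y v) = v :=
  congrArg (fun L => L v) (he.mdifferentiable.comp_symm_deriv hy)

theorem mfderiv_symm_dd (he : IsSmoothChart e) {x : M} (hx : x ∈ e.source)
    (X : TangentSpace (𝓡 2) x) :
    mfderiv 𝓘(ℝ, E) (𝓡 2) e.symm (e x) (dd (F := E) e x X) = X :=
  congrArg (fun L => L X) (he.mdifferentiable.symm_comp_deriv hx)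

theorem contDiffOn_comp_symm (he : IsSmoothChart e) {σ : M → F} {U : Set M}
    (hσ : ContMDiffOn (𝓡 2) 𝓘(ℝ, F) ∞ σ U) :
    ContDiffOn ℝ ∞ (σ ∘ e.symm) (e.target ∩ e.symm ⁻¹' U) := by
  rw [← contMDiffOn_iff_contDiffOn]
  exact hσ.comp (he.smooth_symm.mono Set.inter_subset_left) fun _ hy => hy.2

theorem contMDiffOn_comp (he : IsSmoothChart e) {g : E → F} {V : Set E}
    (hg : ContDiffOn ℝ ∞ g V) :
    ContMDiffOn (𝓡 2) 𝓘(ℝ, F) ∞ (g ∘ e) (e.source ∩ e ⁻¹' V) :=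
  (contMDiffOn_iff_contDiffOn.2 hg).comp (he.smooth.mono Set.inter_subset_left) fun _ hy => hy.2

end IsSmoothChart

theorem dd_add {σ τ : M → F} {x : M} (hσ : MDifferentiableAt (𝓡 2) 𝓘(ℝ, F) σ x)
    (hτ : MDifferentiableAt (𝓡 2) 𝓘(ℝ, F) τ x) (X : TangentSpace (𝓡 2) x) :
    dd (fun x => σ x + τ x) x X = dd σ x X + dd τ x X := by
  have := (hσ.hasMFDerivAt.add hτ.hasMFDerivAt).mfderiv
  exact congrArg (fun L => L X) this

theorem dd_smul {σ : M → F} {x : M} (hσ : MDifferentiableAt (𝓡 2) 𝓘(ℝ, F) σ x) (r : ℝ)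
    (X : TangentSpace (𝓡 2) x) : dd (fun x => r • σ x) x X = r • dd σ x X := by
  have := (hσ.hasMFDerivAt.const_smul r).mfderiv
  exact congrArg (fun L => L X) this

theorem dd_const (c : F) (x : M) (X : TangentSpace (𝓡 2) x) : dd (fun _ : M => c) x X = 0 :=
  congrArg (fun L => L X) (mfderiv_const (I := 𝓡 2) (I' := 𝓘(ℝ, F)) (c := c) (x := x))

theorem mdifferentiableAt_of_contMDiffOn {U : Set M} {s : M → F}
    (hs : ContMDiffOn (𝓡 2) 𝓘(ℝ, F) ∞ s U) (hU : IsOpen U) {x : M} (hx : x ∈ U) :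
    MDifferentiableAt (𝓡 2) 𝓘(ℝ, F) s x :=
  (hs.contMDiffAt (hU.mem_nhds hx)).mdifferentiableAt (by simp)

theorem dd_linear (s : M → F) (x : M) (a b : ℝ) (Z W : TangentSpace (𝓡 2) x) :
    dd s x (a • Z + b • W) = a • dd s x Z + b • dd s x W := by
  unfold dd
  rw [map_add, map_smul, map_smul]
  rfl

theorem dd_congr {σ τ : M → F} {x : M} (h : σ =ᶠ[𝓝 x] τ) (X : TangentSpace (𝓡 2) x) :
    dd σ x X = dd τ x X :=
  congrArg (fun L => L X) (h.mfderiv_eq (I := 𝓡 2) (I' := 𝓘(ℝ, F)))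

/-! ### One-forms -/

theorem localExpr_apply (η : OneForm M) (p : M) (y v : Plane) :
    localExpr η p y v = η ((chartAt Plane p).symm y)
      (mfderiv 𝓘(ℝ, Plane) (𝓡 2) (chartAt Plane p).symm y v) := by
  rfl

/-- Every tangent space is the model plane by definition, so a vector may be transported along an
equality of base points without a cast. -/
theorem OneForm.congr_point (η : OneForm M) {x x' : M} (h : x = x') (v : Plane) :
    η x v = η x' v := by
  subst h; rfl

variable [IsManifold (𝓡 2) ∞ M]


theorem localExpr_eventuallyEq (η : OneForm M) (p p' : M) {y : Plane}
    (hy : y ∈ (chartAt Plane p).target)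
    (hy' : (chartAt Plane p).symm y ∈ (chartAt Plane p').source) :
    localExpr η p =ᶠ[𝓝 y] fun y =>
      (localExpr η p' ((chartAt Plane p' ∘ (chartAt Plane p).symm) y)).comp
        (fderiv ℝ (chartAt Plane p' ∘ (chartAt Plane p).symm) y) := by
  have he := isSmoothChart_chartAt p
  have he' := isSmoothChart_chartAt p'
  set e := chartAt Plane p
  set e' := chartAt Plane p'
  have hopen : IsOpen (e.target ∩ e.symm ⁻¹' e'.source) :=
    e.symm.continuousOn.isOpen_inter_preimage e.open_target e'.open_source
  filter_upwards [hopen.mem_nhds ⟨hy, hy'⟩] with y ⟨hy, hy'⟩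
  ext1 v
  have hd : MDifferentiableAt (𝓡 2) 𝓘(ℝ, Plane) e' (e.symm y) :=
    he'.mdifferentiable.mdifferentiableAt hy'
  rw [ContinuousLinearMap.comp_apply, localExpr_apply, localExpr_apply, he.fderiv_comp_symm hy hd]
  have := he'.mfderiv_symm_dd hy' (mfderiv 𝓘(ℝ, Plane) (𝓡 2) e.symm y v)
  change _ = η (e'.symm (e' (e.symm y))) (mfderiv 𝓘(ℝ, Plane) (𝓡 2) e'.symm (e' (e.symm y)) _)
  refine Eq.trans ?_ (η.congr_point (e'.left_inv hy').symm _)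
  exact congrArg (η (e.symm y)) this.symm

/-- `extDer` tests closedness only at the centre of each preferred chart. At another point of a
chart, change to the chart centred there and use that pull-backs of closed forms are closed. -/
theorem localExpr_closed {η : OneForm M} (hs : IsSmoothForm η)
    (hc : ∀ (p : M) (X Y : TangentSpace (𝓡 2) p), extDer η p X Y = 0) (p : M) {y : Plane}
    (hy : y ∈ (chartAt Plane p).target) (X Y : Plane) :
    fderiv ℝ (localExpr η p) y X Y = fderiv ℝ (localExpr η p) y Y X := by
  set p' := (chartAt Plane p).symm y with hp'
  have hsrc : (chartAt Plane p).symm y ∈ (chartAt Plane p').source := mem_chart_source _ p'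
  refine closed_pullback ?_ ?_ ?_ (localExpr_eventuallyEq η p p' hy hsrc) X Y
  · have he := isSmoothChart_chartAt p
    have he' := isSmoothChart_chartAt p'
    refine (he.contDiffOn_comp_symm he'.smooth).contDiffAt (IsOpen.mem_nhds ?_ ⟨hy, hsrc⟩)
    exact (chartAt Plane p).symm.continuousOn.isOpen_inter_preimage
      (chartAt Plane p).open_target (chartAt Plane p').open_source
  · have := (hs p').contDiffAt ((isOpen_extChartAt_target p').mem_nhds (mem_extChartAt_target p'))
    exact this.differentiableAt (by simp)
  · intro X Y
    exact sub_eq_zero.1 (hc p' X Y)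

end Charts

/-! ### The solder form of a Legendre map -/

section Legendre

variable {M : Type*} [TopologicalSpace M] [ChartedSpace Plane M] {f : M → Submodule ℝ R42}

theorem IsLegendre.isotropicPlane (h : IsLegendre f) (p : M) : IsotropicPlane (f p) :=
  ⟨h.isotropic p, h.rank_two p⟩

theorem IsSectionOn.mdifferentiableAt {U : Set M} {s : M → R42} (hs : IsSectionOn f U s)
    (hU : IsOpen U) {p : M} (hp : p ∈ U) : MDifferentiableAt (𝓡 2) 𝓘(ℝ, R42) s p :=
  (hs.1.contMDiffAt (hU.mem_nhds hp)).mdifferentiableAt (by simp)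

theorem IsSectionOn.mono {U V : Set M} {s : M → R42} (hs : IsSectionOn f U s) (h : V ⊆ U) :
    IsSectionOn f V s :=
  ⟨hs.1.mono h, fun x hx => hs.2 x (h hx)⟩

theorem IsSectionOn.add {U : Set M} {s t : M → R42} (hs : IsSectionOn f U s)
    (ht : IsSectionOn f U t) : IsSectionOn f U (fun x => s x + t x) :=
  ⟨hs.1.add ht.1, fun x hx => (f x).add_mem (hs.2 x hx) (ht.2 x hx)⟩

theorem IsSectionOn.smul {U : Set M} {s : M → R42} (hs : IsSectionOn f U s) (r : ℝ) :
    IsSectionOn f U (fun x => r • s x) :=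
  ⟨(contMDiffOn_const : ContMDiffOn (𝓡 2) 𝓘(ℝ) ∞ (fun _ : M => r) U).smul hs.1,
    fun x hx => (f x).smul_mem _ (hs.2 x hx)⟩

theorem IsLegendre.dd_mem_perp (h : IsLegendre f) {U : Set M} {s : M → R42}
    (hs : IsSectionOn f U s) (hU : IsOpen U) {p : M} (hp : p ∈ U) (X : TangentSpace (𝓡 2) p) :
    dd s p X ∈ perp (f p) :=
  h.contact p _ ⟨U, hU, hp, s, hs, Or.inr ⟨X, rfl⟩⟩

variable [IsManifold (𝓡 2) ∞ M]

/-- The derivative of a section of a Legendre map that vanishes at a point lies in the fibre. -/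
theorem IsLegendre.dd_mem_of_eq_zero (h : IsLegendre f) {U : Set M} {s : M → R42}
    (hs : IsSectionOn f U s) (hU : IsOpen U) {p : M} (hp : p ∈ U) (h0 : s p = 0)
    (X : TangentSpace (𝓡 2) p) : dd s p X ∈ f p := by
  have he := isSmoothChart_chartAt p
  have hpe : p ∈ (chartAt Plane p).source := mem_chart_source _ p
  set e := chartAt Plane p
  refine (h.isotropicPlane p).mem_of_form_self_eq_zero (h.dd_mem_perp hs hU hp X) ?_
  rw [he.dd_eq_fderiv hpe (hs.mdifferentiableAt hU hp)]
  set v := dd (F := Plane) e p X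
  have hopen : IsOpen (e.target ∩ e.symm ⁻¹' U) :=
    e.symm.continuousOn.isOpen_inter_preimage e.open_target hU
  have hmem : e p ∈ e.target ∩ e.symm ⁻¹' U :=
    ⟨e.map_source hpe, by rw [Set.mem_preimage, e.left_inv hpe]; exact hp⟩
  have hsm := (he.contDiffOn_comp_symm hs.1).contDiffAt (hopen.mem_nhds hmem)
  -- By the contact condition `(s, d_v s)` vanishes identically. Differentiating along `v` where `s
  -- = 0` leaves `(d_v s, d_v s) = 0`.
  have hzero : (fun y => form ((s ∘ e.symm) y) (fderiv ℝ (s ∘ e.symm) y v)) =ᶠ[𝓝 (e p)]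
      fun _ => 0 := by
    filter_upwards [hopen.mem_nhds hmem] with y hy
    rw [he.fderiv_comp_symm hy.1 (hs.mdifferentiableAt hU hy.2)]
    exact mem_perp.1 (h.dd_mem_perp hs hU hy.2 _) _ (hs.2 _ hy.2)
  have hd2 : DifferentiableAt ℝ (fun y => fderiv ℝ (s ∘ e.symm) y v) (e p) :=
    ((hsm.fderiv_right (m := ∞) le_rfl).differentiableAt (by simp)).clm_apply
      (differentiableAt_const v)
  have := hasFDerivAt_form (hsm.differentiableAt (by simp)) hd2 v
  rw [hzero.fderiv_eq] at this
  simpa [e.left_inv hpe, h0] using this.symm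

/-- Apply the vanishing case to `s - A a - B b` with constant coefficients: the derivative modulo
`f` depends only on the value of the section at the point. -/
theorem IsLegendre.dd_sub_mem (h : IsLegendre f) {U : Set M} {s a b : M → R42}
    (hs : IsSectionOn f U s) (ha : IsSectionOn f U a) (hb : IsSectionOn f U b)
    (hU : IsOpen U) {p : M} (hp : p ∈ U) {A B : ℝ} (hAB : s p = A • a p + B • b p)
    (X : TangentSpace (𝓡 2) p) : dd s p X - (A • dd a p X + B • dd b p X) ∈ f p := by
  have key := h.dd_mem_of_eq_zero (hs.add ((ha.smul (-A)).add (hb.smul (-B)))) hU hp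
    (by simp only [hAB]; module) X
  have ds := hs.mdifferentiableAt hU hp
  have da := ha.mdifferentiableAt hU hp
  have db := hb.mdifferentiableAt hU hp
  have da' := (ha.smul (-A)).mdifferentiableAt hU hp
  have db' := (hb.smul (-B)).mdifferentiableAt hU hp
  rw [dd_add ds (((ha.smul (-A)).add (hb.smul (-B))).mdifferentiableAt hU hp), dd_add da' db',
    dd_smul da, dd_smul db] at key
  convert! key using 1
  module

/-- By tensoriality modulo `f`, the condition on all sections through a value can be tested on one
of them. -/
theorem IsLegendre.solderKills_iff (h : IsLegendre f) {U : Set M} {a : M → R42}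
    (ha : IsSectionOn f U a) (hU : IsOpen U) {p : M} (hp : p ∈ U) (X : TangentSpace (𝓡 2) p) :
    SolderKills f p X (a p) ↔ dd a p X ∈ f p := by
  refine ⟨fun hk => hk U hU hp a ha rfl, fun hm V hV hpV s hs hsp => ?_⟩
  have := h.dd_sub_mem (A := 1) (B := 0) (hs.mono Set.inter_subset_left)
    (ha.mono Set.inter_subset_right) (ha.mono Set.inter_subset_right) (hV.inter hU) ⟨hpV, hp⟩
    (by simp [hsp]) X
  simp only [one_smul, zero_smul, add_zero] at this
  simpa using (f p).add_mem this hm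

end Legendre

/-! ### Adapted frames and their structure equations -/

/-- Over the open set `Ω`, the sections `σ₁`, `σ₂` are lifts of the curvature sphere congruences
that are adapted to the middle potential `η`, and `E₁`, `E₂` is an orthonormal frame of `f^⊥ / f`
along the directions of their derivatives. -/
structure IsNormalFrame (f : Plane → Submodule ℝ R42) (η : Plane → Plane →L[ℝ] R42 →L[ℝ] R42)
    (Ω : Set Plane) (ε₁ ε₂ : ℝ) (σ₁ σ₂ E₁ E₂ : Plane → R42) : Prop where
  isOpen : IsOpen Ω
  smooth₁ : ContDiffOn ℝ ∞ σ₁ Ω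
  smooth₂ : ContDiffOn ℝ ∞ σ₂ Ω
  smoothE₁ : ContDiffOn ℝ ∞ E₁ Ω
  smoothE₂ : ContDiffOn ℝ ∞ E₂ Ω
  smoothη : ContDiffOn ℝ ∞ η Ω
  closed : ∀ y ∈ Ω, ∀ X Y, fderiv ℝ η y X Y = fderiv ℝ η y Y X
  plane : ∀ y ∈ Ω, IsotropicPlane (f y)
  mem₁ : ∀ y ∈ Ω, σ₁ y ∈ f y
  mem₂ : ∀ y ∈ Ω, σ₂ y ∈ f y
  indep : ∀ y ∈ Ω, LinearIndependent ℝ ![σ₁ y, σ₂ y]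
  perp₁ : ∀ y ∈ Ω, E₁ y ∈ perp (f y)
  perp₂ : ∀ y ∈ Ω, E₂ y ∈ perp (f y)
  unit₁ : ∀ y ∈ Ω, form (E₁ y) (E₁ y) = 1
  unit₂ : ∀ y ∈ Ω, form (E₂ y) (E₂ y) = 1
  orth : ∀ y ∈ Ω, form (E₁ y) (E₂ y) = 0
  deriv₁ : ∀ y ∈ Ω, ∀ Z, fderiv ℝ σ₁ y Z - form (fderiv ℝ σ₁ y Z) (E₁ y) • E₁ y ∈ f y
  deriv₂ : ∀ y ∈ Ω, ∀ Z, fderiv ℝ σ₂ y Z - form (fderiv ℝ σ₂ y Z) (E₂ y) • E₂ y ∈ f y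
  values : ∀ y ∈ Ω, ∀ Z, η y Z ∈ wedgeSpan (f y) (perp (f y))
  eta₁ : ∀ y ∈ Ω, ∀ Z, η y Z (E₁ y) = -(ε₁ * form (fderiv ℝ σ₁ y Z) (E₁ y)) • σ₁ y
  eta₂ : ∀ y ∈ Ω, ∀ Z, η y Z (E₂ y) = -(ε₂ * form (fderiv ℝ σ₂ y Z) (E₂ y)) • σ₂ y
  sign₁ : ε₁ * ε₁ = 1
  sign₂ : ε₂ * ε₂ = 1
  immersion : ∀ y ∈ Ω, ∀ Z, form (fderiv ℝ σ₁ y Z) (E₁ y) = 0 →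
    form (fderiv ℝ σ₂ y Z) (E₂ y) = 0 → Z = 0

namespace IsNormalFrame

variable {f : Plane → Submodule ℝ R42} {η : Plane → Plane →L[ℝ] R42 →L[ℝ] R42}
  {Ω : Set Plane} {ε₁ ε₂ : ℝ} {σ₁ σ₂ E₁ E₂ : Plane → R42}

theorem swap (h : IsNormalFrame f η Ω ε₁ ε₂ σ₁ σ₂ E₁ E₂) :
    IsNormalFrame f η Ω ε₂ ε₁ σ₂ σ₁ E₂ E₁ where
  isOpen := h.isOpen
  smooth₁ := h.smooth₂
  smooth₂ := h.smooth₁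
  smoothE₁ := h.smoothE₂
  smoothE₂ := h.smoothE₁
  smoothη := h.smoothη
  closed := h.closed
  plane := h.plane
  mem₁ := h.mem₂
  mem₂ := h.mem₁
  indep y hy := by
    have := h.indep y hy
    rw [LinearIndependent.pair_iff] at this ⊢
    intro s t hst
    exact (this t s (by rw [add_comm]; exact hst)).symm
  perp₁ := h.perp₂
  perp₂ := h.perp₁
  unit₁ := h.unit₂
  unit₂ := h.unit₁
  orth y hy := by rw [form_comm]; exact h.orth y hy
  deriv₁ := h.deriv₂
  deriv₂ := h.deriv₁
  values := h.values
  eta₁ := h.eta₂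
  eta₂ := h.eta₁
  sign₁ := h.sign₂
  sign₂ := h.sign₁
  immersion y hy Z h1 h2 := h.immersion y hy Z h2 h1

variable {y : Plane}

theorem mono (h : IsNormalFrame f η Ω ε₁ ε₂ σ₁ σ₂ E₁ E₂) {Ω' : Set Plane} (hΩ : IsOpen Ω')
    (hs : Ω' ⊆ Ω) : IsNormalFrame f η Ω' ε₁ ε₂ σ₁ σ₂ E₁ E₂ where
  isOpen := hΩ
  smooth₁ := h.smooth₁.mono hs
  smooth₂ := h.smooth₂.mono hs
  smoothE₁ := h.smoothE₁.mono hs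
  smoothE₂ := h.smoothE₂.mono hs
  smoothη := h.smoothη.mono hs
  closed y hy := h.closed y (hs hy)
  plane y hy := h.plane y (hs hy)
  mem₁ y hy := h.mem₁ y (hs hy)
  mem₂ y hy := h.mem₂ y (hs hy)
  indep y hy := h.indep y (hs hy)
  perp₁ y hy := h.perp₁ y (hs hy)
  perp₂ y hy := h.perp₂ y (hs hy)
  unit₁ y hy := h.unit₁ y (hs hy)
  unit₂ y hy := h.unit₂ y (hs hy)
  orth y hy := h.orth y (hs hy)
  deriv₁ y hy := h.deriv₁ y (hs hy)
  deriv₂ y hy := h.deriv₂ y (hs hy)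
  values y hy := h.values y (hs hy)
  eta₁ y hy := h.eta₁ y (hs hy)
  eta₂ y hy := h.eta₂ y (hs hy)
  sign₁ := h.sign₁
  sign₂ := h.sign₂
  immersion y hy := h.immersion y (hs hy)

theorem contDiffAt (h : IsNormalFrame f η Ω ε₁ ε₂ σ₁ σ₂ E₁ E₂) (hy : y ∈ Ω) :
    ContDiffAt ℝ ∞ σ₁ y ∧ ContDiffAt ℝ ∞ σ₂ y ∧ ContDiffAt ℝ ∞ E₁ y ∧ ContDiffAt ℝ ∞ E₂ y ∧
      ContDiffAt ℝ ∞ η y :=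
  have hn := h.isOpen.mem_nhds hy
  ⟨h.smooth₁.contDiffAt hn, h.smooth₂.contDiffAt hn, h.smoothE₁.contDiffAt hn,
    h.smoothE₂.contDiffAt hn, h.smoothη.contDiffAt hn⟩

theorem differentiableAt (h : IsNormalFrame f η Ω ε₁ ε₂ σ₁ σ₂ E₁ E₂) (hy : y ∈ Ω) :
    DifferentiableAt ℝ σ₁ y ∧ DifferentiableAt ℝ σ₂ y ∧ DifferentiableAt ℝ E₁ y ∧
      DifferentiableAt ℝ E₂ y ∧ DifferentiableAt ℝ η y :=
  have hn := h.contDiffAt hy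
  ⟨hn.1.differentiableAt (by simp), hn.2.1.differentiableAt (by simp),
    hn.2.2.1.differentiableAt (by simp), hn.2.2.2.1.differentiableAt (by simp),
    hn.2.2.2.2.differentiableAt (by simp)⟩

theorem exists_fderiv_eq (h : IsNormalFrame f η Ω ε₁ ε₂ σ₁ σ₂ E₁ E₂) (hy : y ∈ Ω) (Z : Plane) :
    ∃ l m : ℝ, fderiv ℝ σ₁ y Z =
      form (fderiv ℝ σ₁ y Z) (E₁ y) • E₁ y + l • σ₁ y + m • σ₂ y := by
  have := h.deriv₁ y hy Z
  rw [(h.plane y hy).span_eq (h.mem₁ y hy) (h.mem₂ y hy) (h.indep y hy)] at this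
  obtain ⟨l, m, e⟩ := Submodule.mem_span_pair.1 this
  exact ⟨l, m, by rw [add_assoc, e]; abel⟩

theorem form_mem_E₁ (h : IsNormalFrame f η Ω ε₁ ε₂ σ₁ σ₂ E₁ E₂) (hy : y ∈ Ω) {v : R42}
    (hv : v ∈ f y) : form v (E₁ y) = 0 :=
  mem_perp.1 (h.perp₁ y hy) v hv

theorem form_fderiv_E₂ (h : IsNormalFrame f η Ω ε₁ ε₂ σ₁ σ₂ E₁ E₂) (hy : y ∈ Ω) (Z : Plane) :
    form (fderiv ℝ σ₁ y Z) (E₂ y) = 0 := by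
  have := h.swap.form_mem_E₁ hy (h.deriv₁ y hy Z)
  simpa [h.orth y hy] using this

/-- A section of `f` paired with the derivative of `E₁`. -/
theorem form_fderiv_E (h : IsNormalFrame f η Ω ε₁ ε₂ σ₁ σ₂ E₁ E₂) (hy : y ∈ Ω) {s : Plane → R42}
    (hs : DifferentiableAt ℝ s y) (hm : ∀ y ∈ Ω, s y ∈ f y) (Z : Plane) :
    form (s y) (fderiv ℝ E₁ y Z) = -form (fderiv ℝ s y Z) (E₁ y) := by
  have h0 : (fun y => form (s y) (E₁ y)) =ᶠ[𝓝 y] fun _ => 0 := by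
    filter_upwards [h.isOpen.mem_nhds hy] with y hy
    exact h.form_mem_E₁ hy (hm y hy)
  have := hasFDerivAt_form hs (h.differentiableAt hy).2.2.1 Z
  rw [h0.fderiv_eq] at this
  simp at this
  linarith

theorem form₁_fderiv_E₁ (h : IsNormalFrame f η Ω ε₁ ε₂ σ₁ σ₂ E₁ E₂) (hy : y ∈ Ω) (Z : Plane) :
    form (σ₁ y) (fderiv ℝ E₁ y Z) = -form (fderiv ℝ σ₁ y Z) (E₁ y) :=
  h.form_fderiv_E hy (h.differentiableAt hy).1 h.mem₁ Z

theorem form₂_fderiv_E₁ (h : IsNormalFrame f η Ω ε₁ ε₂ σ₁ σ₂ E₁ E₂) (hy : y ∈ Ω) (Z : Plane) :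
    form (σ₂ y) (fderiv ℝ E₁ y Z) = 0 := by
  rw [h.form_fderiv_E hy (h.differentiableAt hy).2.1 h.mem₂ Z, h.swap.form_fderiv_E₂ hy, neg_zero]

theorem formE₁_fderiv_E₁ (h : IsNormalFrame f η Ω ε₁ ε₂ σ₁ σ₂ E₁ E₂) (hy : y ∈ Ω) (Z : Plane) :
    form (E₁ y) (fderiv ℝ E₁ y Z) = 0 := by
  have h0 : (fun y => form (E₁ y) (E₁ y)) =ᶠ[𝓝 y] fun _ => 1 := by
    filter_upwards [h.isOpen.mem_nhds hy] with y hy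
    exact h.unit₁ y hy
  have hd := (h.differentiableAt hy).2.2.1
  have := hasFDerivAt_form hd hd Z
  rw [h0.fderiv_eq, form_comm (fderiv ℝ E₁ y Z)] at this
  simp at this
  linarith

theorem exists_eta_eq (h : IsNormalFrame f η Ω ε₁ ε₂ σ₁ σ₂ E₁ E₂) (hy : y ∈ Ω) (Z : Plane) :
    ∃ c : ℝ, η y Z = (ε₁ * form (fderiv ℝ σ₁ y Z) (E₁ y)) • wedge (σ₁ y) (E₁ y) +
      (ε₂ * form (fderiv ℝ σ₂ y Z) (E₂ y)) • wedge (σ₂ y) (E₂ y) + c • wedge (σ₁ y) (σ₂ y) :=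
  (h.plane y hy).eq_of_wedgeSpan (h.values y hy Z) (h.mem₁ y hy) (h.mem₂ y hy) (h.indep y hy)
    (h.perp₁ y hy) (h.perp₂ y hy) (h.unit₁ y hy) (h.unit₂ y hy) (h.orth y hy) (h.eta₁ y hy Z)
    (h.eta₂ y hy Z)

theorem form_eta_E₁ (h : IsNormalFrame f η Ω ε₁ ε₂ σ₁ σ₂ E₁ E₂) (hy : y ∈ Ω) (Z : Plane)
    (v : R42) : form (η y Z v) (E₁ y) =
      ε₁ * form (fderiv ℝ σ₁ y Z) (E₁ y) * form (σ₁ y) v := by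
  obtain ⟨c, hc⟩ := h.exists_eta_eq hy Z
  rw [hc]
  simp [wedge_apply, h.form_mem_E₁ hy (h.mem₁ y hy), h.form_mem_E₁ hy (h.mem₂ y hy), h.unit₁ y hy,
    form_comm (E₂ y) (E₁ y), h.orth y hy]

theorem smooth_form_fderiv (h : IsNormalFrame f η Ω ε₁ ε₂ σ₁ σ₂ E₁ E₂) :
    ContDiffOn ℝ ∞ (fun y => (formL (E₁ y)).comp (fderiv ℝ σ₁ y)) Ω :=
  (formL.contDiff.comp_contDiffOn h.smoothE₁).clm_comp
    (h.smooth₁.fderiv_of_isOpen h.isOpen le_rfl)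

/-- The curvature one-form `(dσ₁, E₁)` is closed. -/
theorem closed_form_fderiv (h : IsNormalFrame f η Ω ε₁ ε₂ σ₁ σ₂ E₁ E₂) (hy : y ∈ Ω)
    (Z W : Plane) :
    fderiv ℝ (fun y => (formL (E₁ y)).comp (fderiv ℝ σ₁ y)) y Z W =
      fderiv ℝ (fun y => (formL (E₁ y)).comp (fderiv ℝ σ₁ y)) y W Z := by
  obtain ⟨dσ₁, -, dE₁, -, dη⟩ := h.differentiableAt hy
  have dσ' : DifferentiableAt ℝ (fderiv ℝ σ₁) y :=
    ((h.contDiffAt hy).1.fderiv_right (m := ∞) le_rfl).differentiableAt (by simp)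
  have hβ (Z W : Plane) : fderiv ℝ (fun y => (formL (E₁ y)).comp (fderiv ℝ σ₁ y)) y Z W =
      form (fderiv ℝ E₁ y Z) (fderiv ℝ σ₁ y W) +
        form (E₁ y) (fderiv ℝ (fderiv ℝ σ₁) y Z W) := by
    have hl : HasFDerivAt (fun y => formL (E₁ y)) (formL.comp (fderiv ℝ E₁ y)) y :=
      formL.hasFDerivAt.comp y dE₁.hasFDerivAt
    rw [(hl.clm_comp dσ'.hasFDerivAt).fderiv]
    simp [add_comm]
  -- This is the derivative of `η(W) E₁ = -ε₁ β₁(W) σ₁` along `Z`, where `β₁ = (dσ₁, E₁)`.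
  have hη (Z W : Plane) : fderiv ℝ η y Z W (E₁ y) + η y W (fderiv ℝ E₁ y Z) =
      -(ε₁ * fderiv ℝ (fun y => (formL (E₁ y)).comp (fderiv ℝ σ₁ y)) y Z W) • σ₁ y -
        (ε₁ * form (fderiv ℝ σ₁ y W) (E₁ y)) • fderiv ℝ σ₁ y Z := by
    have dβ : DifferentiableAt ℝ (fun y => (formL (E₁ y)).comp (fderiv ℝ σ₁ y)) y :=
      (h.smooth_form_fderiv.contDiffAt (h.isOpen.mem_nhds hy)).differentiableAt (by simp)
    have e1 : (fun y => η y W (E₁ y)) =ᶠ[𝓝 y]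
        fun y => -(ε₁ * ((formL (E₁ y)).comp (fderiv ℝ σ₁ y)) W) • σ₁ y := by
      filter_upwards [h.isOpen.mem_nhds hy] with y hy
      rw [h.eta₁ y hy W, form_comm]; rfl
    have e2 := ((dη.hasFDerivAt.clm_apply (hasFDerivAt_const W y)).clm_apply dE₁.hasFDerivAt).fderiv
    have e3 := ((((dβ.hasFDerivAt.clm_apply (hasFDerivAt_const W y)).const_mul ε₁).neg).smul
      dσ₁.hasFDerivAt).fderiv
    have e4 := congrArg (fun L => L Z) (e2.symm.trans (e1.fderiv_eq.trans e3))
    simp only [form_comm (fderiv ℝ σ₁ y W)]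
    simp at e4
    rw [add_comm, e4]
    module
  obtain ⟨lZ, mZ, eZ⟩ := h.exists_fderiv_eq hy Z
  obtain ⟨lW, mW, eW⟩ := h.exists_fderiv_eq hy W
  obtain ⟨cZ, hcZ⟩ := h.exists_eta_eq hy Z
  obtain ⟨cW, hcW⟩ := h.exists_eta_eq hy W
  have h1 := hβ Z W
  have h2 := hβ W Z
  have h3 := hη Z W
  have h4 := hη W Z
  rw [fderiv_fderiv_symm (h.contDiffAt hy).1 W Z] at h2
  rw [h.closed y hy W Z, hcZ] at h4
  rw [hcW] at h3
  have fZ := h.form₁_fderiv_E₁ hy Z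
  have fW := h.form₁_fderiv_E₁ hy W
  set bZ := form (fderiv ℝ σ₁ y Z) (E₁ y)
  set bW := form (fderiv ℝ σ₁ y W) (E₁ y)
  set DZW := fderiv ℝ (fun y => (formL (E₁ y)).comp (fderiv ℝ σ₁ y)) y Z W
  set DWZ := fderiv ℝ (fun y => (formL (E₁ y)).comp (fderiv ℝ σ₁ y)) y W Z
  rw [eW, form_comm] at h1
  rw [eZ, form_comm] at h2
  rw [eZ] at h3
  rw [eW] at h4
  simp only [map_add, map_smul, LinearMap.add_apply, LinearMap.smul_apply, smul_eq_mul,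
    h.formE₁_fderiv_E₁ hy, h.form₂_fderiv_E₁ hy, fZ, fW, _root_.add_apply, _root_.smul_apply,
    wedge_apply] at h1 h2 h3 h4
  -- Antisymmetrising in `Z`, `W` removes the derivative of `η`. The `σ₁`-coefficient gives `DZW -
  -- DWZ = -(bW lZ - bZ lW)`, whereas `h1` and `h2` give the same difference with the opposite sign;
  -- so it vanishes.
  have hind := LinearIndependent.pair_iff.1 (h.indep y hy) (ε₁ * (DZW - DWZ + bW * lZ - bZ * lW))
    (ε₁ * (bW * mZ - bZ * mW) -
      (ε₂ * form (fderiv ℝ σ₂ y W) (E₂ y) * form (E₂ y) (fderiv ℝ E₁ y Z) + cW * bZ) +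
      (ε₂ * form (fderiv ℝ σ₂ y Z) (E₂ y) * form (E₂ y) (fderiv ℝ E₁ y W) + cZ * bW))
    (by linear_combination (norm := module) h3 - h4)
  have hε : ε₁ ≠ 0 := fun h0 => by simpa [h0] using h.sign₁
  have := (mul_eq_zero.1 hind.1).resolve_left hε
  linarith

end IsNormalFrame

/-! ### Curvature line coordinates and lightlike conserved quantities in an adapted frame -/

/-- The coframe `(dσ₂, E₂) + i (dσ₁, E₁)`. -/
def coframe (σ₁ σ₂ E₁ E₂ : Plane → R42) (y : Plane) : Plane →L[ℝ] ℂ :=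
  (Complex.equivRealProdCLM.symm : ℝ × ℝ →L[ℝ] ℂ).comp
    (((formL (E₂ y)).comp (fderiv ℝ σ₂ y)).prod ((formL (E₁ y)).comp (fderiv ℝ σ₁ y)))

theorem coframe_re (σ₁ σ₂ E₁ E₂ : Plane → R42) (y Z : Plane) :
    (coframe σ₁ σ₂ E₁ E₂ y Z).re = form (fderiv ℝ σ₂ y Z) (E₂ y) := by
  rw [form_comm]; simp [coframe]

theorem coframe_im (σ₁ σ₂ E₁ E₂ : Plane → R42) (y Z : Plane) :
    (coframe σ₁ σ₂ E₁ E₂ y Z).im = form (fderiv ℝ σ₁ y Z) (E₁ y) := by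
  rw [form_comm]; simp [coframe]

/-- An injective linear map between the plane and `ℂ` is invertible. -/
theorem exists_equiv_of_injective {L : Plane →L[ℝ] ℂ} (h : ∀ Z, L Z = 0 → Z = 0) :
    ∃ e : Plane ≃L[ℝ] ℂ, (e : Plane →L[ℝ] ℂ) = L := by
  have hinj : Function.Injective L := (injective_iff_map_eq_zero L).2 h
  have hfr : Module.finrank ℝ Plane = Module.finrank ℝ ℂ := by simp
  exact ⟨(LinearEquiv.ofInjectiveOfFinrankEq L.toLinearMap hinj hfr).toContinuousLinearEquiv, by
    ext Z; rfl⟩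

/-- A nearby zero forces vanishing when `|dF| ≤ K F`. -/
theorem eventually_eq_zero_of_fderiv_le {E : Type*} [NormedAddCommGroup E] [NormedSpace ℝ E]
    {F : E → ℝ} {y₀ : E} {K : ℝ} (h0 : F y₀ = 0) (hd : ∀ᶠ y in 𝓝 y₀, DifferentiableAt ℝ F y)
    (hK : ∀ᶠ y in 𝓝 y₀, ∀ Z, |fderiv ℝ F y Z| ≤ K * ‖Z‖ * |F y|) : ∀ᶠ y in 𝓝 y₀, F y = 0 := by
  obtain ⟨r, hr, hball⟩ := Metric.eventually_nhds_iff_ball.1 (hd.and hK)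
  filter_upwards [Metric.ball_mem_nhds y₀ hr] with y hy
  have hseg : ∀ t ∈ Set.Icc (0 : ℝ) 1, y₀ + t • (y - y₀) ∈ Metric.ball y₀ r := by
    intro t ht
    have := (convex_ball y₀ r).add_smul_sub_mem (Metric.mem_ball_self hr) hy ht
    exact this
  have hderiv : ∀ t ∈ Set.Icc (0 : ℝ) 1, HasDerivAt (fun t : ℝ => F (y₀ + t • (y - y₀)))
      (fderiv ℝ F (y₀ + t • (y - y₀)) (y - y₀)) t := by
    intro t ht
    have h1 : HasDerivAt (fun t : ℝ => y₀ + t • (y - y₀)) (y - y₀) t := by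
      simpa using ((hasDerivAt_id t).smul_const (y - y₀)).const_add y₀
    exact ((hball _ (hseg t ht)).1.hasFDerivAt).comp_hasDerivAt t h1
  -- Grönwall's inequality along the radial segment from `y₀` to `y`.
  have := eq_zero_of_abs_deriv_le_mul_abs_self_of_eq_zero_right (a := 0) (b := 1)
    (f := fun t : ℝ => F (y₀ + t • (y - y₀))) (K := K * ‖y - y₀‖)
    (fun t ht => (hderiv t ht).continuousAt.continuousWithinAt)
    (fun t ht => (hderiv t ⟨ht.1, ht.2.le⟩).hasDerivWithinAt) (by simpa using h0)
    (fun t ht => (hball _ (hseg t ⟨ht.1, ht.2.le⟩)).2 _) 1 (by simp)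
  simpa using this

namespace IsNormalFrame

variable {f : Plane → Submodule ℝ R42} {η : Plane → Plane →L[ℝ] R42 →L[ℝ] R42}
  {Ω : Set Plane} {ε₁ ε₂ : ℝ} {σ₁ σ₂ E₁ E₂ : Plane → R42} {y : Plane}

theorem smooth_coframe (h : IsNormalFrame f η Ω ε₁ ε₂ σ₁ σ₂ E₁ E₂) :
    ContDiffOn ℝ ∞ (coframe σ₁ σ₂ E₁ E₂) Ω := by
  have : coframe σ₁ σ₂ E₁ E₂ = fun y =>
      ((Complex.equivRealProdCLM.symm : ℝ × ℝ →L[ℝ] ℂ).comp (ContinuousLinearMap.inl ℝ ℝ ℝ)).comp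
        ((formL (E₂ y)).comp (fderiv ℝ σ₂ y)) +
      ((Complex.equivRealProdCLM.symm : ℝ × ℝ →L[ℝ] ℂ).comp (ContinuousLinearMap.inr ℝ ℝ ℝ)).comp
        ((formL (E₁ y)).comp (fderiv ℝ σ₁ y)) := by
    funext y; ext Z; apply Complex.ext <;> simp [coframe]
  rw [this]
  exact (contDiffOn_const.clm_comp h.swap.smooth_form_fderiv).add
    (contDiffOn_const.clm_comp h.smooth_form_fderiv)

theorem closed_coframe (h : IsNormalFrame f η Ω ε₁ ε₂ σ₁ σ₂ E₁ E₂) (hy : y ∈ Ω) (Z W : Plane) :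
    fderiv ℝ (coframe σ₁ σ₂ E₁ E₂) y Z W = fderiv ℝ (coframe σ₁ σ₂ E₁ E₂) y W Z := by
  have hd : DifferentiableAt ℝ (coframe σ₁ σ₂ E₁ E₂) y :=
    (h.smooth_coframe.contDiffAt (h.isOpen.mem_nhds hy)).differentiableAt (by simp)
  have dβ : DifferentiableAt ℝ (fun y => (formL (E₁ y)).comp (fderiv ℝ σ₁ y)) y :=
      (h.smooth_form_fderiv.contDiffAt (h.isOpen.mem_nhds hy)).differentiableAt (by simp)
  have dα : DifferentiableAt ℝ (fun y => (formL (E₂ y)).comp (fderiv ℝ σ₂ y)) y :=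
      (h.swap.smooth_form_fderiv.contDiffAt (h.isOpen.mem_nhds hy)).differentiableAt (by simp)
  have hre (Z W : Plane) : (fderiv ℝ (coframe σ₁ σ₂ E₁ E₂) y Z W).re =
      fderiv ℝ (fun y => (formL (E₂ y)).comp (fderiv ℝ σ₂ y)) y Z W := by
    have e1 : (fun y => ((formL (E₂ y)).comp (fderiv ℝ σ₂ y))) =
        fun y => Complex.reCLM.comp (coframe σ₁ σ₂ E₁ E₂ y) := by
      funext y; ext W; simp [coframe_re, form_comm]
    have := ((hasFDerivAt_const Complex.reCLM y).clm_comp hd.hasFDerivAt).fderiv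
    rw [e1, this]
    simp
  have him (Z W : Plane) : (fderiv ℝ (coframe σ₁ σ₂ E₁ E₂) y Z W).im =
      fderiv ℝ (fun y => (formL (E₁ y)).comp (fderiv ℝ σ₁ y)) y Z W := by
    have e1 : (fun y => ((formL (E₁ y)).comp (fderiv ℝ σ₁ y))) =
        fun y => Complex.imCLM.comp (coframe σ₁ σ₂ E₁ E₂ y) := by
      funext y; ext W; simp [coframe_im, form_comm]
    have := ((hasFDerivAt_const Complex.imCLM y).clm_comp hd.hasFDerivAt).fderiv
    rw [e1, this]
    simp
  apply Complex.ext
  · rw [hre, hre, h.swap.closed_form_fderiv hy]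
  · rw [him, him, h.closed_form_fderiv hy]

theorem exists_coframe_equiv (h : IsNormalFrame f η Ω ε₁ ε₂ σ₁ σ₂ E₁ E₂) (hy : y ∈ Ω) :
    ∃ e : Plane ≃L[ℝ] ℂ, (e : Plane →L[ℝ] ℂ) = coframe σ₁ σ₂ E₁ E₂ y := by
  refine exists_equiv_of_injective fun Z hZ => h.immersion y hy Z ?_ ?_
  · rw [← coframe_im σ₁ σ₂ E₁ E₂, hZ, Complex.zero_im]
  · rw [← coframe_re σ₁ σ₂ E₁ E₂, hZ, Complex.zero_re]

/-- Curvature line coordinates. -/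
theorem exists_coordinate (h : IsNormalFrame f η Ω ε₁ ε₂ σ₁ σ₂ E₁ E₂) (hy : y ∈ Ω) :
    ∃ Ω' ⊆ Ω, IsOpen Ω' ∧ y ∈ Ω' ∧ ∃ z : Plane → ℂ, ContDiffOn ℝ ∞ z Ω' ∧ Set.InjOn z Ω' ∧
      ∀ y ∈ Ω', HasFDerivAt z (coframe σ₁ σ₂ E₁ E₂ y) y := by
  obtain ⟨r, hr, hball⟩ := Metric.isOpen_iff.1 h.isOpen y hy
  -- The Poincaré lemma on a ball, applied to the closed coframe.
  obtain ⟨z, hz⟩ := (convex_ball y r).exists_forall_hasFDerivAt_of_fderiv_symmetric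
    Metric.isOpen_ball ((h.smooth_coframe.mono hball).differentiableOn (by simp))
    (fun a ha => h.closed_coframe (hball ha))
  have hsm : ContDiffOn ℝ ∞ z (Metric.ball y r) := by
    rw [contDiffOn_infty_iff_fderiv_of_isOpen Metric.isOpen_ball]
    refine ⟨fun a ha => (hz a ha).differentiableAt.differentiableWithinAt, ?_⟩
    exact (h.smooth_coframe.mono hball).congr fun a ha => (hz a ha).fderiv
  obtain ⟨e, he⟩ := h.exists_coframe_equiv hy
  have hyb : y ∈ Metric.ball y r := Metric.mem_ball_self hr
  have hzy : HasFDerivAt z (e : Plane →L[ℝ] ℂ) y := by rw [he]; exact hz y hyb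
  have hsy := hsm.contDiffAt (Metric.isOpen_ball.mem_nhds hyb)
  -- The coframe is invertible by the immersion condition, so the inverse function theorem makes `z`
  -- injective near `y`.
  let φ := hsy.toOpenPartialHomeomorph z hzy (by simp)
  refine ⟨φ.source ∩ Metric.ball y r, fun a ha => hball ha.2, φ.open_source.inter
    Metric.isOpen_ball, ⟨hsy.mem_toOpenPartialHomeomorph_source hzy (by simp), hyb⟩, z,
    hsm.mono Set.inter_subset_right, ?_, fun a ha => hz a ha.2⟩
  exact φ.injOn.mono Set.inter_subset_left

/-- A vector on which `β₁` is one, for extracting `σ₁`-coefficients; the swapped frame provides one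
for `β₂`. -/
theorem exists_dual (h : IsNormalFrame f η Ω ε₁ ε₂ σ₁ σ₂ E₁ E₂) (hy : y ∈ Ω) :
    ∃ Z, form (fderiv ℝ σ₁ y Z) (E₁ y) = 1 := by
  obtain ⟨e, he⟩ := h.exists_coframe_equiv hy
  refine ⟨e.symm Complex.I, ?_⟩
  rw [← coframe_im σ₁ σ₂ E₁ E₂, ← he]
  simp

/-- The kernel of the middle pencil at a lightlike vector. -/
theorem mem_of_eta_eq_zero (h : IsNormalFrame f η Ω ε₁ ε₂ σ₁ σ₂ E₁ E₂) (hy : y ∈ Ω) {v : R42}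
    (hv : form v v = 0) (h0 : ∀ Z, η y Z v = 0) : v ∈ f y := by
  refine (h.plane y hy).mem_of_form_self_eq_zero ?_ hv
  rw [(h.plane y hy).span_eq (h.mem₁ y hy) (h.mem₂ y hy) (h.indep y hy),
    IsotropicPlane.mem_perp_span_pair]
  -- The `E₁`-component of `η(Z) v` is `ε₁ β₁(Z) (σ₁, v)`, so it detects `(σ₁, v)`. The claim is
  -- stated for an arbitrary frame so that the swapped frame handles `σ₂`.
  have key {ε₁ ε₂ : ℝ} {σ₁ σ₂ E₁ E₂ : Plane → R42} (h : IsNormalFrame f η Ω ε₁ ε₂ σ₁ σ₂ E₁ E₂) :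
      form (σ₁ y) v = 0 := by
    obtain ⟨Z, hZ⟩ := h.exists_dual hy
    have := h.form_eta_E₁ hy Z v
    have hε : ε₁ ≠ 0 := fun h0 => by simpa [h0] using h.sign₁
    rw [h0, hZ] at this
    simpa [hε] using this.symm
  exact ⟨key h, key h.swap⟩

/-- A linear conserved quantity is determined by its constant term. -/
theorem eq_of_conserved (h : IsNormalFrame f η Ω ε₁ ε₂ σ₁ σ₂ E₁ E₂) {q : R42} {P : Plane → R42}
    (hP : ∀ y ∈ Ω, DifferentiableAt ℝ P y) (hdP : ∀ y ∈ Ω, ∀ Z, fderiv ℝ P y Z = -η y Z q)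
    (hmem : ∀ y ∈ Ω, P y ∈ f y) (hy : y ∈ Ω) :
    P y = -(ε₁ * form (σ₁ y) q) • σ₁ y - (ε₂ * form (σ₂ y) q) • σ₂ y := by
  have hm := hmem y hy
  rw [(h.plane y hy).span_eq (h.mem₁ y hy) (h.mem₂ y hy) (h.indep y hy)] at hm
  obtain ⟨a, b, hab⟩ := Submodule.mem_span_pair.1 hm
  have key {ε₁ ε₂ : ℝ} {σ₁ σ₂ E₁ E₂ : Plane → R42} (h : IsNormalFrame f η Ω ε₁ ε₂ σ₁ σ₂ E₁ E₂)
      {a b : ℝ} (hab : a • σ₁ y + b • σ₂ y = P y) : a = -(ε₁ * form (σ₁ y) q) := by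
    -- Differentiating `(P, E₁) = 0` along `Z` compares `a` with the `E₁`-component of `η(Z) q`.
    obtain ⟨Z, hZ⟩ := h.exists_dual hy
    have h1 := h.form_fderiv_E hy (hP y hy) hmem Z
    rw [hdP y hy, ← hab, map_neg, LinearMap.neg_apply, h.form_eta_E₁ hy] at h1
    simp only [map_add, map_smul, LinearMap.add_apply, LinearMap.smul_apply, smul_eq_mul,
      h.form₁_fderiv_E₁ hy, h.form₂_fderiv_E₁ hy, hZ] at h1
    linarith
  rw [← hab, key h hab, key h.swap ((add_comm _ _).trans hab)]
  module

theorem quadratic_of_conserved (h : IsNormalFrame f η Ω ε₁ ε₂ σ₁ σ₂ E₁ E₂) {q : R42}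
    {P : Plane → R42} (hP : ∀ y ∈ Ω, DifferentiableAt ℝ P y)
    (hdP : ∀ y ∈ Ω, ∀ Z, fderiv ℝ P y Z = -η y Z q)
    (hmem : ∀ y ∈ Ω, P y ∈ f y) (hPq : ∀ y ∈ Ω, form (P y) q = 0) (hy : y ∈ Ω) :
    ε₁ * form (σ₁ y) q ^ 2 + ε₂ * form (σ₂ y) q ^ 2 = 0 := by
  have := hPq y hy
  rw [h.eq_of_conserved hP hdP hmem hy] at this
  simp at this
  linarith

/-- A constant vector that is a section of `f` over an open set vanishes. -/
theorem eq_zero_of_eventually_mem (h : IsNormalFrame f η Ω ε₁ ε₂ σ₁ σ₂ E₁ E₂) {q : R42}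
    (hy : y ∈ Ω) (hq : ∀ᶠ y in 𝓝 y, q ∈ f y) : q = 0 := by
  have hm := hq.self_of_nhds
  rw [(h.plane y hy).span_eq (h.mem₁ y hy) (h.mem₂ y hy) (h.indep y hy)] at hm
  obtain ⟨a, b, hab⟩ := Submodule.mem_span_pair.1 hm
  have key {ε₁ ε₂ : ℝ} {σ₁ σ₂ E₁ E₂ : Plane → R42} (h : IsNormalFrame f η Ω ε₁ ε₂ σ₁ σ₂ E₁ E₂)
      {a b : ℝ} (hab : a • σ₁ y + b • σ₂ y = q) : a = 0 := by
    obtain ⟨V, hV, hVo, hyV⟩ := eventually_nhds_iff.1 hq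
    obtain ⟨Z, hZ⟩ := h.exists_dual hy
    -- Here `dq = 0`, while differentiating `(q, E₁) = 0` along `Z` produces `-a`.
    have h1 := (h.mono (h.isOpen.inter hVo) Set.inter_subset_left).form_fderiv_E (s := fun _ => q)
      ⟨hy, hyV⟩ (differentiableAt_const q) (fun y hy => hV y hy.2) Z
    rw [← hab] at h1
    simpa [h.form₁_fderiv_E₁ hy, h.form₂_fderiv_E₁ hy, hZ] using h1
  rw [← hab, key h hab, key h.swap ((add_comm _ _).trans hab)]
  simp

/-- The derivative of `(σ₁, q)²` along its own curvature direction. -/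
theorem exists_bound (h : IsNormalFrame f η Ω ε₁ ε₂ σ₁ σ₂ E₁ E₂) (q : R42)
    (hq : ∀ y ∈ Ω, form (σ₁ y) q ^ 2 = form (σ₂ y) q ^ 2) (hy : y ∈ Ω) :
    ∃ K : ℝ, ∀ᶠ y in 𝓝 y, ∀ X, form (fderiv ℝ σ₁ y X) (E₁ y) = 0 →
      form (fderiv ℝ σ₂ y X) (E₂ y) = 1 →
      |fderiv ℝ (fun y => form (σ₁ y) q ^ 2) y X| ≤ K * form (σ₁ y) q ^ 2 := by
  obtain ⟨e, he⟩ := h.exists_coframe_equiv hy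
  set L := coframe σ₁ σ₂ E₁ E₂
  have hL : ContinuousAt L y := (h.smooth_coframe.contDiffAt (h.isOpen.mem_nhds hy)).continuousAt
  have hinv : ContinuousAt (fun y => (L y).inverse) y := by
    have : ContinuousAt (ContinuousLinearMap.inverse : (Plane →L[ℝ] ℂ) → (ℂ →L[ℝ] Plane))
        (L y) := by
      rw [← he]
      exact (contDiffAt_map_inverse (n := 0) e).continuousAt
    exact this.comp (f := L) hL
  have hX : ContinuousAt (fun y => (L y).inverse 1) y := hinv.clm_apply continuousAt_const
  have hY : ContinuousAt (fun y => (L y).inverse Complex.I) y := hinv.clm_apply continuousAt_const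
  have hD {s : Plane → R42} (hs : ContDiffAt ℝ ∞ s y) : ContinuousAt (fderiv ℝ s) y :=
    (hs.fderiv_right (m := ∞) le_rfl).continuousAt
  obtain ⟨c₁, c₂, cE₁, cE₂, -⟩ := h.contDiffAt hy
  have hform {a b : Plane → R42} (ha : ContinuousAt a y) (hb : ContinuousAt b y) :
      ContinuousAt (fun y => form (a y) (b y)) y :=
    ((formL.continuous.continuousAt.comp ha).clm_apply hb :)
  have hl := hform ((hD c₁).clm_apply hX) ((hD cE₁).clm_apply hY)
  have hm := hform ((hD c₁).clm_apply hX) ((hD cE₂).clm_apply hX)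
  -- With `X = L⁻¹ 1` and `Y = L⁻¹ i`, the two pairings equal, up to sign, the coefficients of `d_X
  -- σ₁ = l σ₁ + m σ₂`. Written this way they are visibly continuous, hence locally bounded.
  obtain ⟨K, hK⟩ : ∃ K, ∀ᶠ y in 𝓝 y,
      2 * (|form (fderiv ℝ σ₁ y ((L y).inverse 1)) (fderiv ℝ E₁ y ((L y).inverse Complex.I))| +
        |form (fderiv ℝ σ₁ y ((L y).inverse 1)) (fderiv ℝ E₂ y ((L y).inverse 1))|) ≤ K :=
    ⟨_, ((hl.abs.add hm.abs).const_mul 2).eventually_le_const (lt_add_one _)⟩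
  refine ⟨K, ?_⟩
  · filter_upwards [hK, h.isOpen.mem_nhds hy] with y hK hy X hX₁ hX₂
    obtain ⟨e, he⟩ := h.exists_coframe_equiv hy
    change (e : Plane →L[ℝ] ℂ) = L y at he
    have heX : (L y).inverse 1 = X := by
      rw [← he, ContinuousLinearMap.inverse_equiv]
      change e.symm 1 = X
      rw [ContinuousLinearEquiv.symm_apply_eq]
      have : e X = L y X := congrArg (fun L => L X) he
      rw [this]
      apply Complex.ext
      · rw [coframe_re, hX₂, Complex.one_re]
      · rw [coframe_im, hX₁, Complex.one_im]
    have heY : L y ((L y).inverse Complex.I) = Complex.I := by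
      rw [← he, ContinuousLinearMap.inverse_equiv]
      exact e.apply_symm_apply _
    set Y := (L y).inverse Complex.I
    have hY₁ : form (fderiv ℝ σ₁ y Y) (E₁ y) = 1 := by
      rw [← coframe_im σ₁ σ₂ E₁ E₂]; exact congrArg Complex.im heY
    rw [heX] at hK
    -- In the curvature direction the `E₁`-term drops out, so the derivative of `(σ₁, q)` is `l (σ₁,
    -- q) + m (σ₂, q)`, and the two pairings have the same absolute value by `hq`.
    obtain ⟨l, m, hlm⟩ := h.exists_fderiv_eq hy X
    rw [hX₁, zero_smul, zero_add] at hlm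
    have hl : form (fderiv ℝ σ₁ y X) (fderiv ℝ E₁ y Y) = -l := by
      rw [hlm]; simp [h.form₁_fderiv_E₁ hy, h.form₂_fderiv_E₁ hy, hY₁]
    have hm : form (fderiv ℝ σ₁ y X) (fderiv ℝ E₂ y X) = -m := by
      rw [hlm]; simp [h.swap.form₁_fderiv_E₁ hy, h.swap.form₂_fderiv_E₁ hy, hX₂]
    rw [hl, hm, abs_neg, abs_neg] at hK
    have hF : fderiv ℝ (fun y => form (σ₁ y) q ^ 2) y X =
        2 * form (σ₁ y) q * (l * form (σ₁ y) q + m * form (σ₂ y) q) := by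
      have h1 := (h.differentiableAt hy).1
      have h2 : DifferentiableAt ℝ (fun y => form (σ₁ y) q) y :=
        (formL.flip q).differentiableAt.comp y h1
      have h3 := hasFDerivAt_form h1 (differentiableAt_const q) X
      rw [fderiv_fun_pow 2 h2]
      simp only [smul_apply, h3, hlm]
      simp
    rw [hF]
    refine le_trans ?_ (mul_le_mul_of_nonneg_right hK (sq_nonneg _))
    have hq := hq y hy
    set φ := form (σ₁ y) q
    set ψ := form (σ₂ y) q
    have hab : |φ| = |ψ| := (sq_eq_sq_iff_abs_eq_abs φ ψ).1 hq
    calc |2 * φ * (l * φ + m * ψ)| = 2 * |φ| * |l * φ + m * ψ| := by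
          rw [abs_mul, abs_mul]; simp
      _ ≤ 2 * |φ| * (|l| * |φ| + |m| * |φ|) := by
          gcongr
          refine (abs_add_le _ _).trans ?_
          rw [abs_mul, abs_mul, hab]
      _ = 2 * (|l| + |m|) * φ ^ 2 := by rw [← sq_abs φ]; ring

theorem mem_of_form_eq_zero (h : IsNormalFrame f η Ω ε₁ ε₂ σ₁ σ₂ E₁ E₂) {q : R42}
    (hqq : form q q = 0) (hy : y ∈ Ω) (h₁ : form (σ₁ y) q = 0) (h₂ : form (σ₂ y) q = 0) :
    q ∈ f y := by
  refine (h.plane y hy).mem_of_form_self_eq_zero ?_ hqq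
  rw [(h.plane y hy).span_eq (h.mem₁ y hy) (h.mem₂ y hy) (h.indep y hy),
    IsotropicPlane.mem_perp_span_pair]
  exact ⟨h₁, h₂⟩

/-- If `(σ₁, q)² = (σ₂, q)²` for a non-zero lightlike vector `q`, then `q` is never in `f`. -/
theorem not_mem_of_sq_eq (h : IsNormalFrame f η Ω ε₁ ε₂ σ₁ σ₂ E₁ E₂) {q : R42}
    (hq0 : q ≠ 0) (hqq : form q q = 0)
    (hq : ∀ y ∈ Ω, form (σ₁ y) q ^ 2 = form (σ₂ y) q ^ 2) (hy : y ∈ Ω) : q ∉ f y := by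
  intro hmem
  apply hq0
  have hn := h.isOpen.mem_nhds hy
  obtain ⟨K₁, hK₁⟩ := h.exists_bound q hq hy
  obtain ⟨K₂, hK₂⟩ := h.swap.exists_bound q (fun y hy => (hq y hy).symm) hy
  have hL : ContinuousAt (coframe σ₁ σ₂ E₁ E₂) y :=
    (h.smooth_coframe.contDiffAt (h.isOpen.mem_nhds hy)).continuousAt
  have hLb := hL.norm.eventually_le_const (lt_add_one _)
  -- The function `(σ₁, q)²` satisfies a linear differential inequality and vanishes at `y`, since
  -- `q` is in `f y`; so it vanishes nearby.
  have hvan : ∀ᶠ y in 𝓝 y, form (σ₁ y) q ^ 2 = 0 := by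
    refine eventually_eq_zero_of_fderiv_le
      (K := (‖coframe σ₁ σ₂ E₁ E₂ y‖ + 1) * (K₁ + K₂)) ?_ ?_ ?_
    · rw [(h.plane y hy).isotropic _ (h.mem₁ y hy) _ hmem]; simp
    · filter_upwards [hn] with y hy
      have h1 := (h.differentiableAt hy).1
      have h2 : DifferentiableAt ℝ (fun y => form (σ₁ y) q) y :=
        (formL.flip q).differentiableAt.comp y h1
      exact h2.pow 2
    · filter_upwards [hn, hK₁, hK₂, hLb] with y hy hK₁ hK₂ hLb Z
      obtain ⟨e, he⟩ := h.exists_coframe_equiv hy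
      set L := coframe σ₁ σ₂ E₁ E₂ y with hLdef
      have hev (w : ℂ) : L (e.symm w) = w := by rw [← he]; exact e.apply_symm_apply w
      have hX := hK₁ (e.symm 1) (by rw [← coframe_im σ₁ σ₂ E₁ E₂, ← hLdef, hev, Complex.one_im])
        (by rw [← coframe_re σ₁ σ₂ E₁ E₂, ← hLdef, hev, Complex.one_re])
      have hY := hK₂ (e.symm Complex.I)
        (by rw [← coframe_re σ₁ σ₂ E₁ E₂, ← hLdef, hev, Complex.I_re])
        (by rw [← coframe_im σ₁ σ₂ E₁ E₂, ← hLdef, hev, Complex.I_im])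
      -- The bound in the other curvature direction comes from the swapped frame, because the
      -- function is also `(σ₂, q)²`.
      have hFe : (fun y => form (σ₂ y) q ^ 2) =ᶠ[𝓝 y] fun y => form (σ₁ y) q ^ 2 := by
        filter_upwards [h.isOpen.mem_nhds hy] with y hy
        exact (hq y hy).symm
      rw [hFe.fderiv_eq, ← hq y hy] at hY
      have hZ : Z = (L Z).re • e.symm 1 + (L Z).im • e.symm Complex.I := by
        have : Z = e.symm (L Z) := by rw [← he]; simp
        conv_lhs => rw [this]
        rw [← map_smul, ← map_smul, ← map_add]
        congr 1
        apply Complex.ext <;> simp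
      have hre : |(L Z).re| ≤ (‖coframe σ₁ σ₂ E₁ E₂ _‖ + 1) * ‖Z‖ :=
        (Complex.abs_re_le_norm _).trans ((L.le_opNorm Z).trans (by gcongr))
      have him : |(L Z).im| ≤ (‖coframe σ₁ σ₂ E₁ E₂ _‖ + 1) * ‖Z‖ :=
        (Complex.abs_im_le_norm _).trans ((L.le_opNorm Z).trans (by gcongr))
      conv_lhs => rw [hZ]
      rw [map_add, map_smul, map_smul, abs_of_nonneg (sq_nonneg (form (σ₁ y) q))]
      refine (abs_add_le _ _).trans ?_
      rw [smul_eq_mul, smul_eq_mul, abs_mul, abs_mul]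
      calc _ ≤ _ := add_le_add (mul_le_mul hre hX (abs_nonneg _) (by positivity))
            (mul_le_mul him hY (abs_nonneg _) (by positivity))
        _ = _ := by ring
  refine h.eq_zero_of_eventually_mem hy ?_
  filter_upwards [hvan, hn] with y hF hy
  refine h.mem_of_form_eq_zero hqq hy (pow_eq_zero_iff two_ne_zero |>.1 hF) ?_
  rw [hq y hy] at hF
  exact pow_eq_zero_iff two_ne_zero |>.1 hF

/-- The signs of an adapted frame with a lightlike linear conserved quantity. -/
theorem sign_of_conserved (h : IsNormalFrame f η Ω ε₁ ε₂ σ₁ σ₂ E₁ E₂) {q : R42}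
    (hq0 : q ≠ 0) (hqq : form q q = 0)
    (hq : ∀ y ∈ Ω, ε₁ * form (σ₁ y) q ^ 2 + ε₂ * form (σ₂ y) q ^ 2 = 0) (hy : y ∈ Ω) :
    ε₂ = -ε₁ := by
  have h12 : (ε₂ - ε₁) * (ε₂ + ε₁) = 0 := by linear_combination h.sign₂ - h.sign₁
  rcases mul_eq_zero.1 h12 with h0 | h0
  -- With equal signs the quadratic relation is a vanishing sum of two squares, so `q` would be a
  -- section of `f` over an open set.
  · exfalso
    apply hq0
    refine h.eq_zero_of_eventually_mem hy ?_
    filter_upwards [h.isOpen.mem_nhds hy] with y hy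
    have hε : ε₁ ≠ 0 := fun h0 => by simpa [h0] using h.sign₁
    have := hq y hy
    rw [sub_eq_zero.1 h0, ← mul_add] at this
    have := (mul_eq_zero.1 this).resolve_left hε
    exact h.mem_of_form_eq_zero hqq hy (by nlinarith) (by nlinarith)
  · linarith

end IsNormalFrame

/-! ### Curvature frames and the Lie cyclide splitting -/

/-- If `(da, b) = 0`, then `(da ∧ db) = 0`. -/
theorem form_fderiv_symm {E : Type*} [NormedAddCommGroup E] [NormedSpace ℝ E] {a b : E → R42}
    {y : E} (ha : ContDiffAt ℝ ∞ a y) (hb : DifferentiableAt ℝ b y)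
    (hab : ∀ᶠ y in 𝓝 y, ∀ Z, form (fderiv ℝ a y Z) (b y) = 0) (Z W : E) :
    form (fderiv ℝ a y Z) (fderiv ℝ b y W) = form (fderiv ℝ a y W) (fderiv ℝ b y Z) := by
  have hd : DifferentiableAt ℝ (fderiv ℝ a) y :=
    (ha.fderiv_right (m := ∞) le_rfl).differentiableAt (by simp)
  have key (Z W : E) : form (fderiv ℝ (fderiv ℝ a) y W Z) (b y) +
      form (fderiv ℝ a y Z) (fderiv ℝ b y W) = 0 := by
    have h0 : (fun y => form (fderiv ℝ a y Z) (b y)) =ᶠ[𝓝 y] fun _ => 0 := by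
      filter_upwards [hab] with y hy using hy Z
    have hd' := hd.hasFDerivAt.clm_apply (hasFDerivAt_const Z y)
    have := hasFDerivAt_form hd'.differentiableAt hb W
    rw [h0.fderiv_eq, hd'.fderiv] at this
    simpa using this.symm
  have h1 := key Z W
  have h2 := key W Z
  rw [fderiv_fderiv_symm ha W Z] at h1
  linarith

/-- The trace of an endomorphism of a plane. -/
theorem trace_eq_of_pair {V : Type*} [AddCommGroup V] [Module ℝ V] [FiniteDimensional ℝ V]
    (hV : Module.finrank ℝ V = 2) {a b : V} (hab : LinearIndependent ℝ ![a, b])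
    (L : V →ₗ[ℝ] V) {x y z w : ℝ} (ha : L a = x • a + y • b) (hb : L b = z • a + w • b) :
    LinearMap.trace ℝ V L = x + w := by
  let B := basisOfLinearIndependentOfCardEqFinrank hab (by simp [hV])
  have hB0 : B 0 = a := by simp [B]
  have hB1 : B 1 = b := by simp [B]
  rw [LinearMap.trace_eq_matrix_trace ℝ B, Matrix.trace_fin_two, LinearMap.toMatrix_apply,
    LinearMap.toMatrix_apply, hB0, hB1, ha, hb]
  conv_lhs => rw [← hB0, ← hB1]
  simp

section Surface

variable {M : Type*} [TopologicalSpace M] [ChartedSpace Plane M] [IsManifold (𝓡 2) ∞ M]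
variable {f : M → Submodule ℝ R42} {U : Set M}

theorem contMDiffOn_dd {s : M → R42} (hU : IsOpen U)
    (hs : ContMDiffOn (𝓡 2) 𝓘(ℝ, R42) ∞ s U) {Z : (p : M) → TangentSpace (𝓡 2) p}
    (hZ : ContMDiffOn (𝓡 2) (𝓡 2).tangent ∞ (fun p => (⟨p, Z p⟩ : TangentBundle (𝓡 2) M)) U) :
    ContMDiffOn (𝓡 2) 𝓘(ℝ, R42) ∞ (fun x => dd s x (Z x)) U := by
  have h1 := (hs.contMDiffOn_tangentMapWithin (m := ∞) le_rfl hU.uniqueMDiffOn).comp hZ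
    (fun x hx => hx)
  have h2 := (contMDiff_snd_tangentBundle_modelSpace R42 𝓘(ℝ, R42)
    (n := ∞)).contMDiffOn.comp (t := Set.univ) h1 (fun x hx => Set.mem_univ _)
  refine h2.congr fun x hx => ?_
  change _ = mfderivWithin (𝓡 2) 𝓘(ℝ, R42) s U x (Z x)
  rw [mfderivWithin_of_isOpen hU hx]
  rfl

/-- The product rule for `(a, b)` when this function vanishes. -/
theorem form_dd_add_eq_zero {a b : M → R42} (hU : IsOpen U)
    (ha : ContMDiffOn (𝓡 2) 𝓘(ℝ, R42) ∞ a U) (hb : ContMDiffOn (𝓡 2) 𝓘(ℝ, R42) ∞ b U)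
    (hab : ∀ x ∈ U, form (a x) (b x) = 0) {x : M} (hx : x ∈ U) (Z : TangentSpace (𝓡 2) x) :
    form (dd a x Z) (b x) + form (a x) (dd b x Z) = 0 := by
  have he := isSmoothChart_chartAt x
  have hxe : x ∈ (chartAt Plane x).source := mem_chart_source _ x
  set e := chartAt Plane x
  have hn := (isOpen_chart_inter e hU).mem_nhds (mem_chart_inter e hxe hx)
  have da := ((he.contDiffOn_comp_symm ha).contDiffAt hn).differentiableAt (by simp)
  have db := ((he.contDiffOn_comp_symm hb).contDiffAt hn).differentiableAt (by simp)
  have h0 : (fun y => form ((a ∘ e.symm) y) ((b ∘ e.symm) y)) =ᶠ[𝓝 (e x)] fun _ => 0 := by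
    filter_upwards [hn] with y hy using hab _ hy.2
  have := hasFDerivAt_form da db (dd (F := Plane) e x Z)
  rw [h0.fderiv_eq, ← he.dd_eq_fderiv hxe (mdifferentiableAt_of_contMDiffOn ha hU hx),
    ← he.dd_eq_fderiv hxe (mdifferentiableAt_of_contMDiffOn hb hU hx)] at this
  simpa [e.left_inv hxe] using this.symm

theorem form_dd_symm {a b : M → R42} (hU : IsOpen U)
    (ha : ContMDiffOn (𝓡 2) 𝓘(ℝ, R42) ∞ a U) (hb : ContMDiffOn (𝓡 2) 𝓘(ℝ, R42) ∞ b U)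
    (hab : ∀ x ∈ U, ∀ Z, form (dd a x Z) (b x) = 0) {x : M} (hx : x ∈ U)
    (Z W : TangentSpace (𝓡 2) x) :
    form (dd a x Z) (dd b x W) = form (dd a x W) (dd b x Z) := by
  have he := isSmoothChart_chartAt x
  have hxe : x ∈ (chartAt Plane x).source := mem_chart_source _ x
  set e := chartAt Plane x
  have hn := (isOpen_chart_inter e hU).mem_nhds (mem_chart_inter e hxe hx)
  have da := (he.contDiffOn_comp_symm ha).contDiffAt hn
  have db := ((he.contDiffOn_comp_symm hb).contDiffAt hn).differentiableAt (by simp)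
  have da' := mdifferentiableAt_of_contMDiffOn ha hU hx
  have db' := mdifferentiableAt_of_contMDiffOn hb hU hx
  rw [he.dd_eq_fderiv hxe da', he.dd_eq_fderiv hxe da', he.dd_eq_fderiv hxe db',
    he.dd_eq_fderiv hxe db']
  apply form_fderiv_symm da db
  filter_upwards [hn] with y hy Z
  rw [he.fderiv_comp_symm hy.1 (mdifferentiableAt_of_contMDiffOn ha hU hy.2)]
  exact hab _ hy.2 _

namespace IsCurvatureFrame

variable {σ₁ σ₂ : M → R42} {X Y : (p : M) → TangentSpace (𝓡 2) p} {x : M}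

theorem swap (h : IsCurvatureFrame f U σ₁ σ₂ X Y) : IsCurvatureFrame f U σ₂ σ₁ Y X where
  isOpen := h.isOpen
  section₁ := h.section₂
  section₂ := h.section₁
  indep p hp := by
    have := h.indep p hp
    rw [LinearIndependent.pair_iff] at this ⊢
    intro s t hst
    exact (this t s (by rw [add_comm]; exact hst)).symm
  smoothX := h.smoothY
  smoothY := h.smoothX
  neX := h.neY
  neY := h.neX
  killsX := h.killsY
  killsY := h.killsX

theorem span_eq (h : IsCurvatureFrame f U σ₁ σ₂ X Y) (hf : IsLegendre f) (hx : x ∈ U) :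
    f x = Submodule.span ℝ {σ₁ x, σ₂ x} :=
  (hf.isotropicPlane x).span_eq (h.section₁.2 x hx) (h.section₂.2 x hx) (h.indep x hx)

theorem dd_mem (h : IsCurvatureFrame f U σ₁ σ₂ X Y) (hx : x ∈ U) : dd σ₁ x (X x) ∈ f x :=
  h.killsX x hx U h.isOpen hx σ₁ h.section₁ rfl

/-- `Y` already kills `σ₂`; if it killed `σ₁` too, it would kill all of `f`, against the immersion
condition. -/
theorem dd_not_mem (h : IsCurvatureFrame f U σ₁ σ₂ X Y) (hf : IsLegendre f) (hx : x ∈ U) :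
    dd σ₁ x (Y x) ∉ f x := by
  intro hmem
  apply h.neY x hx
  apply hf.immersion x
  intro v hv
  rw [h.span_eq hf hx] at hv
  obtain ⟨a, b, rfl⟩ := Submodule.mem_span_pair.1 hv
  have hs := (h.section₁.smul a).add (h.section₂.smul b)
  refine (hf.solderKills_iff hs h.isOpen hx (Y x)).2 ?_
  rw [dd_add ((h.section₁.smul a).mdifferentiableAt h.isOpen hx)
    ((h.section₂.smul b).mdifferentiableAt h.isOpen hx),
    dd_smul (h.section₁.mdifferentiableAt h.isOpen hx),
    dd_smul (h.section₂.mdifferentiableAt h.isOpen hx)]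
  exact (f x).add_mem ((f x).smul_mem _ hmem) ((f x).smul_mem _ (h.swap.dd_mem hx))

/-- The curvature directions span the tangent plane. -/
theorem exists_eq_add (h : IsCurvatureFrame f U σ₁ σ₂ X Y) (hf : IsLegendre f) (hx : x ∈ U)
    (Z : TangentSpace (𝓡 2) x) : ∃ a b : ℝ, Z = a • X x + b • Y x := by
  have hind : LinearIndependent ℝ ![(X x : Plane), (Y x : Plane)] := by
    rw [LinearIndependent.pair_iff]
    intro s t hst
    have h1 : s • dd σ₁ x (X x) + t • dd σ₁ x (Y x) = 0 := by
      have := congrArg (mfderiv (𝓡 2) 𝓘(ℝ, R42) σ₁ x) hst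
      rw [map_zero, map_add, map_smul, map_smul] at this
      exact this
    have ht : t = 0 := by
      by_contra ht
      apply h.dd_not_mem hf hx
      have : dd σ₁ x (Y x) = (-(t⁻¹ * s)) • dd σ₁ x (X x) := by
        have h2 := congrArg (fun v => t⁻¹ • v) h1
        simp only [smul_add, smul_smul, inv_mul_cancel₀ ht, one_smul, smul_zero] at h2
        rw [neg_smul]; exact eq_neg_of_add_eq_zero_right h2
      rw [this]
      exact (f x).smul_mem _ (h.dd_mem hx)
    refine ⟨?_, ht⟩
    rw [ht, zero_smul, add_zero] at hst
    exact (smul_eq_zero.1 hst).resolve_right (h.neX x hx)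
  have htop : Submodule.span ℝ (Set.range ![(X x : Plane), (Y x : Plane)]) = ⊤ :=
    hind.span_eq_top_of_card_eq_finrank (by
      change _ = Module.finrank ℝ Plane; simp)
  have hr : Set.range ![(X x : Plane), (Y x : Plane)] = {(X x : Plane), (Y x : Plane)} := by
    simp [Set.pair_comm]
  rw [hr] at htop
  have hZ : (Z : Plane) ∈ Submodule.span ℝ {(X x : Plane), (Y x : Plane)} := by
    rw [htop]; trivial
  obtain ⟨a, b, hab⟩ := Submodule.mem_span_pair.1 hZ
  exact ⟨a, b, hab.symm⟩

theorem contMDiffOn_dd₁ (h : IsCurvatureFrame f U σ₁ σ₂ X Y) :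
    ContMDiffOn (𝓡 2) 𝓘(ℝ, R42) ∞ (fun x => dd σ₁ x (Y x)) U :=
  contMDiffOn_dd h.isOpen h.section₁.1 h.smoothY

theorem dd_mem_perp (h : IsCurvatureFrame f U σ₁ σ₂ X Y) (hf : IsLegendre f) (hx : x ∈ U)
    (Z : TangentSpace (𝓡 2) x) : dd σ₁ x Z ∈ perp (f x) :=
  hf.dd_mem_perp h.section₁ h.isOpen hx Z

/-- `(dσ₁, d_X σ₂) = 0`. -/
theorem form_dd_dd (h : IsCurvatureFrame f U σ₁ σ₂ X Y) (hf : IsLegendre f) (hx : x ∈ U)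
    (Z : TangentSpace (𝓡 2) x) : form (dd σ₁ x Z) (dd σ₂ x (X x)) = 0 := by
  obtain ⟨a, b, rfl⟩ := h.exists_eq_add hf hx Z
  have h1 : form (dd σ₁ x (X x)) (dd σ₂ x (X x)) = 0 :=
    mem_perp.1 (h.swap.dd_mem_perp hf hx _) _ (h.dd_mem hx)
  have h2 : form (dd σ₁ x (Y x)) (dd σ₂ x (X x)) = 0 := by
    -- Since `(dσ₁, σ₂) = 0`, the directions may be exchanged: `(d_Y σ₁, d_X σ₂) = (d_X σ₁, d_Y
    -- σ₂)`, and `d_X σ₁` lies in `f`.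
    rw [form_dd_symm h.isOpen h.section₁.1 h.section₂.1 (fun x hx Z => ?_) hx]
    · exact mem_perp.1 (h.swap.dd_mem_perp hf hx _) _ (h.dd_mem hx)
    · rw [form_comm]
      exact mem_perp.1 (h.dd_mem_perp hf hx _) _ (h.section₂.2 x hx)
  rw [dd_linear]
  simp [h1, h2]

/-- The Lie cyclides are orthogonal: `d_Y σ₁ ⊥ S₂`. -/
theorem form_cyclideSpace (h : IsCurvatureFrame f U σ₁ σ₂ X Y) (hf : IsLegendre f) (hx : x ∈ U)
    {v : R42} (hv : v ∈ cyclideSpace σ₂ X x) : form (dd σ₁ x (Y x)) v = 0 := by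
  have hw : ∀ x ∈ U, dd σ₂ x (X x) ∈ perp (f x) := fun x hx => h.swap.dd_mem_perp hf hx _
  have h2 := h.swap.contMDiffOn_dd₁
  have hpair {s : M → R42} (hs : IsSectionOn f U s) (Z : TangentSpace (𝓡 2) x) :
      form (s x) (dd (fun x => dd σ₂ x (X x)) x Z) = - form (dd s x Z) (dd σ₂ x (X x)) := by
    have := form_dd_add_eq_zero h.isOpen hs.1 h2 (fun x hx => mem_perp.1 (hw x hx) _ (hs.2 x hx))
      hx Z
    linarith
  -- The same exchange applied to `(dσ₁, d_X σ₂) = 0` moves the pairing to `(d_X σ₁, d_Y d_X σ₂)`.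
  -- Here `d_X σ₁` is a combination of `σ₁`, `σ₂`, and differentiating `(σᵢ, d_X σ₂) = 0` along `Y`
  -- finishes.
  have key : form (dd σ₁ x (Y x)) (dd (fun x => dd σ₂ x (X x)) x (X x)) = 0 := by
    rw [form_dd_symm h.isOpen h.section₁.1 h2 (fun x hx Z => h.form_dd_dd hf hx Z) hx]
    have hm := h.dd_mem hx
    rw [h.span_eq hf hx] at hm
    obtain ⟨a, b, hab⟩ := Submodule.mem_span_pair.1 hm
    rw [← hab]
    simp only [map_add, map_smul, LinearMap.add_apply, LinearMap.smul_apply, hpair h.section₁,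
      hpair h.section₂, h.form_dd_dd hf hx, mem_perp.1 (hw x hx) _ (h.swap.dd_mem hx)]
    simp
  induction hv using Submodule.span_induction with
  | mem v hv =>
    rcases hv with rfl | rfl | rfl
    · rw [form_comm]
      exact mem_perp.1 (h.dd_mem_perp hf hx _) _ (h.section₂.2 x hx)
    · exact h.form_dd_dd hf hx _
    · exact key
  | zero => simp
  | add v w _ _ hv hw => simp [hv, hw]
  | smul r v _ hv => simp [hv]

/-- A vector of `S₁` in `f` lies on the curvature sphere. -/
theorem exists_smul_eq_of_mem (h : IsCurvatureFrame f U σ₁ σ₂ X Y) (hf : IsLegendre f)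
    (hx : x ∈ U) {v : R42} (hv : v ∈ cyclideSpace σ₁ Y x) (hvf : v ∈ f x) :
    ∃ a : ℝ, v = a • σ₁ x := by
  have hpl := hf.isotropicPlane x
  have hpos := hpl.form_self_pos (h.dd_mem_perp hf hx (Y x)) (h.dd_not_mem hf hx)
  obtain ⟨a, b, c, rfl⟩ := Submodule.mem_span_triple.1 hv
  have hpair : form (σ₁ x) (dd (fun x => dd σ₁ x (Y x)) x (Y x)) =
      -form (dd σ₁ x (Y x)) (dd σ₁ x (Y x)) := by
    have := form_dd_add_eq_zero h.isOpen h.section₁.1 h.contMDiffOn_dd₁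
      (fun x hx => mem_perp.1 (h.dd_mem_perp hf hx _) _ (h.section₁.2 x hx)) hx (Y x)
    linarith
  -- Pairing with `σ₁` eliminates the second derivative; pairing with `d_Y σ₁` then eliminates the
  -- first.
  have h1 := hpl.isotropic _ (h.section₁.2 x hx) _ hvf
  simp only [map_add, map_smul, hpair, hpl.isotropic _ (h.section₁.2 x hx) _ (h.section₁.2 x hx),
    mem_perp.1 (h.dd_mem_perp hf hx (Y x)) _ (h.section₁.2 x hx), smul_eq_mul, mul_zero,
    zero_add, mul_neg, neg_eq_zero, mul_eq_zero, hpos.ne', or_false] at h1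
  have h2 := mem_perp.1 (h.dd_mem_perp hf hx (Y x)) _ hvf
  simp only [h1, map_add, map_smul, LinearMap.add_apply, LinearMap.smul_apply, zero_smul, add_zero,
    mem_perp.1 (h.dd_mem_perp hf hx (Y x)) _ (h.section₁.2 x hx), smul_eq_mul, mul_zero,
    zero_add, mul_eq_zero, hpos.ne', or_false] at h2
  exact ⟨a, by simp [h1, h2]⟩

/-- A middle potential maps `d_Y σ₁` to the curvature sphere. -/
theorem exists_apply_eq (h : IsCurvatureFrame f U σ₁ σ₂ X Y) (hf : IsLegendre f) (hx : x ∈ U)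
    {T g m : R42 →L[ℝ] R42} (hT : T ∈ wedgeSpan (f x) (perp (f x)))
    (hg : g ∈ wedgeSpan (cyclideSpace σ₁ Y x) (cyclideSpace σ₁ Y x) ⊔
      wedgeSpan (cyclideSpace σ₂ X x) (cyclideSpace σ₂ X x))
    (hm : m ∈ wedgeSpan (f x) (f x)) (hTgm : T = g + m) :
    ∃ a : ℝ, T (dd σ₁ x (Y x)) = a • σ₁ x := by
  have hw := h.dd_mem_perp hf hx (Y x)
  -- The value lies in `f` because `d_Y σ₁` is in `f^⊥`. It lies in `S₁` because the `∧² f` part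
  -- kills `f^⊥`, the `∧² S₂` part kills `d_Y σ₁` by orthogonality, and the `∧² S₁` part takes
  -- values in `S₁`.
  refine h.exists_smul_eq_of_mem hf hx ?_ (IsotropicPlane.wedgeSpan_apply_mem hT hw)
  rw [hTgm, _root_.add_apply, IsotropicPlane.wedgeSpan_self_apply_eq_zero hm hw, add_zero]
  obtain ⟨g₁, hg₁, g₂, hg₂, rfl⟩ := Submodule.mem_sup.1 hg
  have hz : g₂ (dd σ₁ x (Y x)) = 0 := by
    clear hTgm hg
    induction hg₂ using Submodule.span_induction with
    | mem T hT =>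
      obtain ⟨a, ha, b, hb, rfl⟩ := hT
      rw [wedge_apply, form_comm a, form_comm b, h.form_cyclideSpace hf hx ha,
        h.form_cyclideSpace hf hx hb]
      simp
    | zero => rfl
    | add T S _ _ hT hS => simp [hT, hS]
    | smul r T _ hT => simp [hT]
  rw [_root_.add_apply, hz, add_zero]
  clear hTgm hg
  induction hg₁ using Submodule.span_induction with
  | mem T hT =>
    obtain ⟨a, ha, b, hb, rfl⟩ := hT
    rw [wedge_apply]
    exact Submodule.sub_mem _ (Submodule.smul_mem _ _ hb) (Submodule.smul_mem _ _ ha)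
  | zero => exact Submodule.zero_mem _
  | add T S _ _ hT hS => exact Submodule.add_mem _ hT hS
  | smul r T _ hT => exact Submodule.smul_mem _ _ hT

end IsCurvatureFrame

end Surface

/-! ### Normalisation of a middle potential -/

theorem contDiffOn_form {E : Type*} [NormedAddCommGroup E] [NormedSpace ℝ E] {a b : E → R42}
    {Ω : Set E} (ha : ContDiffOn ℝ ∞ a Ω) (hb : ContDiffOn ℝ ∞ b Ω) :
    ContDiffOn ℝ ∞ (fun y => form (a y) (b y)) Ω :=
  ((formL.contDiff.comp_contDiffOn ha).clm_apply hb :)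

/-- A potential that maps `E` to multiples of `σ` does so by a multiple of `(dσ, E)`. -/
theorem exists_eta_eq_smul {η : Plane → Plane →L[ℝ] R42 →L[ℝ] R42} {Ω : Set Plane}
    {σ E : Plane → R42} (hΩ : IsOpen Ω) (hη : ContDiffOn ℝ ∞ η Ω) (hσ : ContDiffOn ℝ ∞ σ Ω)
    (hE : ContDiffOn ℝ ∞ E Ω)
    (hclosed : ∀ y ∈ Ω, ∀ X Y, fderiv ℝ η y X Y = fderiv ℝ η y Y X)
    (hησ : ∀ y ∈ Ω, ∀ Z, η y Z (σ y) = 0)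
    (hηE : ∀ y ∈ Ω, ∀ Z, ∃ a : ℝ, η y Z (E y) = a • σ y)
    (hηd : ∀ y ∈ Ω, ∀ Z W, η y W (fderiv ℝ σ y Z) = form (fderiv ℝ σ y Z) (E y) • η y W (E y))
    (hσE : ∀ y ∈ Ω, form (σ y) (E y) = 0) (hσ0 : ∀ y ∈ Ω, σ y ≠ 0) {y₀ Z₀ : Plane} (hy₀ : y₀ ∈ Ω)
    (hZ₀ : form (fderiv ℝ σ y₀ Z₀) (E y₀) ≠ 0) :
    ∃ Ω' ⊆ Ω, IsOpen Ω' ∧ y₀ ∈ Ω' ∧ ∃ κ : Plane → ℝ, ContDiffOn ℝ ∞ κ Ω' ∧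
      ∀ y ∈ Ω', ∀ Z, η y Z (E y) = -(κ y * form (fderiv ℝ σ y Z) (E y)) • σ y := by
  have hdσ : ContDiffOn ℝ ∞ (fun y => fderiv ℝ σ y Z₀) Ω :=
    (hσ.fderiv_of_isOpen hΩ le_rfl).clm_apply contDiffOn_const
  have hdE : ContDiffOn ℝ ∞ (fun y => fderiv ℝ E y Z₀) Ω :=
    (hE.fderiv_of_isOpen hΩ le_rfl).clm_apply contDiffOn_const
  have hβ := contDiffOn_form hdσ hE
  have hη₀ : ContDiffOn ℝ ∞ (fun y => η y Z₀ (E y)) Ω :=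
    (hη.clm_apply contDiffOn_const).clm_apply hE
  -- Write `η(Z₀) E = a₀ σ` and `b₀ = (d_{Z₀} σ, E)`. The factor sought is `-a₀ / b₀`; since `(σ,
  -- d_{Z₀} E) = -b₀`, pairing with `d_{Z₀} E` expresses it as a quotient of smooth functions.
  refine ⟨Ω ∩ (fun y => form (fderiv ℝ σ y Z₀) (E y)) ⁻¹' {0}ᶜ, Set.inter_subset_left,
    hβ.continuousOn.isOpen_inter_preimage hΩ isOpen_compl_singleton, ⟨hy₀, hZ₀⟩,
    fun y => form (η y Z₀ (E y)) (fderiv ℝ E y Z₀) / form (fderiv ℝ σ y Z₀) (E y) ^ 2, ?_, ?_⟩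
  · refine ((contDiffOn_form hη₀ hdE).mono Set.inter_subset_left).div
      ((hβ.mono Set.inter_subset_left).pow 2) fun y hy => pow_ne_zero 2 hy.2
  · rintro y ⟨hy, hb⟩ Z
    have hb : form (fderiv ℝ σ y Z₀) (E y) ≠ 0 := hb
    have hn := hΩ.mem_nhds hy
    have dσ := (hσ.contDiffAt hn).differentiableAt (by simp)
    have dE := (hE.contDiffAt hn).differentiableAt (by simp)
    have dη := (hη.contDiffAt hn).differentiableAt (by simp)
    obtain ⟨a₀, ha₀⟩ := hηE y hy Z₀
    obtain ⟨a, ha⟩ := hηE y hy Z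
    have hpair : form (σ y) (fderiv ℝ E y Z₀) = -form (fderiv ℝ σ y Z₀) (E y) := by
      have h0 : (fun y => form (σ y) (E y)) =ᶠ[𝓝 y] fun _ => 0 := by
        filter_upwards [hn] with y hy using hσE y hy
      have := hasFDerivAt_form dσ dE Z₀
      rw [h0.fderiv_eq] at this
      simp at this
      linarith
    have hD (Z W : Plane) : fderiv ℝ η y Z W (σ y) + η y W (fderiv ℝ σ y Z) = 0 := by
      have h0 : (fun y => η y W (σ y)) =ᶠ[𝓝 y] fun _ => 0 := by
        filter_upwards [hn] with y hy using hησ y hy W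
      have e2 := ((dη.hasFDerivAt.clm_apply (hasFDerivAt_const W y)).clm_apply
        dσ.hasFDerivAt).fderiv
      have e3 := congrArg (fun L => L Z) (e2.symm.trans h0.fderiv_eq)
      simp at e3
      rw [add_comm, e3]
    -- Antisymmetrising the derivative of `η σ = 0` gives `β ∧ a = 0` for the one-form `a` with `η E
    -- = a σ` and `β = (dσ, E)`: Cartan's lemma.
    have hsymm :
        (form (fderiv ℝ σ y Z₀) (E y) * a - form (fderiv ℝ σ y Z) (E y) * a₀) • σ y = 0 := by
      have h1 := hD Z Z₀
      have h2 := hD Z₀ Z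
      rw [hclosed y hy Z₀ Z, hηd y hy, ha] at h2
      rw [hηd y hy, ha₀] at h1
      linear_combination (norm := module) h2 - h1
    have hs := (smul_eq_zero.1 hsymm).resolve_right (hσ0 y hy)
    simp only [ha, ha₀, map_smul, LinearMap.smul_apply, hpair, smul_eq_mul]
    congr 1
    field_simp
    linear_combination hs

/-- Normalization of a non-zero smooth function to a sign times a square. -/
theorem exists_sign_mul_sq {Ω : Set Plane} (hΩ : IsOpen Ω) {κ : Plane → ℝ}
    (hκ : ContDiffOn ℝ ∞ κ Ω) {y₀ : Plane} (hy₀ : y₀ ∈ Ω) (h0 : κ y₀ ≠ 0) :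
    ∃ Ω' ⊆ Ω, IsOpen Ω' ∧ y₀ ∈ Ω' ∧ ∃ (ε : ℝ) (g : Plane → ℝ), ε * ε = 1 ∧
      ContDiffOn ℝ ∞ g Ω' ∧ ∀ y ∈ Ω', g y ≠ 0 ∧ κ y = ε * (g y * g y) := by
  obtain ⟨ε, hε, hpos⟩ : ∃ ε : ℝ, ε * ε = 1 ∧ 0 < ε * κ y₀ := by
    rcases lt_or_gt_of_ne h0 with h | h
    · exact ⟨-1, by norm_num, by linarith⟩
    · exact ⟨1, by norm_num, by linarith⟩
  have hεκ : ContDiffOn ℝ ∞ (fun y => ε * κ y) Ω := contDiffOn_const.mul hκ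
  refine ⟨Ω ∩ (fun y => ε * κ y) ⁻¹' Set.Ioi 0, Set.inter_subset_left,
    hεκ.continuousOn.isOpen_inter_preimage hΩ isOpen_Ioi, ⟨hy₀, hpos⟩, ε,
    fun y => √(ε * κ y), hε, ?_, ?_⟩
  · exact (hεκ.mono Set.inter_subset_left).sqrt fun y hy => ne_of_gt hy.2
  · rintro y ⟨hy, hp⟩
    have hp : 0 < ε * κ y := hp
    refine ⟨(Real.sqrt_pos.2 hp).ne', ?_⟩
    rw [Real.mul_self_sqrt hp.le, ← mul_assoc, hε, one_mul]

section Surface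

variable {M : Type*} [TopologicalSpace M] [ChartedSpace Plane M]
variable {f : M → Submodule ℝ R42} {U : Set M}

/-- The quadratic differential of a potential that is diagonal in a frame of `f`. -/
theorem IsQuadDiffOf.eq_add (hf : IsLegendre f) {η : OneForm M} {q : TwoTensor M}
    (hq : IsQuadDiffOf f η q) (hU : IsOpen U) {a b : M → R42} (ha : IsSectionOn f U a)
    (hb : IsSectionOn f U b) {x : M} (hx : x ∈ U) (hind : LinearIndependent ℝ ![a x, b x])
    {X Y : TangentSpace (𝓡 2) x} {k l m n : ℝ} (hka : η x X (dd a x Y) = k • a x + l • b x)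
    (hlb : η x X (dd b x Y) = m • a x + n • b x) : q x X Y = k + n := by
  obtain ⟨L, hL, hq⟩ := hq x X Y
  rw [hq]
  have hind' : LinearIndependent ℝ ![(⟨a x, ha.2 x hx⟩ : f x), ⟨b x, hb.2 x hx⟩] := by
    rw [LinearIndependent.pair_iff] at hind ⊢
    intro s t hst
    exact hind s t (congrArg Subtype.val hst)
  refine trace_eq_of_pair (hf.rank_two x) hind' L (x := k) (y := l) (z := m) (w := n) ?_ ?_
  · apply Subtype.ext
    rw [hL U hU hx a ha _ rfl, hka]
    rfl
  · apply Subtype.ext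
    rw [hL U hU hx b hb _ rfl, hlb]
    rfl

variable [IsManifold (𝓡 2) ∞ M]

/-- The unit vector in the direction of `d_Z σ`. -/
def unitDeriv (σ : M → R42) (Z : (p : M) → TangentSpace (𝓡 2) p) (x : M) : R42 :=
  (√(form (dd σ x (Z x)) (dd σ x (Z x))))⁻¹ • dd σ x (Z x)

namespace IsCurvatureFrame

variable {σ₁ σ₂ : M → R42} {X Y : (p : M) → TangentSpace (𝓡 2) p} {x : M}

theorem form_dd_pos (h : IsCurvatureFrame f U σ₁ σ₂ X Y) (hf : IsLegendre f) (hx : x ∈ U) :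
    0 < form (dd σ₁ x (Y x)) (dd σ₁ x (Y x)) :=
  (hf.isotropicPlane x).form_self_pos (h.dd_mem_perp hf hx (Y x)) (h.dd_not_mem hf hx)

theorem unitDeriv_mem_perp (h : IsCurvatureFrame f U σ₁ σ₂ X Y) (hf : IsLegendre f)
    (hx : x ∈ U) : unitDeriv σ₁ Y x ∈ perp (f x) :=
  Submodule.smul_mem _ _ (h.dd_mem_perp hf hx (Y x))

theorem form_unitDeriv (h : IsCurvatureFrame f U σ₁ σ₂ X Y) (hf : IsLegendre f)
    (hx : x ∈ U) : form (unitDeriv σ₁ Y x) (unitDeriv σ₁ Y x) = 1 := by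
  have hp := h.form_dd_pos hf hx
  have hs := (Real.sqrt_pos.2 hp).ne'
  simp only [unitDeriv, map_smul, LinearMap.smul_apply, smul_eq_mul]
  field_simp
  exact (Real.sq_sqrt hp.le).symm

theorem form_dd_unitDeriv (h : IsCurvatureFrame f U σ₁ σ₂ X Y) (hf : IsLegendre f)
    (hx : x ∈ U) (Z : TangentSpace (𝓡 2) x) : form (dd σ₁ x Z) (unitDeriv σ₂ X x) = 0 := by
  simp [unitDeriv, h.form_dd_dd hf hx]

theorem form_unitDeriv_unitDeriv (h : IsCurvatureFrame f U σ₁ σ₂ X Y) (hf : IsLegendre f)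
    (hx : x ∈ U) : form (unitDeriv σ₁ Y x) (unitDeriv σ₂ X x) = 0 := by
  rw [unitDeriv, map_smul, LinearMap.smul_apply, h.form_dd_unitDeriv hf hx, smul_zero]

theorem dd_sub_mem (h : IsCurvatureFrame f U σ₁ σ₂ X Y) (hf : IsLegendre f)
    (hx : x ∈ U) (Z : TangentSpace (𝓡 2) x) :
    dd σ₁ x Z - form (dd σ₁ x Z) (unitDeriv σ₁ Y x) • unitDeriv σ₁ Y x ∈ f x := by
  have := (hf.isotropicPlane x).sub_proj_mem (h.unitDeriv_mem_perp hf hx)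
    (h.swap.unitDeriv_mem_perp hf hx) (h.dd_mem_perp hf hx Z)
    (by rw [h.form_unitDeriv hf hx]; exact one_ne_zero)
    (by rw [h.swap.form_unitDeriv hf hx]; exact one_ne_zero)
    (h.form_unitDeriv_unitDeriv hf hx)
  rwa [h.form_unitDeriv hf hx, h.form_dd_unitDeriv hf hx, zero_div, zero_smul, sub_zero,
    div_one] at this

theorem eq_zero_of_form_dd_eq_zero (h : IsCurvatureFrame f U σ₁ σ₂ X Y) (hf : IsLegendre f)
    (hx : x ∈ U) {Z : TangentSpace (𝓡 2) x} (h₁ : form (dd σ₁ x Z) (unitDeriv σ₁ Y x) = 0)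
    (h₂ : form (dd σ₂ x Z) (unitDeriv σ₂ X x) = 0) : Z = 0 := by
  obtain ⟨a, b, rfl⟩ := h.exists_eq_add hf hx Z
  have key {σ₁ σ₂ : M → R42} {X Y : (p : M) → TangentSpace (𝓡 2) p}
      (h : IsCurvatureFrame f U σ₁ σ₂ X Y) {a b : ℝ}
      (h₁ : form (dd σ₁ x (a • X x + b • Y x)) (unitDeriv σ₁ Y x) = 0) : b = 0 := by
    have hX := mem_perp.1 (h.unitDeriv_mem_perp hf hx) _ (h.dd_mem hx)
    have hp := h.form_dd_pos hf hx
    have hs := (Real.sqrt_pos.2 hp).ne'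
    rw [dd_linear, map_add, map_smul, map_smul, LinearMap.add_apply, LinearMap.smul_apply,
      LinearMap.smul_apply, hX, smul_zero, zero_add, unitDeriv, map_smul] at h₁
    simpa [hp.ne', hs] using h₁
  have hb := key h h₁
  have ha := key h.swap (a := b) (b := a) (by rw [add_comm]; exact h₂)
  simp [ha, hb]

theorem form_dd_unitDeriv_pos (h : IsCurvatureFrame f U σ₁ σ₂ X Y) (hf : IsLegendre f)
    (hx : x ∈ U) : form (dd σ₁ x (Y x)) (unitDeriv σ₁ Y x) ≠ 0 := by
  have hp := h.form_dd_pos hf hx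
  have hs := (Real.sqrt_pos.2 hp).ne'
  simp [unitDeriv, hp.ne', hs]

theorem contDiffOn_unitDeriv (h : IsCurvatureFrame f U σ₁ σ₂ X Y) (hf : IsLegendre f)
    {E : Type*} [NormedAddCommGroup E] [NormedSpace ℝ E] {e : OpenPartialHomeomorph M E}
    (he : IsSmoothChart e) :
    ContDiffOn ℝ ∞ (unitDeriv σ₁ Y ∘ e.symm) (e.target ∩ e.symm ⁻¹' U) := by
  have hw := he.contDiffOn_comp_symm h.contMDiffOn_dd₁
  have hN := contDiffOn_form hw hw
  refine ContDiffOn.smul (ContDiffOn.inv (hN.sqrt fun y hy => ?_) fun y hy => ?_) hw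
  · exact (h.form_dd_pos hf hy.2).ne'
  · exact (Real.sqrt_pos.2 (h.form_dd_pos hf hy.2)).ne'

/-- In a chart, a middle potential is a multiple of the curvature one-form. -/
theorem exists_localExpr_eq (h : IsCurvatureFrame f U σ₁ σ₂ X Y) (hf : IsLegendre f)
    {η : OneForm M} (hη : IsOmegaPotential f η)
    (hmid : ∀ x ∈ U, ∀ Z : TangentSpace (𝓡 2) x, ∃ a : ℝ, η x Z (dd σ₁ x (Y x)) = a • σ₁ x)
    {p : M} (hp : p ∈ U) :
    ∃ Ω ⊆ (chartAt Plane p).target ∩ (chartAt Plane p).symm ⁻¹' U, IsOpen Ω ∧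
      chartAt Plane p p ∈ Ω ∧ ∃ κ : Plane → ℝ, ContDiffOn ℝ ∞ κ Ω ∧
      ∀ y ∈ Ω, ∀ Z, localExpr η p y Z (unitDeriv σ₁ Y ((chartAt Plane p).symm y)) =
        -(κ y * form (fderiv ℝ (σ₁ ∘ (chartAt Plane p).symm) y Z)
          (unitDeriv σ₁ Y ((chartAt Plane p).symm y))) • σ₁ ((chartAt Plane p).symm y) := by
  have he := isSmoothChart_chartAt p
  have hpe : p ∈ (chartAt Plane p).source := mem_chart_source _ p
  have hcl := fun (y : Plane) (hy : y ∈ (chartAt Plane p).target) =>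
    localExpr_closed hη.smooth hη.closed p hy
  have hsm : ContDiffOn ℝ ∞ (localExpr η p) (chartAt Plane p).target := by
    have := hη.smooth p
    rwa [extChartAt_target, modelWithCornersSelf_coe_symm, Set.preimage_id,
      modelWithCornersSelf_coe, Set.range_id, Set.inter_univ] at this
  have hloc := localExpr_apply η p
  set e := chartAt Plane p
  have hd {y : Plane} (hy : y ∈ e.target ∩ e.symm ⁻¹' U) (Z : Plane) :=
    he.fderiv_comp_symm hy.1 (h.section₁.mdifferentiableAt h.isOpen hy.2) Z
  refine exists_eta_eq_smul (Z₀ := dd (F := Plane) e p (Y p)) (isOpen_chart_inter e h.isOpen)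
    (hsm.mono Set.inter_subset_left) (he.contDiffOn_comp_symm h.section₁.1)
    (h.contDiffOn_unitDeriv hf he) (fun y hy => hcl y hy.1) ?_ ?_ ?_ ?_ ?_
    (mem_chart_inter e hpe hp) ?_
  · intro y hy Z
    rw [hloc]
    exact (hf.isotropicPlane _).wedgeSpan_apply_eq_zero (hη.values _ _) (h.section₁.2 _ hy.2)
  · intro y hy Z
    obtain ⟨a, ha⟩ := hmid _ hy.2 (mfderiv 𝓘(ℝ, Plane) (𝓡 2) e.symm y Z)
    refine ⟨(√(form (dd σ₁ (e.symm y) (Y (e.symm y))) (dd σ₁ (e.symm y) (Y (e.symm y)))))⁻¹ * a, ?_⟩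
    rw [hloc, Function.comp_apply, unitDeriv, map_smul, ha, smul_smul]
    rfl
  · intro y hy Z W
    rw [hd hy]
    have := (hf.isotropicPlane _).wedgeSpan_apply_eq_zero
      (hη.values _ (mfderiv 𝓘(ℝ, Plane) (𝓡 2) e.symm y W))
      (h.dd_sub_mem hf hy.2 (mfderiv 𝓘(ℝ, Plane) (𝓡 2) e.symm y Z))
    rw [map_sub, map_smul, sub_eq_zero] at this
    rw [hloc]
    exact this
  · intro y hy
    exact mem_perp.1 (h.unitDeriv_mem_perp hf hy.2) _ (h.section₁.2 _ hy.2)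
  · intro y hy
    exact (h.indep _ hy.2).ne_zero 0
  · rw [← he.dd_eq_fderiv hpe (h.section₁.mdifferentiableAt h.isOpen hp), Function.comp_apply,
      e.left_inv hpe]
    exact h.form_dd_unitDeriv_pos hf hp

end IsCurvatureFrame

end Surface

section Surface

variable {M : Type*} [TopologicalSpace M] [ChartedSpace Plane M]
variable {f : M → Submodule ℝ R42} {U : Set M}

theorem IsSmoothChart.dd_comp {E F : Type*} [NormedAddCommGroup E] [NormedSpace ℝ E]
    [NormedAddCommGroup F] [NormedSpace ℝ F] {e : OpenPartialHomeomorph M E}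
    (he : IsSmoothChart e) {g : E → F} {x : M} (hx : x ∈ e.source)
    (hg : DifferentiableAt ℝ g (e x)) (X : TangentSpace (𝓡 2) x) :
    dd (g ∘ e) x X = fderiv ℝ g (e x) (dd e x X) := by
  rw [dd, mfderiv_comp x hg.mdifferentiableAt (he.mdifferentiable.mdifferentiableAt hx),
    mfderiv_eq_fderiv]
  rfl

theorem contDiffOn_localExpr {η : OneForm M} (hη : IsSmoothForm η) (p : M) :
    ContDiffOn ℝ ∞ (localExpr η p) (chartAt Plane p).target := by
  have := hη p
  rwa [extChartAt_target, modelWithCornersSelf_coe_symm, Set.preimage_id,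
    modelWithCornersSelf_coe, Set.range_id, Set.inter_univ] at this

variable [IsManifold (𝓡 2) ∞ M]

theorem localExpr_dd (η : OneForm M) (p : M) {x : M} (hx : x ∈ (chartAt Plane p).source)
    (X : TangentSpace (𝓡 2) x) :
    localExpr η p (chartAt Plane p x) (dd (F := Plane) (chartAt Plane p) x X) = η x X := by
  rw [localExpr_apply]
  refine (η.congr_point ((chartAt Plane p).left_inv hx) _).trans ?_
  exact congrArg (η x) ((isSmoothChart_chartAt p).mfderiv_symm_dd hx X)

namespace IsCurvatureFrame

variable {σ₁ σ₂ : M → R42} {X Y : (p : M) → TangentSpace (𝓡 2) p}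

/-- Non-degeneracy of the quadratic differential of a middle potential. -/
theorem ne_zero_of_nondegenerate (h : IsCurvatureFrame f U σ₁ σ₂ X Y) (hf : IsLegendre f)
    {η : OneForm M} (hη : IsOmegaPotential f η) {p : M} (hp : p ∈ U) {k₁ k₂ : ℝ}
    (hk₁ : ∀ Z, η p Z (unitDeriv σ₁ Y p) =
      -(k₁ * form (dd σ₁ p Z) (unitDeriv σ₁ Y p)) • σ₁ p)
    (hk₂ : ∀ Z, η p Z (unitDeriv σ₂ X p) =
      -(k₂ * form (dd σ₂ p Z) (unitDeriv σ₂ X p)) • σ₂ p) : k₁ ≠ 0 := by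
  rintro rfl
  obtain ⟨q, hq, hnd⟩ := hη.nondegenerate
  apply h.neY p hp
  refine hnd p (Y p) fun W => ?_
  -- If `k₁` were zero, `η(Y)` would kill `E₁`; it kills `E₂` because `(d_Y σ₂, E₂) = 0`. Then it
  -- kills all derivatives of `σ₁`, `σ₂`, and `Y` lies in the radical of the quadratic differential.
  have h₁ : η p (Y p) (unitDeriv σ₁ Y p) = 0 := by rw [hk₁]; simp
  have h₂ : η p (Y p) (unitDeriv σ₂ X p) = 0 := by
    rw [hk₂, mem_perp.1 (h.swap.unitDeriv_mem_perp hf hp) _ (h.swap.dd_mem hp)]; simp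
  have e₁ := (hf.isotropicPlane p).wedgeSpan_apply_eq_zero (hη.values p (Y p))
    (h.dd_sub_mem hf hp W)
  have e₂ := (hf.isotropicPlane p).wedgeSpan_apply_eq_zero (hη.values p (Y p))
    (h.swap.dd_sub_mem hf hp W)
  rw [map_sub, map_smul, h₁, smul_zero, sub_zero] at e₁
  rw [map_sub, map_smul, h₂, smul_zero, sub_zero] at e₂
  have := hq.eq_add hf h.isOpen h.section₁ h.section₂ hp (h.indep p hp)
    (X := Y p) (Y := W) (k := 0) (l := 0) (m := 0) (n := 0) (by simp [e₁]) (by simp [e₂])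
  simpa using this

end IsCurvatureFrame

/-- Rescaling a section does not change its derivative modulo the section. -/
theorem fderiv_rescale {g : Plane → ℝ} {s : Plane → R42} {y : Plane}
    (hg : DifferentiableAt ℝ g y) (hs : DifferentiableAt ℝ s y) (Z : Plane) :
    fderiv ℝ (fun y => g y • s y) y Z = g y • fderiv ℝ s y Z + fderiv ℝ g y Z • s y := by
  rw [fderiv_fun_smul hg hs]
  simp

/-- Adapted frames of a middle potential. -/
theorem exists_normalFrame (hf : IsLegendre f) {η : OneForm M} (hη : IsOmegaPotential f η)
    (hmid : IsMiddle f η) (p : M) :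
    ∃ Ω ⊆ (chartAt Plane p).target, chartAt Plane p p ∈ Ω ∧
      ∃ (ε₁ ε₂ : ℝ) (s₁ s₂ E₁ E₂ : Plane → R42),
        IsNormalFrame (f ∘ (chartAt Plane p).symm) (localExpr η p) Ω ε₁ ε₂ s₁ s₂ E₁ E₂ := by
  obtain ⟨U, σ₁, σ₂, X, Y, hp, h, hm⟩ := hmid p
  have mid₁ : ∀ x ∈ U, ∀ Z : TangentSpace (𝓡 2) x,
      ∃ a : ℝ, η x Z (dd σ₁ x (Y x)) = a • σ₁ x := by
    intro x hx Z
    obtain ⟨g, hg, m, -, e, hm'⟩ := hm x hx Z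
    exact h.exists_apply_eq hf hx (hη.values x Z) hg hm' e
  have mid₂ : ∀ x ∈ U, ∀ Z : TangentSpace (𝓡 2) x,
      ∃ a : ℝ, η x Z (dd σ₂ x (X x)) = a • σ₂ x := by
    intro x hx Z
    obtain ⟨g, hg, m, -, e, hm'⟩ := hm x hx Z
    exact h.swap.exists_apply_eq hf hx (hη.values x Z) (by rwa [sup_comm]) hm' e
  obtain ⟨Ω₁, hΩ₁, hΩ₁o, hp₁, κ₁, hκ₁, hE₁⟩ := h.exists_localExpr_eq hf hη mid₁ hp
  obtain ⟨Ω₂, hΩ₂, hΩ₂o, hp₂, κ₂, hκ₂, hE₂⟩ := h.swap.exists_localExpr_eq hf hη mid₂ hp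
  have he := isSmoothChart_chartAt p
  have hpe : p ∈ (chartAt Plane p).source := mem_chart_source _ p
  have hat {σ : M → R42} {Z : (p : M) → TangentSpace (𝓡 2) p} {Ω : Set Plane} {κ : Plane → ℝ}
      (hσ : IsSectionOn f U σ) (hpΩ : chartAt Plane p p ∈ Ω)
      (hE : ∀ y ∈ Ω, ∀ W, localExpr η p y W (unitDeriv σ Z ((chartAt Plane p).symm y)) =
        -(κ y * form (fderiv ℝ (σ ∘ (chartAt Plane p).symm) y W)
          (unitDeriv σ Z ((chartAt Plane p).symm y))) • σ ((chartAt Plane p).symm y))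
      (W : TangentSpace (𝓡 2) p) : η p W (unitDeriv σ Z p) =
        -(κ (chartAt Plane p p) * form (dd σ p W) (unitDeriv σ Z p)) • σ p := by
    have := hE _ hpΩ (dd (F := Plane) (chartAt Plane p) p W)
    rwa [localExpr_dd η p hpe, (chartAt Plane p).left_inv hpe,
      ← he.dd_eq_fderiv hpe (hσ.mdifferentiableAt h.isOpen hp)] at this
  have a₁ := hat h.section₁ hp₁ hE₁
  have a₂ := hat h.section₂ hp₂ hE₂
  have n₁ := h.ne_zero_of_nondegenerate hf hη hp a₁ a₂
  have n₂ := h.swap.ne_zero_of_nondegenerate hf hη hp a₂ a₁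
  -- Writing `κ = ε g²`, the lift `g σ` absorbs one factor `g` in `(dσ, E)` and the other in `σ`,
  -- leaving only the sign `ε`.
  obtain ⟨V₁, hV₁, hV₁o, hpV₁, ε₁, g₁, sg₁, hg₁, hκg₁⟩ := exists_sign_mul_sq hΩ₁o hκ₁ hp₁ n₁
  obtain ⟨V₂, hV₂, hV₂o, hpV₂, ε₂, g₂, sg₂, hg₂, hκg₂⟩ := exists_sign_mul_sq hΩ₂o hκ₂ hp₂ n₂
  have hη' := contDiffOn_localExpr hη.smooth p
  have hcl := fun (y : Plane) (hy : y ∈ (chartAt Plane p).target) =>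
    localExpr_closed hη.smooth hη.closed p hy
  have hloc := localExpr_apply η p
  set e := chartAt Plane p
  have hsub₁ : V₁ ∩ V₂ ⊆ e.target ∩ e.symm ⁻¹' U := fun y hy => hΩ₁ (hV₁ hy.1)
  have hop : IsOpen (V₁ ∩ V₂) := hV₁o.inter hV₂o
  have hd₁ {y : Plane} (hy : y ∈ V₁ ∩ V₂) (Z : Plane) := he.fderiv_comp_symm (hsub₁ hy).1
    (h.section₁.mdifferentiableAt h.isOpen (hsub₁ hy).2) Z
  have hd₂ {y : Plane} (hy : y ∈ V₁ ∩ V₂) (Z : Plane) := he.fderiv_comp_symm (hsub₁ hy).1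
    (h.section₂.mdifferentiableAt h.isOpen (hsub₁ hy).2) Z
  have c₁ := (he.contDiffOn_comp_symm h.section₁.1).mono hsub₁
  have c₂ := (he.contDiffOn_comp_symm h.section₂.1).mono hsub₁
  have cg₁ : ContDiffOn ℝ ∞ g₁ (V₁ ∩ V₂) := hg₁.mono Set.inter_subset_left
  have cg₂ : ContDiffOn ℝ ∞ g₂ (V₁ ∩ V₂) := hg₂.mono Set.inter_subset_right
  have D₁ {y : Plane} (hy : y ∈ V₁ ∩ V₂) (Z : Plane) := fderiv_rescale
    ((cg₁.contDiffAt (hop.mem_nhds hy)).differentiableAt (by simp))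
    ((c₁.contDiffAt (hop.mem_nhds hy)).differentiableAt (by simp)) Z
  have D₂ {y : Plane} (hy : y ∈ V₁ ∩ V₂) (Z : Plane) := fderiv_rescale
    ((cg₂.contDiffAt (hop.mem_nhds hy)).differentiableAt (by simp))
    ((c₂.contDiffAt (hop.mem_nhds hy)).differentiableAt (by simp)) Z
  have F₁ {y : Plane} (hy : y ∈ V₁ ∩ V₂) (Z : Plane) :
      form (fderiv ℝ (fun y => g₁ y • (σ₁ ∘ e.symm) y) y Z) (unitDeriv σ₁ Y (e.symm y)) =
        g₁ y * form (fderiv ℝ (σ₁ ∘ e.symm) y Z) (unitDeriv σ₁ Y (e.symm y)) := by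
    rw [D₁ hy]
    simp [mem_perp.1 (h.unitDeriv_mem_perp hf (hsub₁ hy).2) _ (h.section₁.2 _ (hsub₁ hy).2)]
  have F₂ {y : Plane} (hy : y ∈ V₁ ∩ V₂) (Z : Plane) :
      form (fderiv ℝ (fun y => g₂ y • (σ₂ ∘ e.symm) y) y Z) (unitDeriv σ₂ X (e.symm y)) =
        g₂ y * form (fderiv ℝ (σ₂ ∘ e.symm) y Z) (unitDeriv σ₂ X (e.symm y)) := by
    rw [D₂ hy]
    simp [mem_perp.1 (h.swap.unitDeriv_mem_perp hf (hsub₁ hy).2) _ (h.section₂.2 _ (hsub₁ hy).2)]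
  refine ⟨V₁ ∩ V₂, fun y hy => (hsub₁ hy).1, ⟨hpV₁, hpV₂⟩, ε₁, ε₂,
    fun y => g₁ y • (σ₁ ∘ e.symm) y, fun y => g₂ y • (σ₂ ∘ e.symm) y,
    unitDeriv σ₁ Y ∘ e.symm, unitDeriv σ₂ X ∘ e.symm, ?_⟩
  refine
    { isOpen := hop
      smooth₁ := cg₁.smul c₁
      smooth₂ := cg₂.smul c₂
      smoothE₁ := (h.contDiffOn_unitDeriv hf he).mono hsub₁
      smoothE₂ := (h.swap.contDiffOn_unitDeriv hf he).mono hsub₁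
      smoothη := hη'.mono fun y hy => (hsub₁ hy).1
      closed := fun y hy => hcl y (hsub₁ hy).1
      plane := fun y _ => hf.isotropicPlane _
      mem₁ := fun y hy => Submodule.smul_mem _ _ (h.section₁.2 _ (hsub₁ hy).2)
      mem₂ := fun y hy => Submodule.smul_mem _ _ (h.section₂.2 _ (hsub₁ hy).2)
      indep := fun y hy => ?_
      perp₁ := fun y hy => h.unitDeriv_mem_perp hf (hsub₁ hy).2
      perp₂ := fun y hy => h.swap.unitDeriv_mem_perp hf (hsub₁ hy).2
      unit₁ := fun y hy => h.form_unitDeriv hf (hsub₁ hy).2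
      unit₂ := fun y hy => h.swap.form_unitDeriv hf (hsub₁ hy).2
      orth := fun y hy => h.form_unitDeriv_unitDeriv hf (hsub₁ hy).2
      deriv₁ := fun y hy Z => ?_
      deriv₂ := fun y hy Z => ?_
      values := fun y hy Z => hη.values _ _
      eta₁ := fun y hy Z => ?_
      eta₂ := fun y hy Z => ?_
      sign₁ := sg₁
      sign₂ := sg₂
      immersion := fun y hy Z h₁ h₂ => ?_ }
  · have := h.indep _ (hsub₁ hy).2
    rw [LinearIndependent.pair_iff] at this ⊢
    intro s t hst
    obtain ⟨hs, ht⟩ := this (s * g₁ y) (t * g₂ y) (by rw [← hst]; simp only [smul_smul]; rfl)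
    exact ⟨(mul_eq_zero.1 hs).resolve_right (hκg₁ y hy.1).1,
      (mul_eq_zero.1 ht).resolve_right (hκg₂ y hy.2).1⟩
  · have h1 := F₁ hy Z
    have h2 := h.dd_sub_mem hf (hsub₁ hy).2 (mfderiv 𝓘(ℝ, Plane) (𝓡 2) e.symm y Z)
    rw [← hd₁ hy] at h2
    rw [Function.comp_apply, Function.comp_apply, h1, D₁ hy]
    have := (f (e.symm y)).add_mem ((f (e.symm y)).smul_mem (g₁ y) h2)
      ((f (e.symm y)).smul_mem (fderiv ℝ g₁ y Z) (h.section₁.2 _ (hsub₁ hy).2))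
    convert! this using 1
    simp only [Function.comp_apply]
    module
  · have h1 := F₂ hy Z
    have h2 := h.swap.dd_sub_mem hf (hsub₁ hy).2 (mfderiv 𝓘(ℝ, Plane) (𝓡 2) e.symm y Z)
    rw [← hd₂ hy] at h2
    rw [Function.comp_apply, Function.comp_apply, h1, D₂ hy]
    have := (f (e.symm y)).add_mem ((f (e.symm y)).smul_mem (g₂ y) h2)
      ((f (e.symm y)).smul_mem (fderiv ℝ g₂ y Z) (h.section₂.2 _ (hsub₁ hy).2))
    convert! this using 1
    simp only [Function.comp_apply]
    module
  · rw [Function.comp_apply, F₁ hy, hE₁ y (hV₁ hy.1), (hκg₁ y hy.1).2, smul_smul]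
    congr 1
    ring
  · rw [Function.comp_apply, F₂ hy, hE₂ y (hV₂ hy.2), (hκg₂ y hy.2).2, smul_smul]
    congr 1
    ring
  · rw [Function.comp_apply, F₁ hy, mul_eq_zero, hd₁ hy] at h₁
    rw [Function.comp_apply, F₂ hy, mul_eq_zero, hd₂ hy] at h₂
    have := h.eq_zero_of_form_dd_eq_zero hf (hsub₁ hy).2 (h₁.resolve_left (hκg₁ y hy.1).1)
      (h₂.resolve_left (hκg₂ y hy.2).1)
    rw [← he.dd_mfderiv_symm (hsub₁ hy).1 Z, this]
    exact map_zero (mfderiv (𝓡 2) 𝓘(ℝ, Plane) e (e.symm y))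

end Surface

/-! ### Laguerre lifts and Euclidean projections -/

/-- The linear part `v ↦ v + (v, q0) qinf` of the projection to Euclidean space. -/
def euclideanPart (qinf q0 : R42) : R42 →L[ℝ] R42 :=
  ContinuousLinearMap.id ℝ R42 + (formL.flip q0).smulRight qinf

theorem euclideanPart_apply (qinf q0 v : R42) :
    euclideanPart qinf q0 v = v + form v q0 • qinf := rfl

/-- Adding multiples of `qinf` does not change pairings on `qinf^⊥`. Derivatives of the lifts lie
there, so the Euclidean fundamental forms can be computed directly from the sections of `f`. -/
theorem form_euclideanPart {qinf : R42} (q0 : R42) (hq : form qinf qinf = 0) {v w : R42}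
    (hv : form v qinf = 0) (hw : form w qinf = 0) :
    form (euclideanPart qinf q0 v) (euclideanPart qinf q0 w) = form v w := by
  simp [euclideanPart_apply, hq, hv, form_comm qinf w, hw]

section Surface

variable {M : Type*} [TopologicalSpace M] [ChartedSpace Plane M]

theorem dd_clm {F G : Type*} [NormedAddCommGroup F] [NormedSpace ℝ F] [NormedAddCommGroup G]
    [NormedSpace ℝ G] (L : F →L[ℝ] G) {s : M → F} {x : M}
    (hs : MDifferentiableAt (𝓡 2) 𝓘(ℝ, F) s x) (X : TangentSpace (𝓡 2) x) :
    dd (fun x => L (s x)) x X = L (dd s x X) := by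
  have h1 : mfderiv (𝓡 2) 𝓘(ℝ, G) (L ∘ s) x =
      (mfderiv 𝓘(ℝ, F) 𝓘(ℝ, G) L (s x)).comp (mfderiv (𝓡 2) 𝓘(ℝ, F) s x) :=
    mfderiv_comp x L.differentiableAt.mdifferentiableAt hs
  rw [mfderiv_eq_fderiv, L.fderiv] at h1
  exact congrArg (fun L => L X) h1

theorem dd_sub_const {F : Type*} [NormedAddCommGroup F] [NormedSpace ℝ F] {s : M → F} {x : M}
    (hs : MDifferentiableAt (𝓡 2) 𝓘(ℝ, F) s x) (c : F) (X : TangentSpace (𝓡 2) x) :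
    dd (fun x => s x - c) x X = dd s x X := by
  have := dd_add hs (mdifferentiableAt_const (c := -c)) X
  simp only [dd_const, add_zero, ← sub_eq_add_neg] at this
  exact this

/-- Sections `ρ`, `τ` of `f` representing the points and the oriented tangent planes of the
projection of `f` to Euclidean space. -/
structure IsLaguerreLift (f : M → Submodule ℝ R42) (qinf pt : R42) (ρ τ : M → R42) : Prop where
  smooth_ρ : ContMDiff (𝓡 2) 𝓘(ℝ, R42) ∞ ρ
  smooth_τ : ContMDiff (𝓡 2) 𝓘(ℝ, R42) ∞ τ
  mem_ρ : ∀ p, ρ p ∈ f p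
  mem_τ : ∀ p, τ p ∈ f p
  ρ_inf : ∀ p, form (ρ p) qinf = -1
  ρ_pt : ∀ p, form (ρ p) pt = 0
  τ_inf : ∀ p, form (τ p) qinf = 0
  τ_pt : ∀ p, form (τ p) pt = -1

variable {f : M → Submodule ℝ R42} {qinf q0 pt : R42} {ρ τ x n : M → R42}

theorem mem_perp_span_triple {a b c v : R42} :
    v ∈ perp (Submodule.span ℝ {a, b, c}) ↔ form a v = 0 ∧ form b v = 0 ∧ form c v = 0 := by
  rw [mem_perp]
  constructor
  · exact fun h => ⟨h _ (Submodule.subset_span (by simp)), h _ (Submodule.subset_span (by simp)),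
      h _ (Submodule.subset_span (by simp))⟩
  · rintro ⟨h1, h2, h3⟩ w hw
    obtain ⟨x, y, z, rfl⟩ := Submodule.mem_span_triple.1 hw
    simp [h1, h2, h3]

namespace IsLaguerreLift

theorem mdifferentiableAt_ρ (h : IsLaguerreLift f qinf pt ρ τ) (p : M) :
    MDifferentiableAt (𝓡 2) 𝓘(ℝ, R42) ρ p :=
  h.smooth_ρ.contMDiffAt.mdifferentiableAt (by simp)

theorem mdifferentiableAt_τ (h : IsLaguerreLift f qinf pt ρ τ) (p : M) :
    MDifferentiableAt (𝓡 2) 𝓘(ℝ, R42) τ p :=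
  h.smooth_τ.contMDiffAt.mdifferentiableAt (by simp)

theorem section_ρ (h : IsLaguerreLift f qinf pt ρ τ) (U : Set M) : IsSectionOn f U ρ :=
  ⟨h.smooth_ρ.contMDiffOn, fun p _ => h.mem_ρ p⟩

theorem section_τ (h : IsLaguerreLift f qinf pt ρ τ) (U : Set M) : IsSectionOn f U τ :=
  ⟨h.smooth_τ.contMDiffOn, fun p _ => h.mem_τ p⟩

theorem indep (h : IsLaguerreLift f qinf pt ρ τ) (p : M) :
    LinearIndependent ℝ ![ρ p, τ p] := by
  rw [LinearIndependent.pair_iff]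
  intro s t hst
  have h1 := congrArg (fun v => form v qinf) hst
  have h2 := congrArg (fun v => form v pt) hst
  simp [h.ρ_inf, h.τ_inf] at h1
  simp [h.ρ_pt, h.τ_pt] at h2
  exact ⟨h1, h2⟩

theorem span_eq (h : IsLaguerreLift f qinf pt ρ τ) (hf : IsLegendre f) (p : M) :
    f p = Submodule.span ℝ {ρ p, τ p} :=
  (hf.isotropicPlane p).span_eq (h.mem_ρ p) (h.mem_τ p) (h.indep p)

theorem eq_of_mem (h : IsLaguerreLift f qinf pt ρ τ) (hf : IsLegendre f) {p : M} {v : R42}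
    (hv : v ∈ f p) : v = -form v qinf • ρ p - form v pt • τ p := by
  rw [h.span_eq hf] at hv
  obtain ⟨a, b, rfl⟩ := Submodule.mem_span_pair.1 hv
  simp [h.ρ_inf, h.ρ_pt, h.τ_inf, h.τ_pt]

theorem form_dd_eq_zero {s : M → R42} {p : M} (hs : MDifferentiableAt (𝓡 2) 𝓘(ℝ, R42) s p)
    {v : R42} {c : ℝ} (hc : ∀ x, form (s x) v = c) (X : TangentSpace (𝓡 2) p) :
    form (dd s p X) v = 0 := by
  have h1 := dd_clm (formL.flip v) hs X
  have h2 : (fun x => formL.flip v (s x)) = fun _ => c := funext hc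
  rw [h2, dd_const] at h1
  exact h1.symm

theorem thirdFF_eq (h : IsLaguerreLift f qinf pt ρ τ) (hq : form qinf qinf = 0) (q0 : R42) (p : M)
    (X Y : TangentSpace (𝓡 2) p) :
    thirdFF (fun p => euclideanPart qinf q0 (τ p) - pt) p X Y = form (dd τ p X) (dd τ p Y) := by
  have ht := h.mdifferentiableAt_τ p
  have ht' : MDifferentiableAt (𝓡 2) 𝓘(ℝ, R42) (fun p => euclideanPart qinf q0 (τ p)) p :=
    (euclideanPart qinf q0).differentiableAt.mdifferentiableAt.comp p ht
  rw [thirdFF, dd_sub_const ht', dd_sub_const ht', dd_clm _ ht, dd_clm _ ht]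
  exact form_euclideanPart q0 hq (form_dd_eq_zero ht h.τ_inf X) (form_dd_eq_zero ht h.τ_inf Y)

theorem secondFF_eq (h : IsLaguerreLift f qinf pt ρ τ) (hq : form qinf qinf = 0) (q0 : R42) (p : M)
    (X Y : TangentSpace (𝓡 2) p) :
    secondFF (fun p => euclideanPart qinf q0 (ρ p) - q0)
      (fun p => euclideanPart qinf q0 (τ p) - pt) p X Y = -form (dd ρ p X) (dd τ p Y) := by
  have hr := h.mdifferentiableAt_ρ p
  have hr' : MDifferentiableAt (𝓡 2) 𝓘(ℝ, R42) (fun p => euclideanPart qinf q0 (ρ p)) p :=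
    (euclideanPart qinf q0).differentiableAt.mdifferentiableAt.comp p hr
  have ht := h.mdifferentiableAt_τ p
  have ht' : MDifferentiableAt (𝓡 2) 𝓘(ℝ, R42) (fun p => euclideanPart qinf q0 (τ p)) p :=
    (euclideanPart qinf q0).differentiableAt.mdifferentiableAt.comp p ht
  rw [secondFF, dd_sub_const ht', dd_sub_const hr', dd_clm _ ht, dd_clm _ hr]
  rw [form_euclideanPart q0 hq (form_dd_eq_zero hr h.ρ_inf X) (form_dd_eq_zero ht h.τ_inf Y)]

/-- The multiples of `qinf` come from isotropy of `f`: `(ρ,ρ) = 0` yields `(x,x) = -2(ρ,q0)`, and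
`(ρ,τ) = 0` yields `(n,x) = -(τ,q0)`. -/
theorem isEuclideanProjection (h : IsLaguerreLift f qinf pt ρ τ) (hf : IsLegendre f)
    (hL : IsLaguerreFrame qinf q0 pt) :
    IsEuclideanProjection f qinf q0 pt (fun p => euclideanPart qinf q0 (ρ p) - q0)
      (fun p => euclideanPart qinf q0 (τ p) - pt) := by
  have hρρ (p : M) := hf.isotropic p _ (h.mem_ρ p) _ (h.mem_ρ p)
  have hρτ (p : M) := hf.isotropic p _ (h.mem_ρ p) _ (h.mem_τ p)
  have hττ (p : M) := hf.isotropic p _ (h.mem_τ p) _ (h.mem_τ p)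
  have hxx (p : M) : form (euclideanPart qinf q0 (ρ p) - q0) (euclideanPart qinf q0 (ρ p) - q0) =
      -2 * form (ρ p) q0 := by
    simp [euclideanPart_apply, hρρ, h.ρ_inf, hL.null_inf, hL.null_zero, hL.pairing,
      form_comm qinf q0, form_comm qinf (ρ p), form_comm q0 (ρ p)]
    ring
  have hnx (p : M) : form (euclideanPart qinf q0 (τ p) - pt) (euclideanPart qinf q0 (ρ p) - q0) =
      -form (τ p) q0 := by
    simp [euclideanPart_apply, form_comm (τ p) (ρ p), hρτ, h.ρ_inf, h.τ_inf, hL.null_inf,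
      hL.pairing, form_comm qinf q0, form_comm qinf (ρ p), hL.perp_inf, hL.perp_zero,
      form_comm pt (ρ p), h.ρ_pt]
  refine ⟨?_, ?_, fun p => ?_, fun p => ?_, fun p => ?_, fun p => ?_, fun p => ?_⟩
  · exact ((euclideanPart qinf q0).contMDiff.comp h.smooth_ρ).sub contMDiff_const
  · exact ((euclideanPart qinf q0).contMDiff.comp h.smooth_τ).sub contMDiff_const
  · rw [mem_perp_span_triple]
    simp [euclideanPart_apply, form_comm _ (ρ p), h.ρ_inf, h.ρ_pt, hL.null_inf, hL.null_zero,
      hL.pairing, form_comm qinf q0, hL.perp_inf, hL.perp_zero]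
  · rw [mem_perp_span_triple]
    simp [euclideanPart_apply, form_comm _ (τ p), h.τ_inf, h.τ_pt, hL.null_inf,
      hL.pairing, form_comm qinf pt, form_comm q0 pt, hL.perp_inf, hL.perp_zero, hL.timelike]
  · simp [euclideanPart_apply, form_comm _ (τ p), h.τ_inf, h.τ_pt, hL.null_inf, hττ,
      form_comm qinf pt, hL.perp_inf, hL.timelike]
  · rw [hxx]
    convert! h.mem_ρ p using 1
    rw [euclideanPart_apply]; module
  · rw [hnx]
    convert! h.mem_τ p using 1
    rw [euclideanPart_apply]; module

end IsLaguerreLift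

theorem IsEuclideanProjection.isLaguerreLift (h : IsEuclideanProjection f qinf q0 pt x n)
    (hL : IsLaguerreFrame qinf q0 pt) :
    IsLaguerreLift f qinf pt (fun p => x p + q0 + (form (x p) (x p) / 2) • qinf)
      (fun p => n p + pt + form (n p) (x p) • qinf) := by
  have hx (p : M) := mem_perp_span_triple.1 (h.x_mem p)
  have hn (p : M) := mem_perp_span_triple.1 (h.n_mem p)
  have hform {a b : M → R42} (ha : ContMDiff (𝓡 2) 𝓘(ℝ, R42) ∞ a)
      (hb : ContMDiff (𝓡 2) 𝓘(ℝ, R42) ∞ b) :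
      ContMDiff (𝓡 2) 𝓘(ℝ) ∞ (fun p => form (a p) (b p)) :=
    ((formL.contMDiff.comp ha).clm_apply hb :)
  refine ⟨?_, ?_, h.point_mem, h.plane_mem, fun p => ?_, fun p => ?_, fun p => ?_, fun p => ?_⟩
  · exact (h.smooth_x.add contMDiff_const).add
      (((hform h.smooth_x h.smooth_x).div_const 2).smul contMDiff_const)
  · exact (h.smooth_n.add contMDiff_const).add
      ((hform h.smooth_n h.smooth_x).smul contMDiff_const)
  · simp [form_comm (x p) qinf, hx, hL.pairing, hL.null_inf]
  · simp [form_comm (x p) pt, hx, form_comm q0 pt, form_comm qinf pt, hL.perp_inf, hL.perp_zero]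
  · simp [form_comm (n p) qinf, hn, hL.perp_inf, hL.null_inf]
  · simp [form_comm (n p) pt, hn, hL.timelike, form_comm qinf pt, hL.perp_inf]

theorem IsEuclideanProjection.eq_euclideanPart (h : IsEuclideanProjection f qinf q0 pt x n)
    (hL : IsLaguerreFrame qinf q0 pt) :
    (x = fun p => euclideanPart qinf q0 (x p + q0 + (form (x p) (x p) / 2) • qinf) - q0) ∧
      n = fun p => euclideanPart qinf q0 (n p + pt + form (n p) (x p) • qinf) - pt := by
  have hx (p : M) := mem_perp_span_triple.1 (h.x_mem p)
  have hn (p : M) := mem_perp_span_triple.1 (h.n_mem p)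
  constructor
  · funext p
    rw [euclideanPart_apply]
    simp only [map_add, map_smul, LinearMap.add_apply, LinearMap.smul_apply, form_comm (x p) q0, hx,
      hL.null_zero, form_comm qinf q0, hL.pairing]
    module
  · funext p
    rw [euclideanPart_apply]
    simp only [map_add, map_smul, LinearMap.add_apply, LinearMap.smul_apply, form_comm (n p) q0, hn,
      hL.perp_zero, form_comm qinf q0, hL.pairing]
    module

/-- A Legendre map that avoids the vector at infinity projects to Euclidean space. -/
theorem IsLegendre.exists_laguerreLift (hf : IsLegendre f) (hL : IsLaguerreFrame qinf q0 pt)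
    (hq : ∀ p, qinf ∉ f p) : ∃ ρ τ : M → R42, IsLaguerreLift f qinf pt ρ τ := by
  -- A null vector orthogonal to both `qinf` and `pt` is a multiple of `qinf`, which is not in `f`.
  -- So the pairings with `qinf` and `pt` are coordinates on each fibre.
  have huniq : ∀ p, ∀ v ∈ f p, form v qinf = 0 → form v pt = 0 → v = 0 := by
    intro p v hv h1 h2
    obtain ⟨c, rfl⟩ := hL.exists_eq_smul (hf.isotropic p _ hv _ hv) h1 h2
    by_cases hc : c = 0
    · simp [hc]
    · exact absurd ((Submodule.smul_mem_iff _ hc).1 hv) (hq p)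
  have hdet : ∀ p (a b : R42), f p = Submodule.span ℝ {a, b} →
      form a qinf * form b pt - form a pt * form b qinf ≠ 0 := by
    intro p a b hab h0
    have ha : a ∈ f p := hab ▸ Submodule.subset_span (by simp)
    have hb : b ∈ f p := hab ▸ Submodule.subset_span (by simp)
    have hind : LinearIndependent ℝ ![a, b] := by
      have hr : Set.range ![a, b] = {a, b} := by simp [Set.pair_comm]
      rw [linearIndependent_iff_card_eq_finrank_span, Set.finrank, hr, ← hab, hf.rank_two]
      rfl
    have h1 := huniq p (form b pt • a - form a pt • b)
      ((f p).sub_mem ((f p).smul_mem _ ha) ((f p).smul_mem _ hb))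
      (by simp; linarith) (by simp; ring)
    have h2 := huniq p (form b qinf • a - form a qinf • b)
      ((f p).sub_mem ((f p).smul_mem _ ha) ((f p).smul_mem _ hb))
      (by simp; ring) (by simp; linarith)
    rw [LinearIndependent.pair_iff] at hind
    obtain ⟨h3, h4⟩ := hind (form b pt) (-form a pt) (by
      rw [neg_smul, ← sub_eq_add_neg]; exact h1)
    obtain ⟨h5, h6⟩ := hind (form b qinf) (-form a qinf) (by
      rw [neg_smul, ← sub_eq_add_neg]; exact h2)
    have := huniq p a ha (by linarith) (by linarith)
    have := hind 1 0 (by simp [this])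
    simp at this
  -- Cramer's rule for the section with prescribed pairings; it also shows smooth dependence on a
  -- local frame.
  have hex : ∀ p (a b : R42), f p = Submodule.span ℝ {a, b} → ∀ c d : ℝ,
      ((form a qinf * form b pt - form a pt * form b qinf)⁻¹ •
        ((c * form b pt - d * form b qinf) • a + (d * form a qinf - c * form a pt) • b)) ∈ f p ∧
      form ((form a qinf * form b pt - form a pt * form b qinf)⁻¹ •
        ((c * form b pt - d * form b qinf) • a + (d * form a qinf - c * form a pt) • b)) qinf = c ∧
      form ((form a qinf * form b pt - form a pt * form b qinf)⁻¹ •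
        ((c * form b pt - d * form b qinf) • a + (d * form a qinf - c * form a pt) • b)) pt =
          d := by
    intro p a b hab c d
    have h0 := hdet p a b hab
    have ha : a ∈ f p := hab ▸ Submodule.subset_span (by simp)
    have hb : b ∈ f p := hab ▸ Submodule.subset_span (by simp)
    refine ⟨(f p).smul_mem _ ((f p).add_mem ((f p).smul_mem _ ha) ((f p).smul_mem _ hb)), ?_, ?_⟩
    · simp only [map_add, map_smul, LinearMap.add_apply, LinearMap.smul_apply, smul_eq_mul]
      rw [inv_mul_eq_iff_eq_mul₀ h0]
      ring
    · simp only [map_add, map_smul, LinearMap.add_apply, LinearMap.smul_apply, smul_eq_mul]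
      rw [inv_mul_eq_iff_eq_mul₀ h0]
      ring
  have hform {U : Set M} {a : M → R42} (ha : ContMDiffOn (𝓡 2) 𝓘(ℝ, R42) ∞ a U) (v : R42) :
      ContMDiffOn (𝓡 2) 𝓘(ℝ) ∞ (fun p => form (a p) v) U :=
    ((formL.flip v).contMDiff.comp_contMDiffOn ha :)
  have key : ∀ c d : ℝ, ∃ s : M → R42, ContMDiff (𝓡 2) 𝓘(ℝ, R42) ∞ s ∧ (∀ p, s p ∈ f p) ∧
      (∀ p, form (s p) qinf = c) ∧ ∀ p, form (s p) pt = d := by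
    intro c d
    have : ∀ p, ∃ v ∈ f p, form v qinf = c ∧ form v pt = d := by
      intro p
      obtain ⟨U, -, hp, a, b, -, -, hab⟩ := hf.smooth p
      exact ⟨_, hex p _ _ (hab p hp) c d⟩
    choose s hs hs1 hs2 using this
    refine ⟨s, fun p => ?_, hs, hs1, hs2⟩
    obtain ⟨U, hU, hp, a, b, ha, hb, hab⟩ := hf.smooth p
    have hsm : ContMDiffOn (𝓡 2) 𝓘(ℝ, R42) ∞ (fun p =>
        (form (a p) qinf * form (b p) pt - form (a p) pt * form (b p) qinf)⁻¹ •
          ((c * form (b p) pt - d * form (b p) qinf) • a p +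
            (d * form (a p) qinf - c * form (a p) pt) • b p)) U := by
      have h1 : ContMDiffOn (𝓡 2) 𝓘(ℝ) ∞ (fun p =>
          (form (a p) qinf * form (b p) pt - form (a p) pt * form (b p) qinf)⁻¹) U :=
        ContMDiffOn.inv₀ (((hform ha _).mul (hform hb _)).sub ((hform ha _).mul (hform hb _)))
          fun p hp => hdet p _ _ (hab p hp)
      have h2 : ContMDiffOn (𝓡 2) 𝓘(ℝ) ∞
          (fun p => c * form (b p) pt - d * form (b p) qinf) U :=
        (contMDiffOn_const.mul (hform hb _)).sub (contMDiffOn_const.mul (hform hb _))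
      have h3 : ContMDiffOn (𝓡 2) 𝓘(ℝ) ∞
          (fun p => d * form (a p) qinf - c * form (a p) pt) U :=
        (contMDiffOn_const.mul (hform ha _)).sub (contMDiffOn_const.mul (hform ha _))
      exact h1.smul ((h2.smul ha).add (h3.smul hb))
    refine (hsm.congr fun p hp => ?_).contMDiffAt (hU.mem_nhds hp)
    obtain ⟨h1, h2, h3⟩ := hex p _ _ (hab p hp) c d
    rw [← sub_eq_zero]
    refine huniq p _ ((f p).sub_mem (hs p) h1) ?_ ?_
    · rw [map_sub, LinearMap.sub_apply, h2, hs1, sub_self]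
    · rw [map_sub, LinearMap.sub_apply, h3, hs2, sub_self]
  obtain ⟨ρ, h1, h2, h3, h4⟩ := key (-1) 0
  obtain ⟨τ, h5, h6, h7, h8⟩ := key 0 (-1)
  exact ⟨ρ, τ, h1, h5, h2, h6, h3, h4, h7, h8⟩

end Surface

/-! ### From a lightlike conserved quantity to an `L`-isothermic surface -/

section Surface

theorem polyEval_one {M : Type*} (p : ℕ → M → R42) (t : ℝ) (x : M) :
    polyEval 1 p t x = p 0 x + t • p 1 x := by
  simp [polyEval, Finset.sum_range_succ]

variable {M : Type*} [TopologicalSpace M] [ChartedSpace Plane M]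

/-- A conformal metric has no `(2,0)`-part in its own complex structure, so only the `q`-term
contributes and `d` serves as `μ`. -/
theorem commutesWith_of_eq_add {g q B : TwoTensor M}
    (h : ∀ x, ∃ c d : ℝ, ∀ X Y, B x X Y = c * g x X Y + d * q x X Y) : CommutesWith g q B := by
  choose c d hB using h
  refine ⟨d, fun U z hz x hx a b ha hb => ?_⟩
  obtain ⟨u, hu⟩ := hz.conformal
  have h1 : g x a a = g x b b := by rw [hu x hx, hu x hx, ha, hb]; simp
  have h2 : g x a b = 0 := by rw [hu x hx, ha, hb]; simp
  have h3 : g x b a = 0 := by rw [hu x hx, ha, hb]; simp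
  simp only [coeffZZ, hB, h1, h2, h3]
  push_cast
  ring

/-- The coefficients of a linear conserved quantity. -/
theorem IsConservedQuantity.dd_eq {η : OneForm M} {p : ℕ → M → R42}
    (h : IsConservedQuantity η 1 p) (x : M)
    (X : TangentSpace (𝓡 2) x) :
    dd (p 0) x X = 0 ∧ dd (p 1) x X = -η x X (p 0 x) ∧ η x X (p 1 x) = 0 := by
  have h0 : MDifferentiableAt (𝓡 2) 𝓘(ℝ, R42) (p 0) x :=
    (h.smooth 0).contMDiffAt.mdifferentiableAt (by simp)
  have h1 : MDifferentiableAt (𝓡 2) 𝓘(ℝ, R42) (p 1) x :=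
    (h.smooth 1).contMDiffAt.mdifferentiableAt (by simp)
  -- The left side is quadratic in `t`; its values at `0`, `1` and `-1` determine the coefficients.
  have key (t : ℝ) : dd (p 0) x X + t • dd (p 1) x X + t • (η x X (p 0 x) + t • η x X (p 1 x)) =
      0 := by
    have := h.parallel t x X
    rw [funext (polyEval_one p t)] at this
    simp only [map_add, map_smul] at this
    have h2 : MDifferentiableAt (𝓡 2) 𝓘(ℝ, R42) (fun x => t • p 1 x) x := h1.const_smul t
    rwa [dd_add h0 h2, dd_smul h1] at this
  have k0 := key 0
  have k1 := key 1
  have k2 := key (-1)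
  have e0 : dd (p 0) x X = 0 := by simpa using k0
  refine ⟨e0, ?_, ?_⟩
  · rw [eq_neg_iff_add_eq_zero]
    linear_combination (norm := module) (1 / 2 : ℝ) • k1 - (1 / 2 : ℝ) • k2
  · linear_combination (norm := module) (1 / 2 : ℝ) • k1 + (1 / 2 : ℝ) • k2 - k0

variable [IsManifold (𝓡 2) ∞ M]

theorem eq_const_of_dd_eq_zero [ConnectedSpace M] {F : Type*} [NormedAddCommGroup F]
    [NormedSpace ℝ F] {s : M → F} (hs : ContMDiff (𝓡 2) 𝓘(ℝ, F) ∞ s)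
    (h0 : ∀ x (X : TangentSpace (𝓡 2) x), dd s x X = 0) (x y : M) : s x = s y := by
  refine IsLocallyConstant.apply_eq_of_preconnectedSpace ?_ x y
  rw [IsLocallyConstant.iff_eventually_eq]
  intro p
  have he := isSmoothChart_chartAt p
  set e := chartAt Plane p
  have hp : p ∈ e.source := mem_chart_source _ p
  obtain ⟨r, hr, hball⟩ := Metric.isOpen_iff.1 e.open_target (e p) (e.map_source hp)
  have hd : ∀ w ∈ e.target, DifferentiableAt ℝ (s ∘ e.symm) w := fun w hw =>
    ((he.contDiffOn_comp_symm hs.contMDiffOn).contDiffAt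
      ((isOpen_chart_inter e isOpen_univ).mem_nhds ⟨hw, trivial⟩)).differentiableAt (by simp)
  have hn : e.source ∩ e ⁻¹' Metric.ball (e p) r ∈ 𝓝 p :=
    (e.continuousOn.isOpen_inter_preimage e.open_source Metric.isOpen_ball).mem_nhds
      ⟨hp, Metric.mem_ball_self hr⟩
  filter_upwards [hn] with x hx
  have := (convex_ball (e p) r).is_const_of_fderivWithin_eq_zero (𝕜 := ℝ) (f := s ∘ e.symm)
    (fun w hw => (hd w (hball hw)).differentiableWithinAt) (fun w hw => by
      rw [fderivWithin_of_isOpen Metric.isOpen_ball hw]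
      ext v
      rw [he.fderiv_comp_symm (hball hw) (hs.contMDiffAt.mdifferentiableAt (by simp)), h0]
      rfl) hx.2 (Metric.mem_ball_self hr)
  simpa [e.left_inv hx.1, e.left_inv hp] using this

variable {f : M → Submodule ℝ R42} {η : OneForm M}

theorem form_coeff_eq_zero {a b : R42} (h : ∀ t : ℝ, form (a + t • b) (a + t • b) = 0) :
    form a a = 0 ∧ form b a = 0 ∧ form b b = 0 := by
  have h0 := h 0
  have h1 := h 1
  have h2 := h (-1)
  simp [form_comm a b] at h0 h1 h2
  refine ⟨h0, ?_, ?_⟩ <;> linarith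

theorem dd_comp_chart_symm {s : M → R42} (hs : ContMDiff (𝓡 2) 𝓘(ℝ, R42) ∞ s) {q : R42}
    (hds : ∀ x X, dd s x X = -η x X q) (p : M) :
    ∀ y ∈ (chartAt Plane p).target, DifferentiableAt ℝ (s ∘ (chartAt Plane p).symm) y ∧
      ∀ Z, fderiv ℝ (s ∘ (chartAt Plane p).symm) y Z = -localExpr η p y Z q := by
  intro y hy
  have he := isSmoothChart_chartAt p
  refine ⟨((he.contDiffOn_comp_symm hs.contMDiffOn).contDiffAt ((isOpen_chart_inter
    (chartAt Plane p) isOpen_univ).mem_nhds ⟨hy, trivial⟩)).differentiableAt (by simp), fun Z => ?_⟩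
  rw [he.fderiv_comp_symm hy (hs.contMDiffAt.mdifferentiableAt (by simp)), hds]
  rfl

/-- Adapted frames of the middle potential of a special Omega surface of type one with a lightlike
conserved quantity. -/
theorem exists_normalFrame_of_conserved (hf : IsLegendre f) (hη : IsOmegaPotential f η)
    (hmid : IsMiddle f η) {q : R42} (hq0 : q ≠ 0) (hqq : form q q = 0) {s : M → R42}
    (hs : ContMDiff (𝓡 2) 𝓘(ℝ, R42) ∞ s) (hds : ∀ x X, dd s x X = -η x X q)
    (hηs : ∀ x X, η x X (s x) = 0) (hsq : ∀ x, form (s x) q = 0) (hss : ∀ x, form (s x) (s x) = 0)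
    (p : M) :
    ∃ Ω ⊆ (chartAt Plane p).target, chartAt Plane p p ∈ Ω ∧ ∃ s₁ s₂ E₁ E₂ : Plane → R42,
      IsNormalFrame (f ∘ (chartAt Plane p).symm) (localExpr η p) Ω 1 (-1) s₁ s₂ E₁ E₂ ∧
      ∀ y ∈ Ω, form (s₁ y) q ^ 2 = form (s₂ y) q ^ 2 := by
  obtain ⟨Ω, hΩ, hp, ε₁, ε₂, s₁, s₂, E₁, E₂, h⟩ := exists_normalFrame hf hη hmid p
  have hds' := dd_comp_chart_symm hs hds p
  have hmem : ∀ y ∈ Ω, s ((chartAt Plane p).symm y) ∈ f ((chartAt Plane p).symm y) :=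
    fun y hy => h.mem_of_eta_eq_zero hy (hss _) fun Z => by rw [localExpr_apply, hηs]
  have hquad : ∀ y ∈ Ω, ε₁ * form (s₁ y) q ^ 2 + ε₂ * form (s₂ y) q ^ 2 = 0 := fun y hy =>
    h.quadratic_of_conserved (fun y hy => (hds' y (hΩ hy)).1) (fun y hy => (hds' y (hΩ hy)).2)
      hmem (fun y _ => hsq _) hy
  obtain rfl := h.sign_of_conserved hq0 hqq hquad hp
  have hε : ε₁ ≠ 0 := fun h0 => by simpa [h0] using h.sign₁
  have hsq' : ∀ y ∈ Ω, form (s₁ y) q ^ 2 = form (s₂ y) q ^ 2 := fun y hy => by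
    apply mul_left_cancel₀ hε
    linear_combination hquad y hy
  -- Interchanging the two curvature spheres if necessary arranges the signs `1, -1`, for which the
  -- quadratic differential is `β₂² - β₁² = Re (β₂ + i β₁)²`.
  rcases mul_self_eq_one_iff.1 h.sign₁ with rfl | rfl
  · exact ⟨Ω, hΩ, hp, s₁, s₂, E₁, E₂, h, hsq'⟩
  · rw [neg_neg] at h
    exact ⟨Ω, hΩ, hp, s₂, s₁, E₂, E₁, h.swap, fun y hy => (hsq' y hy).symm⟩

/-- The fundamental forms in an adapted frame. -/
theorem IsLaguerreLift.exists_form_dd_eq {pt qinf : R42} {ρ τ : M → R42}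
    (hl : IsLaguerreLift f qinf pt ρ τ) (hf : IsLegendre f) (hη : IsOmegaPotential f η)
    {q : TwoTensor M} (hq : IsQuadDiffOf f η q) {p : M} {Ω : Set Plane}
    {s₁ s₂ E₁ E₂ : Plane → R42}
    (h : IsNormalFrame (f ∘ (chartAt Plane p).symm) (localExpr η p) Ω 1 (-1) s₁ s₂ E₁ E₂)
    {x : M} (hx : x ∈ (chartAt Plane p).source) (hxΩ : chartAt Plane p x ∈ Ω)
    (hsq : form (s₁ (chartAt Plane p x)) qinf ^ 2 = form (s₂ (chartAt Plane p x)) qinf ^ 2)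
    (hne : form (s₁ (chartAt Plane p x)) qinf ≠ 0) {L : TangentSpace (𝓡 2) x → ℂ}
    (hL : ∀ X, L X = coframe s₁ s₂ E₁ E₂ (chartAt Plane p x)
      (dd (F := Plane) (chartAt Plane p) x X)) :
    ∃ r c d : ℝ, 0 < r ∧
      (∀ X Y, form (dd τ x X) (dd τ x Y) = r * (L X * (starRingEnd ℂ) (L Y)).re) ∧
      (∀ X Y, -form (dd ρ x X) (dd τ x Y) =
        c * (L X * (starRingEnd ℂ) (L Y)).re + d * (L X * L Y).re) ∧
      ∀ X Y, q x X Y = (L X * L Y).re := by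
  have he := isSmoothChart_chartAt p
  set e := chartAt Plane p
  have hxe : e.symm (e x) = x := e.left_inv hx
  have hUo : IsOpen (e.source ∩ e ⁻¹' Ω) := e.continuousOn.isOpen_inter_preimage e.open_source
    h.isOpen
  have hxU : x ∈ e.source ∩ e ⁻¹' Ω := ⟨hx, hxΩ⟩
  have hs₁ : IsSectionOn f (e.source ∩ e ⁻¹' Ω) (s₁ ∘ e) :=
    ⟨he.contMDiffOn_comp h.smooth₁, fun x' hx' => by
      have := h.mem₁ _ hx'.2
      rwa [Function.comp_apply, e.left_inv hx'.1] at this⟩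
  have hs₂ : IsSectionOn f (e.source ∩ e ⁻¹' Ω) (s₂ ∘ e) :=
    ⟨he.contMDiffOn_comp h.smooth₂, fun x' hx' => by
      have := h.mem₂ _ hx'.2
      rwa [Function.comp_apply, e.left_inv hx'.1] at this⟩
  have hind : LinearIndependent ℝ ![(s₁ ∘ e) x, (s₂ ∘ e) x] := h.indep _ hxΩ
  have hP := hf.isotropicPlane x
  have hspan := hP.span_eq (hs₁.2 x hxU) (hs₂.2 x hxU) hind
  have hE₁ : E₁ (e x) ∈ perp (f x) := by
    have := h.perp₁ _ hxΩ
    rwa [Function.comp_apply, hxe] at this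
  have hE₂ : E₂ (e x) ∈ perp (f x) := by
    have := h.perp₂ _ hxΩ
    rwa [Function.comp_apply, hxe] at this
  have hre (X) : (L X).re = form (dd (s₂ ∘ e) x X) (E₂ (e x)) := by
    rw [hL, coframe_re, he.dd_comp hx (h.differentiableAt hxΩ).2.1]
  have him (X) : (L X).im = form (dd (s₁ ∘ e) x X) (E₁ (e x)) := by
    rw [hL, coframe_im, he.dd_comp hx (h.differentiableAt hxΩ).1]
  have hd₁ (X) : dd (s₁ ∘ e) x X - (L X).im • E₁ (e x) ∈ f x := by
    rw [him, he.dd_comp hx (h.differentiableAt hxΩ).1]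
    have := h.deriv₁ _ hxΩ (dd (F := Plane) e x X)
    rwa [Function.comp_apply, hxe] at this
  have hd₂ (X) : dd (s₂ ∘ e) x X - (L X).re • E₂ (e x) ∈ f x := by
    rw [hre, he.dd_comp hx (h.differentiableAt hxΩ).2.1]
    have := h.deriv₂ _ hxΩ (dd (F := Plane) e x X)
    rwa [Function.comp_apply, hxe] at this
  have hcomb {s : M → R42} (hs : IsSectionOn f (e.source ∩ e ⁻¹' Ω) s) {A B : ℝ}
      (hAB : s x = A • (s₁ ∘ e) x + B • (s₂ ∘ e) x) (X : TangentSpace (𝓡 2) x) :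
      ∃ v ∈ f x, dd s x X = (A * (L X).im) • E₁ (e x) + (B * (L X).re) • E₂ (e x) + v := by
    refine ⟨_, (f x).add_mem (hf.dd_sub_mem hs hs₁ hs₂ hUo hxU hAB X)
      ((f x).add_mem ((f x).smul_mem A (hd₁ X)) ((f x).smul_mem B (hd₂ X))), ?_⟩
    module
  have hform (a b a' b' : ℝ) {v w : R42} (hv : v ∈ f x) (hw : w ∈ f x) :
      form (a • E₁ (e x) + b • E₂ (e x) + v) (a' • E₁ (e x) + b' • E₂ (e x) + w) =
        a * a' + b * b' := by
    simp [h.unit₁ _ hxΩ, h.unit₂ _ hxΩ, h.orth _ hxΩ, form_comm (E₂ (e x)) (E₁ (e x)),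
      mem_perp.1 hE₁ _ hv, mem_perp.1 hE₂ _ hv, form_comm _ w, mem_perp.1 hE₁ _ hw,
      mem_perp.1 hE₂ _ hw, hP.isotropic _ hw _ hv]
  have hτx := hl.mem_τ x
  have hρx := hl.mem_ρ x
  rw [hspan] at hτx hρx
  obtain ⟨A, B, hAB⟩ := Submodule.mem_span_pair.1 hτx
  obtain ⟨C, D, hCD⟩ := Submodule.mem_span_pair.1 hρx
  -- Orthogonality of `τ` to `qinf` reads `A (s₁, qinf) + B (s₂, qinf) = 0`, and the two pairings
  -- have equal non-zero squares.
  have hAB2 : A ^ 2 = B ^ 2 := by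
    have h1 := hl.τ_inf x
    rw [← hAB] at h1
    simp at h1
    apply mul_right_cancel₀ (pow_ne_zero 2 hne)
    linear_combination (A * form (s₁ (e x)) qinf - B * form (s₂ (e x)) qinf) * h1 - B ^ 2 * hsq
  have hA : 0 < A ^ 2 := by
    rcases (sq_nonneg A).lt_or_eq with h0 | h0
    · exact h0
    · have hA0 : A = 0 := by nlinarith
      have hB0 : B = 0 := by nlinarith
      have := hl.τ_pt x
      rw [← hAB, hA0, hB0] at this
      simp at this
  -- In the adapted frame the second fundamental form is `-(CA β₁² + DB β₂²)`. The values of `c` and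
  -- `d` come from `β₂² + β₁² = |L|²` and `β₂² - β₁² = Re L²`.
  refine ⟨A ^ 2, -(C * A + D * B) / 2, -(D * B - C * A) / 2, hA, fun X Y => ?_, fun X Y => ?_,
    fun X Y => ?_⟩
  · obtain ⟨v, hv, ev⟩ := hcomb (hl.section_τ _) hAB.symm X
    obtain ⟨w, hw, ew⟩ := hcomb (hl.section_τ _) hAB.symm Y
    rw [ev, ew, hform _ _ _ _ hv hw]
    simp only [Complex.mul_re, Complex.conj_re, Complex.conj_im]
    linear_combination -(L X).re * (L Y).re * hAB2
  · obtain ⟨v, hv, ev⟩ := hcomb (hl.section_ρ _) hCD.symm X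
    obtain ⟨w, hw, ew⟩ := hcomb (hl.section_τ _) hAB.symm Y
    rw [ev, ew, hform _ _ _ _ hv hw]
    simp only [Complex.mul_re, Complex.conj_re, Complex.conj_im]
    ring
  · have hηE₁ : η x X (E₁ (e x)) = -(L X).im • (s₁ ∘ e) x := by
      rw [← localExpr_dd η p hx, h.eta₁ _ hxΩ, hL, coframe_im, one_mul]
      rfl
    have hηE₂ : η x X (E₂ (e x)) = (L X).re • (s₂ ∘ e) x := by
      rw [← localExpr_dd η p hx, h.eta₂ _ hxΩ, hL, coframe_re, neg_one_mul, neg_neg]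
      rfl
    have e₁ := hP.wedgeSpan_apply_eq_zero (hη.values x X) (hd₁ Y)
    have e₂ := hP.wedgeSpan_apply_eq_zero (hη.values x X) (hd₂ Y)
    rw [map_sub, map_smul, hηE₁, sub_eq_zero] at e₁
    rw [map_sub, map_smul, hηE₂, sub_eq_zero] at e₂
    rw [hq.eq_add hf hUo hs₁ hs₂ hxU hind (X := X) (Y := Y) (k := -((L X).im * (L Y).im)) (l := 0)
      (m := 0) (n := (L X).re * (L Y).re) (by rw [e₁]; module) (by rw [e₂]; module), Complex.mul_re]
    ring

/-- A special Omega surface of type one with a lightlike conserved quantity projects to an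
`L`-isothermic surface. -/
theorem isLIsothermic_of_conserved (hf : IsLegendre f) (hη : IsOmegaPotential f η)
    (hmid : IsMiddle f η) {qinf : R42} (hq0 : qinf ≠ 0) (hqq : form qinf qinf = 0) {s : M → R42}
    (hs : ContMDiff (𝓡 2) 𝓘(ℝ, R42) ∞ s) (hds : ∀ x X, dd s x X = -η x X qinf)
    (hηs : ∀ x X, η x X (s x) = 0) (hsq : ∀ x, form (s x) qinf = 0)
    (hss : ∀ x, form (s x) (s x) = 0) {q0 pt : R42} (hL : IsLaguerreFrame qinf q0 pt) :
    IsLIsothermic f qinf q0 pt := by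
  have hframe := exists_normalFrame_of_conserved hf hη hmid hq0 hqq hs hds hηs hsq hss
  have hnm : ∀ p, qinf ∉ f p := by
    intro p
    obtain ⟨Ω, -, hp, s₁, s₂, E₁, E₂, h, h12⟩ := hframe p
    have := h.not_mem_of_sq_eq hq0 hqq h12 hp
    rwa [Function.comp_apply, (chartAt Plane p).left_inv (mem_chart_source _ p)] at this
  obtain ⟨ρ, τ, hl⟩ := hf.exists_laguerreLift hL hnm
  obtain ⟨q, hq, -⟩ := hη.nondegenerate
  have hne {p : M} {Ω : Set Plane} {s₁ s₂ E₁ E₂ : Plane → R42}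
      (h : IsNormalFrame (f ∘ (chartAt Plane p).symm) (localExpr η p) Ω 1 (-1) s₁ s₂ E₁ E₂)
      (h12 : ∀ y ∈ Ω, form (s₁ y) qinf ^ 2 = form (s₂ y) qinf ^ 2) {y : Plane} (hy : y ∈ Ω) :
      form (s₁ y) qinf ≠ 0 := by
    intro h0
    have h0' : form (s₂ y) qinf = 0 := by
      have := h12 y hy
      rw [h0] at this
      exact pow_eq_zero_iff two_ne_zero |>.1 (by rw [← this]; simp)
    exact hnm _ (h.mem_of_form_eq_zero hqq hy h0 h0')
  -- The factor two turns the quadratic differential `Re dz²` of `η` into `dz² + dz̄²`.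
  refine ⟨_, _, hl.isEuclideanProjection hf hL, fun x X Y => 2 * q x X Y, fun p => ?_,
    commutesWith_of_eq_add fun x => ?_⟩
  · obtain ⟨Ω, hΩ, hp, s₁, s₂, E₁, E₂, h, h12⟩ := hframe p
    obtain ⟨Ω', hΩ', hΩ'o, hp', z, hz, hzi, hdz⟩ := h.exists_coordinate hp
    have he := isSmoothChart_chartAt p
    have hdd {x : M} (hx : x ∈ (chartAt Plane p).source)
        (hxΩ : chartAt Plane p x ∈ Ω') (X : TangentSpace (𝓡 2) x) :
        dd (z ∘ chartAt Plane p) x X = coframe s₁ s₂ E₁ E₂ (chartAt Plane p x)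
          (dd (F := Plane) (chartAt Plane p) x X) := by
      rw [he.dd_comp hx (hdz _ hxΩ).differentiableAt, (hdz _ hxΩ).fderiv]
    have key {x : M} (hx : x ∈ (chartAt Plane p).source) (hxΩ : chartAt Plane p x ∈ Ω') :=
      hl.exists_form_dd_eq hf hη hq h hx (hΩ' hxΩ) (h12 _ (hΩ' hxΩ)) (hne h h12 (hΩ' hxΩ))
        (hdd hx hxΩ)
    refine ⟨(chartAt Plane p).source ∩ chartAt Plane p ⁻¹' Ω', z ∘ chartAt Plane p,
      ⟨mem_chart_source _ p, hp'⟩, ⟨?_, he.contMDiffOn_comp hz, ?_, ?_, ?_⟩, ?_⟩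
    · exact (chartAt Plane p).continuousOn.isOpen_inter_preimage (chartAt Plane p).open_source hΩ'o
    · exact hzi.comp ((chartAt Plane p).injOn.mono Set.inter_subset_left) fun x hx => hx.2
    · rintro x ⟨hx, hxΩ⟩
      obtain ⟨g, hg⟩ := h.exists_coframe_equiv (hΩ' hxΩ)
      have : (fun X : TangentSpace (𝓡 2) x => dd (z ∘ chartAt Plane p) x X) =
          g ∘ fun X => dd (F := Plane) (chartAt Plane p) x X := by
        funext X
        rw [hdd hx hxΩ, ← hg]
        rfl
      rw [this]
      exact g.bijective.comp (he.dd_bijective hx)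
    -- The exponent is half the logarithm of the positive factor `r`; outside the coordinate domain
    -- its value is irrelevant and set to zero.
    · have : ∀ x, ∃ u : ℝ, x ∈ (chartAt Plane p).source ∩ chartAt Plane p ⁻¹' Ω' →
          ∀ X Y : TangentSpace (𝓡 2) x, thirdFF (fun p => euclideanPart qinf q0 (τ p) - pt) x X Y =
            Real.exp (2 * u) * (dd (z ∘ chartAt Plane p) x X *
              (starRingEnd ℂ) (dd (z ∘ chartAt Plane p) x Y)).re := by
        intro x
        by_cases hx : x ∈ (chartAt Plane p).source ∩ chartAt Plane p ⁻¹' Ω'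
        · obtain ⟨r, c, d, hr, h1, -, -⟩ := key hx.1 hx.2
          refine ⟨Real.log r / 2, fun _ X Y => ?_⟩
          rw [hl.thirdFF_eq hqq, h1, mul_div_cancel₀ _ two_ne_zero, Real.exp_log hr]
        · exact ⟨0, fun h => absurd h hx⟩
      choose u hu using this
      exact ⟨u, fun x hx => hu x hx⟩
    · rintro x ⟨hx, hxΩ⟩ X Y
      obtain ⟨r, c, d, -, -, -, h3⟩ := key hx hxΩ
      simp only [h3]
  · obtain ⟨Ω, hΩ, hp, s₁, s₂, E₁, E₂, h, h12⟩ := hframe x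
    obtain ⟨r, c, d, hr, h1, h2, h3⟩ := hl.exists_form_dd_eq hf hη hq h (mem_chart_source _ x) hp
      (h12 _ hp) (hne h h12 hp) (fun _ => rfl)
    refine ⟨c / r, d / 2, fun X Y => ?_⟩
    rw [hl.secondFF_eq hqq, hl.thirdFF_eq hqq, h1, h2, h3]
    field_simp

theorem IsSpecialOmega.exists_isLIsothermic [ConnectedSpace M] {p : ℕ → M → R42}
    (h : IsSpecialOmega f 1 p) (hnull : ∀ t x, form (polyEval 1 p t x) (polyEval 1 p t x) = 0) :
    ∃ qinf : R42, qinf ≠ 0 ∧ form qinf qinf = 0 ∧ (∀ x, p 0 x = qinf) ∧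
      ∀ q0 pt, IsLaguerreFrame qinf q0 pt → IsLIsothermic f qinf q0 pt := by
  obtain ⟨hf, -, η, hη, hmid, hp⟩ := h
  have hform (x : M) := form_coeff_eq_zero fun t => by
    have := hnull t x
    rwa [polyEval_one] at this
  obtain ⟨x₀⟩ := (inferInstance : Nonempty M)
  have hconst : ∀ x, p 0 x = p 0 x₀ := fun x =>
    eq_const_of_dd_eq_zero (hp.smooth 0) (fun x X => (hp.dd_eq x X).1) x x₀
  have hds : ∀ x X, dd (p 1) x X = -η x X (p 0 x₀) := fun x X => by
    rw [← hconst x]; exact (hp.dd_eq x X).2.1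
  have hηs : ∀ x X, η x X (p 1 x) = 0 := fun x X => (hp.dd_eq x X).2.2
  -- If the constant term were zero, the formula expressing `p₁` through the pairings `(σᵢ, p₀)`
  -- would give `p₁ = 0`.
  have hq0 : p 0 x₀ ≠ 0 := by
    intro h0
    apply hp.leading
    funext x
    obtain ⟨Ω, hΩ, hx, ε₁, ε₂, s₁, s₂, E₁, E₂, h⟩ := exists_normalFrame hf hη hmid x
    have hds' := dd_comp_chart_symm (hp.smooth 1) hds x
    have := h.eq_of_conserved (fun y hy => (hds' y (hΩ hy)).1) (fun y hy => (hds' y (hΩ hy)).2)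
      (fun y hy => h.mem_of_eta_eq_zero hy (hform _).2.2 fun Z => by
        rw [localExpr_apply, Function.comp_apply, hηs]) hx
    simpa [h0, (chartAt Plane x).left_inv (mem_chart_source _ x)] using this
  refine ⟨p 0 x₀, hq0, (hform x₀).1, hconst, fun q0 pt hL => ?_⟩
  exact isLIsothermic_of_conserved hf hη hmid hq0 (hform x₀).1 (hp.smooth 1) hds hηs
    (fun x => by rw [← hconst x]; exact (hform x).2.1) (fun x => (hform x).2.2) hL

end Surface

/-! ### Quadratic differentials, pull-backs and conformal charts -/

section Surface

variable {M : Type*} [TopologicalSpace M] [ChartedSpace Plane M]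

/-- A one-form with values in `f ∧ f^⊥` has a quadratic differential. -/
theorem IsLaguerreLift.exists_isQuadDiffOf [IsManifold (𝓡 2) ∞ M] {f : M → Submodule ℝ R42}
    {qinf pt : R42} {ρ τ : M → R42} (hl : IsLaguerreLift f qinf pt ρ τ) (hf : IsLegendre f)
    {η : OneForm M} (hη : ∀ p X, η p X ∈ wedgeSpan (f p) (perp (f p))) :
    ∃ q, IsQuadDiffOf f η q := by
  have key : ∀ (p : M) (X Y : TangentSpace (𝓡 2) p), ∃ L : f p →ₗ[ℝ] f p,
      ∀ U : Set M, IsOpen U → p ∈ U → ∀ σ : M → R42, IsSectionOn f U σ →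
        ∀ v : f p, (v : R42) = σ p → (L v : R42) = η p X (dd σ p Y) := by
    intro p X Y
    have hP := hf.isotropicPlane p
    have hρ := IsotropicPlane.wedgeSpan_apply_mem (hη p X)
      (hf.dd_mem_perp (hl.section_ρ Set.univ) isOpen_univ (Set.mem_univ p) Y)
    have hτ := IsotropicPlane.wedgeSpan_apply_mem (hη p X)
      (hf.dd_mem_perp (hl.section_τ Set.univ) isOpen_univ (Set.mem_univ p) Y)
    -- The functionals `-(·, qinf)` and `-(·, pt)` form the basis dual to `ρ`, `τ`, so this map
    -- takes `ρ`, `τ` to `η(X) d_Y ρ`, `η(X) d_Y τ`.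
    refine ⟨((-form.flip qinf).comp (f p).subtype).smulRight ⟨_, hρ⟩ +
      ((-form.flip pt).comp (f p).subtype).smulRight ⟨_, hτ⟩, fun U hU hp σ hσ v hv => ?_⟩
    have h1 := hl.eq_of_mem hf v.2
    have h2 := hP.wedgeSpan_apply_eq_zero (hη p X) (hf.dd_sub_mem hσ (hl.section_ρ U)
      (hl.section_τ U) hU hp (A := -form v qinf) (B := -form v pt)
      (by rw [← hv]; conv_lhs => rw [h1]
          module) Y)
    rw [map_sub, sub_eq_zero, map_add, map_smul, map_smul] at h2
    rw [h2]
    rfl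
  choose L hL using key
  exact ⟨fun p X Y => LinearMap.trace ℝ (f p) (L p X Y), fun p X Y => ⟨L p X Y, hL p X Y, rfl⟩⟩

section Pullback

variable [IsManifold (𝓡 2) ∞ M] {η : OneForm M} {e : OpenPartialHomeomorph M ℂ}
  {ζ : ℂ → ℂ →L[ℝ] R42 →L[ℝ] R42}

theorem IsSmoothChart.localExpr_eventuallyEq_pullback (he : IsSmoothChart e)
    (hηζ : ∀ x ∈ e.source, ∀ Z : TangentSpace (𝓡 2) x, η x Z = ζ (e x) (dd e x Z)) (p : M)
    {y : Plane} (hy : y ∈ (chartAt Plane p).target)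
    (hye : (chartAt Plane p).symm y ∈ e.source) :
    ContDiffAt ℝ ∞ (e ∘ (chartAt Plane p).symm) y ∧
      localExpr η p =ᶠ[𝓝 y] fun y => (ζ ((e ∘ (chartAt Plane p).symm) y)).comp
        (fderiv ℝ (e ∘ (chartAt Plane p).symm) y) := by
  have hp := isSmoothChart_chartAt p
  have hn := (isOpen_chart_inter (chartAt Plane p) e.open_source).mem_nhds ⟨hy, hye⟩
  refine ⟨(hp.contDiffOn_comp_symm he.smooth).contDiffAt hn, ?_⟩
  filter_upwards [hn] with y hy
  ext1 v
  rw [localExpr_apply, hηζ _ hy.2, ContinuousLinearMap.comp_apply,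
    hp.fderiv_comp_symm hy.1 (he.mdifferentiable.mdifferentiableAt hy.2)]
  rfl

theorem isSmoothForm_of_pullback
    (h : ∀ p, ∃ e : OpenPartialHomeomorph M ℂ, IsSmoothChart e ∧ p ∈ e.source ∧
      ∃ ζ : ℂ → ℂ →L[ℝ] R42 →L[ℝ] R42, ContDiffOn ℝ ∞ ζ e.target ∧
        ∀ x ∈ e.source, ∀ Z : TangentSpace (𝓡 2) x, η x Z = ζ (e x) (dd e x Z)) :
    IsSmoothForm η := by
  intro p y hy
  rw [extChartAt_target, modelWithCornersSelf_coe_symm, Set.preimage_id,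
    modelWithCornersSelf_coe, Set.range_id, Set.inter_univ] at hy
  obtain ⟨e, he, hpe, ζ, hζ, hηζ⟩ := h ((chartAt Plane p).symm y)
  obtain ⟨h1, h2⟩ := he.localExpr_eventuallyEq_pullback hηζ p hy hpe
  refine (ContDiffAt.congr_of_eventuallyEq ?_ h2).contDiffWithinAt
  have h3 : ContDiffAt ℝ ∞ ζ ((e ∘ (chartAt Plane p).symm) y) :=
    hζ.contDiffAt (e.open_target.mem_nhds (e.map_source hpe))
  exact (h3.comp y h1).clm_comp (h1.fderiv_right (m := ∞) le_rfl)

theorem IsSmoothChart.extDer_eq_zero (he : IsSmoothChart e) {p : M} (hp : p ∈ e.source)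
    (hζ : ContDiffOn ℝ ∞ ζ e.target)
    (hcl : ∀ v w, fderiv ℝ ζ (e p) v w = fderiv ℝ ζ (e p) w v)
    (hηζ : ∀ x ∈ e.source, ∀ Z : TangentSpace (𝓡 2) x, η x Z = ζ (e x) (dd e x Z))
    (X Y : TangentSpace (𝓡 2) p) : extDer η p X Y = 0 := by
  have hpp := mem_chart_source Plane p
  have hpe : (chartAt Plane p).symm (chartAt Plane p p) = p := (chartAt Plane p).left_inv hpp
  obtain ⟨h1, h2⟩ := he.localExpr_eventuallyEq_pullback hηζ p
    ((chartAt Plane p).map_source hpp) (by rwa [hpe])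
  have h3 : (e ∘ (chartAt Plane p).symm) (chartAt Plane p p) = e p := by
    rw [Function.comp_apply, hpe]
  have := closed_pullback h1 (θ := ζ) (by
    rw [h3]
    exact (hζ.contDiffAt (e.open_target.mem_nhds (e.map_source hp))).differentiableAt (by simp))
    (by rw [h3]; exact hcl) h2
  rw [extDer, sub_eq_zero]
  exact this _ _

end Pullback

/-- A conformal coordinate restricts to a smooth chart. -/
theorem IsConformalCoordinate.exists_smoothChart [IsManifold (𝓡 2) ∞ M] {g : TwoTensor M}
    {U : Set M} {z : M → ℂ} (hz : IsConformalCoordinate g U z) {p : M} (hp : p ∈ U) :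
    ∃ e : OpenPartialHomeomorph M ℂ, IsSmoothChart e ∧ p ∈ e.source ∧ e.source ⊆ U ∧
      ∀ x ∈ e.source, e x = z x := by
  have hφ := isSmoothChart_chartAt p
  have hpφ : p ∈ (chartAt Plane p).source := mem_chart_source _ p
  set φ := chartAt Plane p
  set V := φ.target ∩ φ.symm ⁻¹' U
  have hV : IsOpen V := isOpen_chart_inter φ hz.isOpen
  have hpV : φ p ∈ V := mem_chart_inter φ hpφ hp
  have hsm : ContDiffOn ℝ ∞ (z ∘ φ.symm) V := hφ.contDiffOn_comp_symm hz.smooth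
  have hat {y : Plane} (hy : y ∈ V) : ContDiffAt ℝ ∞ (z ∘ φ.symm) y :=
    hsm.contDiffAt (hV.mem_nhds hy)
  have heq {y : Plane} (hy : y ∈ V) :
      ∃ L : Plane ≃L[ℝ] ℂ, HasFDerivAt (z ∘ φ.symm) (L : Plane →L[ℝ] ℂ) y := by
    obtain ⟨L, hL⟩ := exists_equiv_of_injective (L := fderiv ℝ (z ∘ φ.symm) y) (fun Z hZ => by
      have hzd := (hz.smooth.contMDiffAt (hz.isOpen.mem_nhds hy.2)).mdifferentiableAt
        (n := ∞) (by simp)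
      rw [hφ.fderiv_comp_symm hy.1 hzd] at hZ
      have h0 := (hz.bijective _ hy.2).1 (hZ.trans (map_zero (mfderiv (𝓡 2) 𝓘(ℝ, ℂ) z _)).symm)
      have h1 := hφ.dd_mfderiv_symm hy.1 Z
      rw [h0] at h1
      rw [← h1]
      exact map_zero _)
    exact ⟨L, by rw [hL]; exact ((hat hy).differentiableAt (by simp)).hasFDerivAt⟩
  obtain ⟨L, hL⟩ := heq hpV
  let ψ := ((hat hpV).toOpenPartialHomeomorph (z ∘ φ.symm) hL (by simp)).restrOpen V hV
  have hψ : ψ.source ⊆ V := fun y hy => hy.2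
  have hψc : ⇑ψ = z ∘ φ.symm := rfl
  -- The derivative of `z` is invertible throughout `U`, not only at `p`; hence the local inverse is
  -- smooth on its whole domain.
  have hψs : ContDiffOn ℝ ∞ ψ.symm ψ.target := by
    intro a ha
    obtain ⟨L', hL'⟩ := heq (hψ (ψ.map_target ha))
    exact (ψ.contDiffAt_symm ha hL' (hat (hψ (ψ.map_target ha)))).contDiffWithinAt
  refine ⟨φ.trans ψ, ⟨?_, ?_⟩, ?_, ?_, ?_⟩
  · rw [OpenPartialHomeomorph.trans_source]
    exact hφ.contMDiffOn_comp (hsm.mono hψ)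
  · rw [OpenPartialHomeomorph.trans_target]
    refine hφ.smooth_symm.comp (t := φ.target) ?_ fun y hy => hy.2
    exact (contMDiffOn_iff_contDiffOn.2 hψs).mono Set.inter_subset_left
  · rw [OpenPartialHomeomorph.trans_source]
    exact ⟨hpφ, (hat hpV).mem_toOpenPartialHomeomorph_source hL (by simp), hpV⟩
  · rw [OpenPartialHomeomorph.trans_source]
    rintro x ⟨hx, hx'⟩
    have := (hψ hx').2
    rwa [Set.mem_preimage, φ.left_inv hx] at this
  · rw [OpenPartialHomeomorph.trans_source]
    rintro x ⟨hx, -⟩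
    change z (φ.symm (φ x)) = z x
    rw [φ.left_inv hx]

end Surface

/-! ### The middle potential in conformal curvature line coordinates -/

/-- Lifts of an `L`-isothermic surface in conformal curvature line coordinates. -/
structure IsIsothermicLift (f : ℂ → Submodule ℝ R42) (qinf pt : R42) (Ω : Set ℂ) (ρ τ : ℂ → R42)
    (E r₁ r₂ : ℂ → ℝ) : Prop where
  isOpen : IsOpen Ω
  smooth_ρ : ContDiffOn ℝ ∞ ρ Ω
  smooth_τ : ContDiffOn ℝ ∞ τ Ω
  plane : ∀ w ∈ Ω, IsotropicPlane (f w)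
  mem_ρ : ∀ w ∈ Ω, ρ w ∈ f w
  mem_τ : ∀ w ∈ Ω, τ w ∈ f w
  ρ_inf : ∀ w ∈ Ω, form (ρ w) qinf = -1
  ρ_pt : ∀ w ∈ Ω, form (ρ w) pt = 0
  τ_inf : ∀ w ∈ Ω, form (τ w) qinf = 0
  τ_pt : ∀ w ∈ Ω, form (τ w) pt = -1
  perp : ∀ w ∈ Ω, ∀ v, fderiv ℝ τ w v ∈ perp (f w)
  conformal : ∀ w ∈ Ω, ∀ v v',
    form (fderiv ℝ τ w v) (fderiv ℝ τ w v') = E w * (v * (starRingEnd ℂ) v').re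
  pos : ∀ w ∈ Ω, 0 < E w
  deriv₁ : ∀ w ∈ Ω, fderiv ℝ ρ w 1 = -r₁ w • fderiv ℝ τ w 1
  deriv₂ : ∀ w ∈ Ω, fderiv ℝ ρ w Complex.I = -r₂ w • fderiv ℝ τ w Complex.I
  ne : ∀ w ∈ Ω, r₁ w ≠ r₂ w

/-- The middle potential of an `L`-isothermic surface in conformal curvature line coordinates. -/
def isothermicForm (C E : ℂ → ℝ) (ρ τ : ℂ → R42) (w : ℂ) : ℂ →L[ℝ] R42 →L[ℝ] R42 :=
  fderiv ℝ (fun w => C w • wedge (ρ w) (τ w)) w -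
    (wedgeL (τ w)).comp ((E w)⁻¹ • (fderiv ℝ τ w).comp Complex.conjCLE.toContinuousLinearMap)

theorem isothermicForm_apply (C E : ℂ → ℝ) (ρ τ : ℂ → R42) (w v : ℂ) :
    isothermicForm C E ρ τ w v = fderiv ℝ (fun w => C w • wedge (ρ w) (τ w)) w v -
      wedge (τ w) ((E w)⁻¹ • fderiv ℝ τ w ((starRingEnd ℂ) v)) := rfl

theorem contDiff_wedgeL : ContDiff ℝ ∞ (fun v => wedgeL v) := by fun_prop

section

variable {E : Type*} [NormedAddCommGroup E] [NormedSpace ℝ E] {a b : E → R42} {y : E}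

theorem differentiableAt_wedge (ha : DifferentiableAt ℝ a y) (hb : DifferentiableAt ℝ b y) :
    DifferentiableAt ℝ (fun y => wedge (a y) (b y)) y :=
  (wedgeL.hasFDerivAt_of_bilinear ha.hasFDerivAt hb.hasFDerivAt).differentiableAt

theorem fderiv_wedge (ha : DifferentiableAt ℝ a y) (hb : DifferentiableAt ℝ b y) (v : E) :
    fderiv ℝ (fun y => wedge (a y) (b y)) y v =
      wedge (fderiv ℝ a y v) (b y) + wedge (a y) (fderiv ℝ b y v) := by
  have := (wedgeL.hasFDerivAt_of_bilinear ha.hasFDerivAt hb.hasFDerivAt).fderiv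
  simp only [wedgeL_apply] at this
  rw [this, add_comm]
  rfl

end

theorem symmetric_of_basis {F : Type*} [NormedAddCommGroup F] [NormedSpace ℝ F]
    {S : ℂ →L[ℝ] ℂ →L[ℝ] F} (h : S 1 Complex.I = S Complex.I 1) (v w : ℂ) : S v w = S w v := by
  have hv (v : ℂ) : v = v.re • (1 : ℂ) + v.im • Complex.I := by apply Complex.ext <;> simp
  rw [hv v, hv w]
  simp only [map_add, map_smul, _root_.add_apply, _root_.smul_apply, h]
  module

theorem clm_complex_apply {F : Type*} [NormedAddCommGroup F] [NormedSpace ℝ F]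
    (S : ℂ →L[ℝ] F) (v : ℂ) : S v = v.re • S 1 + v.im • S Complex.I := by
  rw [← map_smul, ← map_smul, ← map_add]
  congr 1
  apply Complex.ext <;> simp

namespace IsIsothermicLift

variable {f : ℂ → Submodule ℝ R42} {qinf pt : R42} {Ω : Set ℂ} {ρ τ : ℂ → R42}
  {E r₁ r₂ C : ℂ → ℝ} {w : ℂ}

theorem indep (h : IsIsothermicLift f qinf pt Ω ρ τ E r₁ r₂) (hw : w ∈ Ω) :
    LinearIndependent ℝ ![ρ w, τ w] := by
  rw [LinearIndependent.pair_iff]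
  intro s t hst
  have h1 := congrArg (fun v => form v qinf) hst
  have h2 := congrArg (fun v => form v pt) hst
  simp [h.ρ_inf w hw, h.τ_inf w hw] at h1
  simp [h.ρ_pt w hw, h.τ_pt w hw] at h2
  exact ⟨h1, h2⟩

theorem eq_zero_of_mem (h : IsIsothermicLift f qinf pt Ω ρ τ E r₁ r₂) (hw : w ∈ Ω) {v : R42}
    (hv : v ∈ f w) (h1 : form v qinf = 0) (h2 : form v pt = 0) : v = 0 := by
  rw [(h.plane w hw).span_eq (h.mem_ρ w hw) (h.mem_τ w hw) (h.indep hw)] at hv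
  obtain ⟨a, b, rfl⟩ := Submodule.mem_span_pair.1 hv
  simp [h.ρ_inf w hw, h.τ_inf w hw] at h1
  simp [h.ρ_pt w hw, h.τ_pt w hw] at h2
  simp [h1, h2]

theorem contDiffAt_ρ (h : IsIsothermicLift f qinf pt Ω ρ τ E r₁ r₂) (hw : w ∈ Ω) :
    ContDiffAt ℝ ∞ ρ w := h.smooth_ρ.contDiffAt (h.isOpen.mem_nhds hw)

theorem contDiffAt_τ (h : IsIsothermicLift f qinf pt Ω ρ τ E r₁ r₂) (hw : w ∈ Ω) :
    ContDiffAt ℝ ∞ τ w := h.smooth_τ.contDiffAt (h.isOpen.mem_nhds hw)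

theorem smooth_fderiv_τ (h : IsIsothermicLift f qinf pt Ω ρ τ E r₁ r₂) (v : ℂ) :
    ContDiffOn ℝ ∞ (fun w => fderiv ℝ τ w v) Ω :=
  (h.smooth_τ.fderiv_of_isOpen h.isOpen (m := ∞) le_rfl).clm_apply contDiffOn_const

theorem smooth_fderiv_ρ (h : IsIsothermicLift f qinf pt Ω ρ τ E r₁ r₂) (v : ℂ) :
    ContDiffOn ℝ ∞ (fun w => fderiv ℝ ρ w v) Ω :=
  (h.smooth_ρ.fderiv_of_isOpen h.isOpen (m := ∞) le_rfl).clm_apply contDiffOn_const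

theorem form_one_one (h : IsIsothermicLift f qinf pt Ω ρ τ E r₁ r₂) (hw : w ∈ Ω) :
    form (fderiv ℝ τ w 1) (fderiv ℝ τ w 1) = E w := by
  rw [h.conformal w hw]; simp

theorem form_I_I (h : IsIsothermicLift f qinf pt Ω ρ τ E r₁ r₂) (hw : w ∈ Ω) :
    form (fderiv ℝ τ w Complex.I) (fderiv ℝ τ w Complex.I) = E w := by
  rw [h.conformal w hw]; simp

theorem form_one_I (h : IsIsothermicLift f qinf pt Ω ρ τ E r₁ r₂) (hw : w ∈ Ω) :
    form (fderiv ℝ τ w 1) (fderiv ℝ τ w Complex.I) = 0 := by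
  rw [h.conformal w hw]; simp

theorem form_I_one (h : IsIsothermicLift f qinf pt Ω ρ τ E r₁ r₂) (hw : w ∈ Ω) :
    form (fderiv ℝ τ w Complex.I) (fderiv ℝ τ w 1) = 0 := by
  rw [form_comm, h.form_one_I hw]

theorem smooth_E (h : IsIsothermicLift f qinf pt Ω ρ τ E r₁ r₂) : ContDiffOn ℝ ∞ E Ω :=
  (contDiffOn_form (h.smooth_fderiv_τ 1) (h.smooth_fderiv_τ 1)).congr fun _ hw =>
    (h.form_one_one hw).symm

theorem smooth_r₁ (h : IsIsothermicLift f qinf pt Ω ρ τ E r₁ r₂) : ContDiffOn ℝ ∞ r₁ Ω := by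
  refine ((contDiffOn_form (h.smooth_fderiv_ρ 1) (h.smooth_fderiv_τ 1)).neg.div h.smooth_E
    fun w hw => (h.pos w hw).ne').congr fun w hw => ?_
  have := (h.pos w hw).ne'
  simp [h.deriv₁ w hw, h.form_one_one hw]
  field_simp

theorem smooth_r₂ (h : IsIsothermicLift f qinf pt Ω ρ τ E r₁ r₂) : ContDiffOn ℝ ∞ r₂ Ω := by
  refine ((contDiffOn_form (h.smooth_fderiv_ρ Complex.I) (h.smooth_fderiv_τ Complex.I)).neg.div
    h.smooth_E fun w hw => (h.pos w hw).ne').congr fun w hw => ?_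
  have := (h.pos w hw).ne'
  simp [h.deriv₂ w hw, h.form_I_I hw]
  field_simp

theorem smooth_scale (h : IsIsothermicLift f qinf pt Ω ρ τ E r₁ r₂)
    (hC : ∀ w ∈ Ω, C w * (E w * (r₁ w - r₂ w)) = 1) : ContDiffOn ℝ ∞ C Ω := by
  have hne : ∀ w ∈ Ω, E w * (r₁ w - r₂ w) ≠ 0 := fun w hw =>
    mul_ne_zero (h.pos w hw).ne' (sub_ne_zero.2 (h.ne w hw))
  refine ((h.smooth_E.mul (h.smooth_r₁.sub h.smooth_r₂)).inv hne).congr fun w hw => ?_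
  exact eq_inv_of_mul_eq_one_left (hC w hw)

theorem form_fderiv_eq_zero (h : IsIsothermicLift f qinf pt Ω ρ τ E r₁ r₂) {s : ℂ → R42}
    (hw : w ∈ Ω) (hs : DifferentiableAt ℝ s w) {a : R42} {c : ℝ}
    (hc : ∀ w ∈ Ω, form (s w) a = c) (v : ℂ) : form (fderiv ℝ s w v) a = 0 := by
  have h1 := hasFDerivAt_form hs (differentiableAt_const a) v
  have h2 : (fun w => form (s w) a) =ᶠ[𝓝 w] fun _ => c := by
    filter_upwards [h.isOpen.mem_nhds hw] with w hw using hc w hw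
  rw [h2.fderiv_eq] at h1
  simpa using h1.symm

theorem form_fderiv_add_eq_zero (h : IsIsothermicLift f qinf pt Ω ρ τ E r₁ r₂) {s t : ℂ → R42}
    (hw : w ∈ Ω) (hs : DifferentiableAt ℝ s w) (ht : DifferentiableAt ℝ t w)
    (hc : ∀ w ∈ Ω, form (s w) (t w) = 0) (v : ℂ) :
    form (fderiv ℝ s w v) (t w) + form (s w) (fderiv ℝ t w v) = 0 := by
  have h1 := hasFDerivAt_form hs ht v
  have h2 : (fun w => form (s w) (t w)) =ᶠ[𝓝 w] fun _ => 0 := by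
    filter_upwards [h.isOpen.mem_nhds hw] with w hw using hc w hw
  rw [h2.fderiv_eq] at h1
  simpa using h1.symm

/-- The mixed second derivative of the tangent plane congruence. -/
theorem mixed_deriv (h : IsIsothermicLift f qinf pt Ω ρ τ E r₁ r₂) (hw : w ∈ Ω) :
    fderiv ℝ (fderiv ℝ τ) w Complex.I 1 =
      (fderiv ℝ E w Complex.I / (2 * E w)) • fderiv ℝ τ w 1 +
        (fderiv ℝ E w 1 / (2 * E w)) • fderiv ℝ τ w Complex.I := by
  have hτ := h.contDiffAt_τ hw
  have hn := h.isOpen.mem_nhds hw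
  have hd (v : ℂ) : DifferentiableAt ℝ (fun w => fderiv ℝ τ w v) w :=
    ((h.smooth_fderiv_τ v).contDiffAt hn).differentiableAt (by simp)
  have hd2 : DifferentiableAt ℝ (fderiv ℝ τ) w :=
    (hτ.fderiv_right (m := ∞) le_rfl).differentiableAt (by simp)
  have hdd (v v' : ℂ) : fderiv ℝ (fun w => fderiv ℝ τ w v) w v' =
      fderiv ℝ (fderiv ℝ τ) w v' v := by
    rw [(hd2.hasFDerivAt.clm_apply (hasFDerivAt_const v w)).fderiv]
    simp
  have hsym := fderiv_fderiv_symm hτ Complex.I 1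
  have hE (v v' : ℂ) (hv : ∀ w ∈ Ω, form (fderiv ℝ τ w v) (fderiv ℝ τ w v) = E w) :
      form (fderiv ℝ (fderiv ℝ τ) w v' v) (fderiv ℝ τ w v) = fderiv ℝ E w v' / 2 := by
    have h1 := hasFDerivAt_form (hd v) (hd v) v'
    have h2 : (fun w => form (fderiv ℝ τ w v) (fderiv ℝ τ w v)) =ᶠ[𝓝 w] E := by
      filter_upwards [hn] with w hw using hv w hw
    rw [h2.fderiv_eq, hdd, form_comm (fderiv ℝ τ w v)] at h1
    linarith
  have h1 := hE 1 Complex.I fun w hw => h.form_one_one hw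
  have h2 := hE Complex.I 1 fun w hw => h.form_I_I hw
  rw [← hsym] at h2
  -- With `u`, `v` the real and imaginary directions, differentiating `(τ_u, ρ) = 0` along `v`
  -- leaves the term `(τ_u, ρ_v) = -r₂ (τ_u, τ_v) = 0`. Diagonality of the second fundamental form
  -- is used here.
  have hperp : fderiv ℝ (fderiv ℝ τ) w Complex.I 1 ∈ LieSphere.perp (f w) := by
    have hρτ := h.form_fderiv_add_eq_zero hw (hd 1) ((h.contDiffAt_ρ hw).differentiableAt (by simp))
      (fun w hw => by rw [form_comm]; exact mem_perp.1 (h.perp w hw 1) _ (h.mem_ρ w hw)) Complex.I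
    have hττ := h.form_fderiv_add_eq_zero hw (hd 1) (hτ.differentiableAt (by simp))
      (fun w hw => by rw [form_comm]; exact mem_perp.1 (h.perp w hw 1) _ (h.mem_τ w hw)) Complex.I
    rw [hdd] at hρτ hττ
    rw [h.deriv₂ w hw, map_smul, h.form_one_I hw, smul_zero, add_zero] at hρτ
    rw [h.form_one_I hw, add_zero] at hττ
    rw [(h.plane w hw).span_eq (h.mem_ρ w hw) (h.mem_τ w hw) (h.indep hw),
      IsotropicPlane.mem_perp_span_pair]
    exact ⟨by rw [form_comm, hρτ], by rw [form_comm, hττ]⟩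
  have hEne := (h.pos w hw).ne'
  have hmem := (h.plane w hw).sub_proj_mem (h.perp w hw 1) (h.perp w hw Complex.I) hperp
    (by rwa [h.form_one_one hw]) (by rwa [h.form_I_I hw]) (h.form_one_I hw)
  rw [h.form_one_one hw, h.form_I_I hw, h1, h2] at hmem
  have hdτ {a : R42} {c : ℝ} (hc : ∀ w ∈ Ω, form (τ w) a = c) (v : ℂ) :
      ∀ w ∈ Ω, form (fderiv ℝ τ w v) a = 0 := fun w hw =>
    h.form_fderiv_eq_zero hw ((h.contDiffAt_τ hw).differentiableAt (by simp)) hc v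
  have hddτ {a : R42} {c : ℝ} (hc : ∀ w ∈ Ω, form (τ w) a = c) :
      form (fderiv ℝ (fderiv ℝ τ) w Complex.I 1) a = 0 := by
    rw [← hdd]
    exact h.form_fderiv_eq_zero hw (hd 1) (hdτ hc 1) Complex.I
  -- After subtracting the components along `τ_u`, `τ_v` the remainder lies in `f`. It is orthogonal
  -- to `qinf` and `pt`, whose pairings with `τ` are constant, so it vanishes.
  have key := h.eq_zero_of_mem hw hmem
    (by simp [hddτ h.τ_inf, hdτ h.τ_inf _ w hw]) (by simp [hddτ h.τ_pt, hdτ h.τ_pt _ w hw])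
  rw [sub_sub, sub_eq_zero] at key
  rw [key, div_div, div_div]

theorem fderiv_scale_wedge (h : IsIsothermicLift f qinf pt Ω ρ τ E r₁ r₂) (hw : w ∈ Ω)
    (hC : DifferentiableAt ℝ C w) (v : ℂ) :
    fderiv ℝ (fun w => C w • wedge (ρ w) (τ w)) w v = fderiv ℝ C w v • wedge (ρ w) (τ w) +
      C w • (wedge (fderiv ℝ ρ w v) (τ w) + wedge (ρ w) (fderiv ℝ τ w v)) := by
  have hρ := (h.contDiffAt_ρ hw).differentiableAt (n := ∞) (by simp)
  have hτ := (h.contDiffAt_τ hw).differentiableAt (n := ∞) (by simp)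
  rw [fderiv_fun_smul hC (differentiableAt_wedge hρ hτ), _root_.add_apply, _root_.smul_apply,
    fderiv_wedge hρ hτ, ContinuousLinearMap.smulRight_apply, add_comm]

/-- The normalisation gives `E⁻¹ = C (r₁ - r₂)`, so subtracting the second summand replaces the
coefficient `r₁` of `τ` coming from `dρ` by `r₂`. -/
theorem isothermicForm_one (h : IsIsothermicLift f qinf pt Ω ρ τ E r₁ r₂) (hw : w ∈ Ω)
    (hC : DifferentiableAt ℝ C w) (hCE : C w * (E w * (r₁ w - r₂ w)) = 1) :
    isothermicForm C E ρ τ w 1 = fderiv ℝ C w 1 • wedge (ρ w) (τ w) +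
      C w • wedge (ρ w + r₂ w • τ w) (fderiv ℝ τ w 1) := by
  have hE : (E w)⁻¹ = C w * (r₁ w - r₂ w) := by
    rw [inv_eq_iff_eq_inv]
    apply eq_inv_of_mul_eq_one_left
    linear_combination hCE
  have : isothermicForm C E ρ τ w 1 = fderiv ℝ (fun w => C w • wedge (ρ w) (τ w)) w 1 -
      wedge (τ w) ((E w)⁻¹ • fderiv ℝ τ w 1) := by
    simp [isothermicForm_apply]
  rw [this, h.fderiv_scale_wedge hw hC, h.deriv₁ w hw, wedge_smul_right, wedge_smul_left,
    wedge_add_left, wedge_smul_left, hE, wedge_swap (fderiv ℝ τ w 1) (τ w)]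
  module

theorem isothermicForm_I (h : IsIsothermicLift f qinf pt Ω ρ τ E r₁ r₂) (hw : w ∈ Ω)
    (hC : DifferentiableAt ℝ C w) (hCE : C w * (E w * (r₁ w - r₂ w)) = 1) :
    isothermicForm C E ρ τ w Complex.I = fderiv ℝ C w Complex.I • wedge (ρ w) (τ w) +
      C w • wedge (ρ w + r₁ w • τ w) (fderiv ℝ τ w Complex.I) := by
  have hE : (E w)⁻¹ = C w * (r₁ w - r₂ w) := by
    rw [inv_eq_iff_eq_inv]
    apply eq_inv_of_mul_eq_one_left
    linear_combination hCE
  have : isothermicForm C E ρ τ w Complex.I =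
      fderiv ℝ (fun w => C w • wedge (ρ w) (τ w)) w Complex.I +
        wedge (τ w) ((E w)⁻¹ • fderiv ℝ τ w Complex.I) := by
    rw [isothermicForm_apply, Complex.conj_I, map_neg, smul_neg, ← wedgeL_apply, map_neg,
      sub_neg_eq_add, wedgeL_apply]
  rw [this, h.fderiv_scale_wedge hw hC, h.deriv₂ w hw, wedge_smul_right, wedge_smul_left,
    wedge_add_left, wedge_smul_left, hE, wedge_swap (fderiv ℝ τ w Complex.I) (τ w)]
  module

theorem smooth_scale_wedge (h : IsIsothermicLift f qinf pt Ω ρ τ E r₁ r₂)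
    (hC : ContDiffOn ℝ ∞ C Ω) : ContDiffOn ℝ ∞ (fun w => C w • wedge (ρ w) (τ w)) Ω :=
  hC.smul ((contDiff_wedgeL.comp_contDiffOn h.smooth_ρ).clm_apply h.smooth_τ)

theorem smooth_isothermicForm (h : IsIsothermicLift f qinf pt Ω ρ τ E r₁ r₂)
    (hC : ContDiffOn ℝ ∞ C Ω) : ContDiffOn ℝ ∞ (isothermicForm C E ρ τ) Ω := by
  refine ((h.smooth_scale_wedge hC).fderiv_of_isOpen h.isOpen (m := ∞) le_rfl).sub
    ((contDiff_wedgeL.comp_contDiffOn h.smooth_τ).clm_comp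
    ((h.smooth_E.inv fun w hw => (h.pos w hw).ne').smul
      ((h.smooth_τ.fderiv_of_isOpen h.isOpen (m := ∞) le_rfl).clm_comp contDiffOn_const)))

/-- The middle potential is closed. -/
theorem closed_isothermicForm (h : IsIsothermicLift f qinf pt Ω ρ τ E r₁ r₂)
    (hC : ContDiffOn ℝ ∞ C Ω) (hw : w ∈ Ω) (v v' : ℂ) :
    fderiv ℝ (isothermicForm C E ρ τ) w v v' = fderiv ℝ (isothermicForm C E ρ τ) w v' v := by
  have hn := h.isOpen.mem_nhds hw
  have hG := (h.smooth_scale_wedge hC).contDiffAt hn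
  have hG2 : DifferentiableAt ℝ (fderiv ℝ fun w => C w • wedge (ρ w) (τ w)) w :=
    (hG.fderiv_right (m := ∞) le_rfl).differentiableAt (by simp)
  have hτ := h.contDiffAt_τ hw
  have hd2 : DifferentiableAt ℝ (fderiv ℝ τ) w :=
    (hτ.fderiv_right (m := ∞) le_rfl).differentiableAt (by simp)
  have hE : DifferentiableAt ℝ E w := (h.smooth_E.contDiffAt hn).differentiableAt (by simp)
  have hEne := (h.pos w hw).ne'
  have hinv : HasFDerivAt (fun w => (E w)⁻¹) (-(E w ^ 2)⁻¹ • fderiv ℝ E w) w :=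
    (hasDerivAt_inv hEne).comp_hasFDerivAt w hE.hasFDerivAt
  have hζ : DifferentiableAt ℝ (isothermicForm C E ρ τ) w :=
    ((h.smooth_isothermicForm hC).contDiffAt hn).differentiableAt (by simp)
  have key (v v' : ℂ) : fderiv ℝ (isothermicForm C E ρ τ) w v v' =
      fderiv ℝ (fderiv ℝ fun w => C w • wedge (ρ w) (τ w)) w v v' -
        (wedge (fderiv ℝ τ w v) ((E w)⁻¹ • fderiv ℝ τ w ((starRingEnd ℂ) v')) +
          wedge (τ w) ((E w)⁻¹ • fderiv ℝ (fderiv ℝ τ) w v ((starRingEnd ℂ) v') -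
            ((E w ^ 2)⁻¹ * fderiv ℝ E w v) • fderiv ℝ τ w ((starRingEnd ℂ) v'))) := by
    have hτd := hτ.differentiableAt (n := ∞) (by simp)
    have h2 := hinv.fun_smul (hd2.hasFDerivAt.clm_apply
      (hasFDerivAt_const ((starRingEnd ℂ) v') w))
    have h3 : fderiv ℝ (isothermicForm C E ρ τ) w v v' =
        fderiv ℝ (fun w => isothermicForm C E ρ τ w v') w v := by
      rw [(hζ.hasFDerivAt.clm_apply (hasFDerivAt_const v' w)).fderiv]
      simp
    have h4 := hG2.hasFDerivAt.clm_apply (hasFDerivAt_const v' w)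
    simp only [isothermicForm_apply] at h3
    rw [h3, fderiv_fun_sub h4.differentiableAt
      (differentiableAt_wedge hτd h2.differentiableAt), _root_.sub_apply,
      fderiv_wedge hτd h2.differentiableAt, h2.fderiv, h4.fderiv]
    simp only [_root_.add_apply, _root_.smul_apply, ContinuousLinearMap.smulRight_apply,
      ContinuousLinearMap.comp_apply, ContinuousLinearMap.flip_apply, _root_.zero_apply,
      map_zero, zero_add]
    congr 3
    module
  -- One pair of directions suffices. The first summand is exact; for the second, `τ_u ∧ τ_v` terms
  -- cancel and the mixed derivative formula is exactly closedness of `E⁻¹(τ_u du - τ_v dv)`.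
  refine symmetric_of_basis ?_ v v'
  have hm := h.mixed_deriv hw
  rw [key, key, fderiv_fderiv_symm hG 1 Complex.I, Complex.conj_I, map_one (starRingEnd ℂ), map_neg,
    map_neg, fderiv_fderiv_symm hτ 1 Complex.I, hm, ← wedgeL_apply, ← wedgeL_apply, ← wedgeL_apply,
    ← wedgeL_apply]
  simp only [map_add, map_sub, map_smul, map_neg, smul_neg, wedgeL_apply,
    wedge_swap (fderiv ℝ τ w 1)]
  match_scalars <;> field_simp <;> ring

end IsIsothermicLift

namespace IsIsothermicLift

variable {f : ℂ → Submodule ℝ R42} {qinf pt : R42} {Ω : Set ℂ} {ρ τ : ℂ → R42}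
  {E r₁ r₂ C : ℂ → ℝ} {w : ℂ}

theorem isothermicForm_eq (h : IsIsothermicLift f qinf pt Ω ρ τ E r₁ r₂) (hw : w ∈ Ω)
    (hC : DifferentiableAt ℝ C w) (hCE : C w * (E w * (r₁ w - r₂ w)) = 1) (v : ℂ) :
    isothermicForm C E ρ τ w v = fderiv ℝ C w v • wedge (ρ w) (τ w) +
      (v.re * C w) • wedge (ρ w + r₂ w • τ w) (fderiv ℝ τ w 1) +
      (v.im * C w) • wedge (ρ w + r₁ w • τ w) (fderiv ℝ τ w Complex.I) := by
  rw [clm_complex_apply (isothermicForm C E ρ τ w), h.isothermicForm_one hw hC hCE,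
    h.isothermicForm_I hw hC hCE, clm_complex_apply (fderiv ℝ C w) v]
  simp only [smul_eq_mul]
  module

theorem isothermicForm_mem (h : IsIsothermicLift f qinf pt Ω ρ τ E r₁ r₂) (hw : w ∈ Ω)
    (hC : DifferentiableAt ℝ C w) (hCE : C w * (E w * (r₁ w - r₂ w)) = 1) (v : ℂ) :
    isothermicForm C E ρ τ w v ∈ wedgeSpan (f w) (LieSphere.perp (f w)) := by
  have hw' {a b : R42} (ha : a ∈ f w) (hb : b ∈ LieSphere.perp (f w)) :
      wedge a b ∈ wedgeSpan (f w) (LieSphere.perp (f w)) :=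
    Submodule.subset_span ⟨a, ha, b, hb, rfl⟩
  have hρτ (r : ℝ) : ρ w + r • τ w ∈ f w :=
    (f w).add_mem (h.mem_ρ w hw) ((f w).smul_mem _ (h.mem_τ w hw))
  rw [h.isothermicForm_eq hw hC hCE]
  exact Submodule.add_mem _ (Submodule.add_mem _
    (Submodule.smul_mem _ _ (hw' (h.mem_ρ w hw) ((h.plane w hw).le_perp (h.mem_τ w hw))))
    (Submodule.smul_mem _ _ (hw' (hρτ _) (h.perp w hw _))))
    (Submodule.smul_mem _ _ (hw' (hρτ _) (h.perp w hw _)))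

theorem isothermicForm_apply_one (h : IsIsothermicLift f qinf pt Ω ρ τ E r₁ r₂) (hw : w ∈ Ω)
    (hC : DifferentiableAt ℝ C w) (hCE : C w * (E w * (r₁ w - r₂ w)) = 1) (v : ℂ) :
    isothermicForm C E ρ τ w v (fderiv ℝ τ w 1) =
      -(v.re * (C w * E w)) • (ρ w + r₂ w • τ w) := by
  have h1 := mem_perp.1 (h.perp w hw 1) _ (h.mem_ρ w hw)
  have h2 := mem_perp.1 (h.perp w hw 1) _ (h.mem_τ w hw)
  rw [h.isothermicForm_eq hw hC hCE]
  simp only [_root_.add_apply, _root_.smul_apply, wedge_apply, map_add, map_smul,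
    LinearMap.add_apply, LinearMap.smul_apply, h1, h2, h.form_one_one hw, h.form_I_one hw]
  module

theorem isothermicForm_apply_I (h : IsIsothermicLift f qinf pt Ω ρ τ E r₁ r₂) (hw : w ∈ Ω)
    (hC : DifferentiableAt ℝ C w) (hCE : C w * (E w * (r₁ w - r₂ w)) = 1) (v : ℂ) :
    isothermicForm C E ρ τ w v (fderiv ℝ τ w Complex.I) =
      -(v.im * (C w * E w)) • (ρ w + r₁ w • τ w) := by
  have h1 := mem_perp.1 (h.perp w hw Complex.I) _ (h.mem_ρ w hw)
  have h2 := mem_perp.1 (h.perp w hw Complex.I) _ (h.mem_τ w hw)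
  rw [h.isothermicForm_eq hw hC hCE]
  simp only [_root_.add_apply, _root_.smul_apply, wedge_apply, map_add, map_smul,
    LinearMap.add_apply, LinearMap.smul_apply, h1, h2, h.form_one_I hw, h.form_I_I hw]
  module

/-- All values kill `f` and map the orthogonal vectors `τ_u`, `τ_v` to multiples of `ρ + r₂τ`, `ρ +
r₁τ`. In a product, `v` and `v'` enter only through `v.re * v'.re` and `v.im * v'.im`. -/
theorem isothermicForm_mul_comm (h : IsIsothermicLift f qinf pt Ω ρ τ E r₁ r₂) (hw : w ∈ Ω)
    (hC : DifferentiableAt ℝ C w) (hCE : C w * (E w * (r₁ w - r₂ w)) = 1) (v v' : ℂ) :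
    isothermicForm C E ρ τ w v * isothermicForm C E ρ τ w v' =
      isothermicForm C E ρ τ w v' * isothermicForm C E ρ τ w v := by
  have key (v v' : ℂ) (c : R42) :
      isothermicForm C E ρ τ w v (isothermicForm C E ρ τ w v' c) =
        -(v.re * v'.re * (C w * E w * C w * form (ρ w + r₂ w • τ w) c)) • (ρ w + r₂ w • τ w) -
        (v.im * v'.im * (C w * E w * C w * form (ρ w + r₁ w • τ w) c)) • (ρ w + r₁ w • τ w) := by
    have h0 {a : R42} (ha : a ∈ f w) : isothermicForm C E ρ τ w v a = 0 :=
      (h.plane w hw).wedgeSpan_apply_eq_zero (h.isothermicForm_mem hw hC hCE v) ha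
    rw [h.isothermicForm_eq hw hC hCE v']
    simp only [_root_.add_apply, _root_.smul_apply, wedge_apply, map_add, map_sub, map_smul,
      LinearMap.add_apply, LinearMap.smul_apply, h0 (h.mem_ρ w hw), h0 (h.mem_τ w hw),
      h.isothermicForm_apply_one hw hC hCE, h.isothermicForm_apply_I hw hC hCE, smul_eq_mul]
    module
  ext1 c
  rw [mul_apply_eq_comp, mul_apply_eq_comp, key, key, mul_comm v.re,
    mul_comm v.im]

/-- Since `qinf` is orthogonal to `τ` and `dτ`, and pairs to `-1` with `ρ`, only `-dC τ - C dτ`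
remains. This is the equation that makes `C τ` the linear coefficient of the conserved quantity. -/
theorem isothermicForm_apply_inf (h : IsIsothermicLift f qinf pt Ω ρ τ E r₁ r₂) (hw : w ∈ Ω)
    (hC : DifferentiableAt ℝ C w) (hCE : C w * (E w * (r₁ w - r₂ w)) = 1) (v : ℂ) :
    isothermicForm C E ρ τ w v qinf = -fderiv ℝ (fun w => C w • τ w) w v := by
  have hτ := (h.contDiffAt_τ hw).differentiableAt (n := ∞) (by simp)
  have h1 (v : ℂ) := h.form_fderiv_eq_zero hw hτ h.τ_inf v
  rw [h.isothermicForm_eq hw hC hCE, fderiv_fun_smul hC hτ]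
  simp only [_root_.add_apply, _root_.smul_apply, wedge_apply, map_add, map_smul,
    LinearMap.add_apply, LinearMap.smul_apply, h1, h.ρ_inf w hw, h.τ_inf w hw,
    ContinuousLinearMap.smulRight_apply]
  rw [clm_complex_apply (fderiv ℝ τ w) v]
  module

theorem fderiv_add_smul (h : IsIsothermicLift f qinf pt Ω ρ τ E r₁ r₂) (hw : w ∈ Ω) {r : ℂ → ℝ}
    (hr : DifferentiableAt ℝ r w) (v : ℂ) :
    fderiv ℝ (fun w => ρ w + r w • τ w) w v =
      fderiv ℝ ρ w v + r w • fderiv ℝ τ w v + fderiv ℝ r w v • τ w := by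
  have hρ := (h.contDiffAt_ρ hw).differentiableAt (n := ∞) (by simp)
  have hτ := (h.contDiffAt_τ hw).differentiableAt (n := ∞) (by simp)
  rw [fderiv_fun_add hρ (hr.fun_smul hτ), fderiv_fun_smul hr hτ]
  simp [add_assoc]

theorem differentiableAt_r₁ (h : IsIsothermicLift f qinf pt Ω ρ τ E r₁ r₂) (hw : w ∈ Ω) :
    DifferentiableAt ℝ r₁ w :=
  (h.smooth_r₁.contDiffAt (h.isOpen.mem_nhds hw)).differentiableAt (by simp)

theorem differentiableAt_r₂ (h : IsIsothermicLift f qinf pt Ω ρ τ E r₁ r₂) (hw : w ∈ Ω) :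
    DifferentiableAt ℝ r₂ w :=
  (h.smooth_r₂.contDiffAt (h.isOpen.mem_nhds hw)).differentiableAt (by simp)

/-- The decomposition of the potential with respect to the Lie cyclide splitting. -/
theorem exists_isothermicForm_eq (h : IsIsothermicLift f qinf pt Ω ρ τ E r₁ r₂) (hw : w ∈ Ω)
    (hC : DifferentiableAt ℝ C w) (hCE : C w * (E w * (r₁ w - r₂ w)) = 1)
    {S₁ S₂ : Submodule ℝ R42} (h₁ : ρ w + r₁ w • τ w ∈ S₁)
    (h₁' : fderiv ℝ (fun w => ρ w + r₁ w • τ w) w Complex.I ∈ S₁) (h₂ : ρ w + r₂ w • τ w ∈ S₂)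
    (h₂' : fderiv ℝ (fun w => ρ w + r₂ w • τ w) w 1 ∈ S₂) (v : ℂ) :
    ∃ g ∈ wedgeSpan S₁ S₁ ⊔ wedgeSpan S₂ S₂, ∃ m ∈ wedgeSpan S₁ S₂,
      isothermicForm C E ρ τ w v = g + m ∧ m ∈ wedgeSpan (f w) (f w) := by
  have hr := sub_ne_zero.2 (h.ne w hw)
  have hr' : r₂ w - r₁ w ≠ 0 := sub_ne_zero.2 (h.ne w hw).symm
  have hmem {A B : Submodule ℝ R42} {a b : R42} (ha : a ∈ A) (hb : b ∈ B) :
      wedge a b ∈ wedgeSpan A B := Submodule.subset_span ⟨a, ha, b, hb, rfl⟩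
  have hρτ (r : ℝ) : ρ w + r • τ w ∈ f w :=
    (f w).add_mem (h.mem_ρ w hw) ((f w).smul_mem _ (h.mem_τ w hw))
  -- Modulo `τ`, one has `τ_v = (ρ + r₁τ)_v / (r₁ - r₂)` and `τ_u = (ρ + r₂τ)_u / (r₂ - r₁)`.
  -- Substituting gives the two cyclide terms; the corrections are multiples of `ρ ∧ τ`, and `(ρ +
  -- r₁τ) ∧ (ρ + r₂τ) = (r₂ - r₁) ρ ∧ τ`.
  refine ⟨(v.im * C w / (r₁ w - r₂ w)) • wedge (ρ w + r₁ w • τ w)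
      (fderiv ℝ (fun w => ρ w + r₁ w • τ w) w Complex.I) +
    (v.re * C w / (r₂ w - r₁ w)) • wedge (ρ w + r₂ w • τ w)
      (fderiv ℝ (fun w => ρ w + r₂ w • τ w) w 1),
    Submodule.add_mem_sup (Submodule.smul_mem _ _ (hmem h₁ h₁'))
      (Submodule.smul_mem _ _ (hmem h₂ h₂')),
    ((fderiv ℝ C w v - v.im * C w / (r₁ w - r₂ w) * fderiv ℝ r₁ w Complex.I -
      v.re * C w / (r₂ w - r₁ w) * fderiv ℝ r₂ w 1) / (r₂ w - r₁ w)) •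
      wedge (ρ w + r₁ w • τ w) (ρ w + r₂ w • τ w),
    Submodule.smul_mem _ _ (hmem h₁ h₂), ?_, Submodule.smul_mem _ _ (hmem (hρτ _) (hρτ _))⟩
  rw [h.isothermicForm_eq hw hC hCE, h.fderiv_add_smul hw (h.differentiableAt_r₁ hw),
    h.fderiv_add_smul hw (h.differentiableAt_r₂ hw), h.deriv₁ w hw, h.deriv₂ w hw]
  simp only [wedge_add_left, wedge_add_right, wedge_smul_left, wedge_smul_right, wedge_self,
    wedge_swap (τ w) (ρ w)]
  match_scalars <;> field_simp <;> ring

end IsIsothermicLift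

/-! ### Transfer of the coordinate potential to the surface -/

section Surface

variable {M : Type*} [TopologicalSpace M] [ChartedSpace Plane M] {f : M → Submodule ℝ R42}
  {qinf pt : R42} {ρ τ : M → R42} {C : M → ℝ} {η : OneForm M} {e : OpenPartialHomeomorph M ℂ}
  {E r₁ r₂ : ℂ → ℝ}

/-- Conformal curvature line coordinates on an `L`-isothermic surface. -/
structure IsIsothermicChart (f : M → Submodule ℝ R42) (qinf pt : R42) (ρ τ : M → R42)
    (C : M → ℝ) (η : OneForm M) (e : OpenPartialHomeomorph M ℂ) (E r₁ r₂ : ℂ → ℝ) : Prop where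
  chart : IsSmoothChart e
  lift : IsIsothermicLift (f ∘ e.symm) qinf pt e.target (ρ ∘ e.symm) (τ ∘ e.symm) E r₁ r₂
  scale : ∀ w ∈ e.target, C (e.symm w) * (E w * (r₁ w - r₂ w)) = 1
  eta : ∀ x ∈ e.source, ∀ Z : TangentSpace (𝓡 2) x,
    η x Z = isothermicForm (C ∘ e.symm) E (ρ ∘ e.symm) (τ ∘ e.symm) (e x) (dd e x Z)

/-- The coordinate vector fields of a chart. -/
def coordField (e : OpenPartialHomeomorph M ℂ) (v : ℂ) (x : M) : TangentSpace (𝓡 2) x :=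
  (mfderiv 𝓘(ℝ, ℂ) (𝓡 2) e.symm (e x) v : Plane)

theorem IsSmoothChart.dd_coordField (he : IsSmoothChart e) {x : M} (hx : x ∈ e.source) (v : ℂ) :
    dd e x (coordField e v x) = v := by
  obtain ⟨Z, rfl⟩ := (he.dd_bijective hx).2 v
  exact congrArg (fun Z => dd e x Z) (he.mfderiv_symm_dd hx Z)

theorem IsSmoothChart.contMDiffOn_coordField [IsManifold (𝓡 2) ∞ M] (he : IsSmoothChart e)
    (v : ℂ) :
    ContMDiffOn (𝓡 2) (𝓡 2).tangent ∞
      (fun x => (⟨x, coordField e v x⟩ : TangentBundle (𝓡 2) M)) e.source := by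
  have h1 := he.smooth_symm.contMDiffOn_tangentMapWithin (m := ∞) le_rfl
    e.open_target.uniqueMDiffOn
  have h2 : ContMDiffOn 𝓘(ℝ, ℂ) 𝓘(ℝ, ℂ).tangent ∞
      (fun w : ℂ => (⟨w, v⟩ : TangentBundle 𝓘(ℝ, ℂ) ℂ)) Set.univ :=
    contMDiffOn_vectorSpace_iff_contDiffOn.2 contDiffOn_const
  have h3 := h1.comp (h2.comp he.smooth fun x _ => Set.mem_univ _) fun x hx => e.map_source hx
  refine h3.congr fun x hx => ?_
  -- `e.symm (e x)` and `x` are only propositionally equal, but their tangent fibres are the same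
  -- model plane.
  have key : ∀ {a b : M} (_ : a = b) (u : Plane),
      (⟨a, u⟩ : TangentBundle (𝓡 2) M) = ⟨b, u⟩ := by rintro a _ rfl u; rfl
  refine (key (e.left_inv hx).symm _).trans ?_
  change _ = (⟨e.symm (e x), mfderivWithin 𝓘(ℝ, ℂ) (𝓡 2) e.symm e.target (e x) v⟩ :
    TangentBundle (𝓡 2) M)
  rw [mfderivWithin_of_isOpen e.open_target (e.map_source hx)]
  rfl

namespace IsIsothermicChart

theorem smooth_scale (h : IsIsothermicChart f qinf pt ρ τ C η e E r₁ r₂) :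
    ContDiffOn ℝ ∞ (C ∘ e.symm) e.target :=
  h.lift.smooth_scale h.scale

theorem differentiableAt_scale (h : IsIsothermicChart f qinf pt ρ τ C η e E r₁ r₂) {w : ℂ}
    (hw : w ∈ e.target) : DifferentiableAt ℝ (C ∘ e.symm) w :=
  (h.smooth_scale.contDiffAt (e.open_target.mem_nhds hw)).differentiableAt (by simp)

theorem contMDiffOn_scale (h : IsIsothermicChart f qinf pt ρ τ C η e E r₁ r₂) :
    ContMDiffOn (𝓡 2) 𝓘(ℝ) ∞ C e.source := by
  refine ((h.chart.contMDiffOn_comp h.smooth_scale).mono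
    fun x hx => ⟨hx, e.map_source hx⟩).congr fun x hx => ?_
  simp [e.left_inv hx]

theorem eta_mem (h : IsIsothermicChart f qinf pt ρ τ C η e E r₁ r₂) {x : M} (hx : x ∈ e.source)
    (Z : TangentSpace (𝓡 2) x) : η x Z ∈ wedgeSpan (f x) (perp (f x)) := by
  have hw := e.map_source hx
  have := h.lift.isothermicForm_mem hw (h.differentiableAt_scale hw) (h.scale _ hw)
    (dd (F := ℂ) e x Z)
  rwa [Function.comp_apply, e.left_inv hx, ← h.eta x hx] at this

theorem bracket (h : IsIsothermicChart f qinf pt ρ τ C η e E r₁ r₂) {x : M} (hx : x ∈ e.source)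
    (X Y : TangentSpace (𝓡 2) x) : ⁅η x X, η x Y⁆ - ⁅η x Y, η x X⁆ = 0 := by
  have hw := e.map_source hx
  have : η x X * η x Y = η x Y * η x X := by
    rw [h.eta x hx, h.eta x hx]
    exact h.lift.isothermicForm_mul_comm hw (h.differentiableAt_scale hw) (h.scale _ hw) _ _
  simp only [Ring.lie_def, this, sub_self]

/-- The trace is taken in the basis `ρ`, `τ`. In either direction the radii combine to the
difference `r₁ - r₂`, and `C E (r₁ - r₂) = 1` yields the values of `Re dz²`, which is
non-degenerate. -/
theorem quadDiff_coordField [IsManifold (𝓡 2) ∞ M]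
    (h : IsIsothermicChart f qinf pt ρ τ C η e E r₁ r₂) (hf : IsLegendre f)
    (hl : IsLaguerreLift f qinf pt ρ τ) {q : TwoTensor M} (hq : IsQuadDiffOf f η q) {x : M}
    (hx : x ∈ e.source) (X : TangentSpace (𝓡 2) x) :
    q x X (coordField e 1 x) = (dd (F := ℂ) e x X).re ∧
      q x X (coordField e Complex.I x) = -(dd (F := ℂ) e x X).im := by
  have hw := e.map_source hx
  have hC := h.differentiableAt_scale hw
  have hs := h.scale _ hw
  have hρ (v : ℂ) : dd ρ x (coordField e v x) = fderiv ℝ (ρ ∘ e.symm) (e x) v := by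
    rw [h.chart.dd_eq_fderiv hx (hl.mdifferentiableAt_ρ x), h.chart.dd_coordField hx]
  have hτ (v : ℂ) : dd τ x (coordField e v x) = fderiv ℝ (τ ∘ e.symm) (e x) v := by
    rw [h.chart.dd_eq_fderiv hx (hl.mdifferentiableAt_τ x), h.chart.dd_coordField hx]
  have h1 := h.lift.isothermicForm_apply_one hw hC hs (dd (F := ℂ) e x X)
  have h2 := h.lift.isothermicForm_apply_I hw hC hs (dd (F := ℂ) e x X)
  simp only [Function.comp_apply, e.left_inv hx] at h1 h2 hs
  rw [← h.eta x hx] at h1 h2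
  constructor
  · rw [hq.eq_add hf isOpen_univ (hl.section_ρ _) (hl.section_τ _) (Set.mem_univ x) (hl.indep x)
      (X := X) (Y := coordField e 1 x) (k := r₁ (e x) * ((dd (F := ℂ) e x X).re * (C x * E (e x))))
      (l := r₁ (e x) * ((dd (F := ℂ) e x X).re * (C x * E (e x))) * r₂ (e x))
      (m := -((dd (F := ℂ) e x X).re * (C x * E (e x))))
      (n := -((dd (F := ℂ) e x X).re * (C x * E (e x))) * r₂ (e x))
      (by rw [hρ, h.lift.deriv₁ _ hw, map_smul, h1]; module) (by rw [hτ, h1]; module)]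
    linear_combination (dd (F := ℂ) e x X).re * hs
  · rw [hq.eq_add hf isOpen_univ (hl.section_ρ _) (hl.section_τ _) (Set.mem_univ x) (hl.indep x)
      (X := X) (Y := coordField e Complex.I x)
      (k := r₂ (e x) * ((dd (F := ℂ) e x X).im * (C x * E (e x))))
      (l := r₂ (e x) * ((dd (F := ℂ) e x X).im * (C x * E (e x))) * r₁ (e x))
      (m := -((dd (F := ℂ) e x X).im * (C x * E (e x))))
      (n := -((dd (F := ℂ) e x X).im * (C x * E (e x))) * r₁ (e x))
      (by rw [hρ, h.lift.deriv₂ _ hw, map_smul, h2]; module) (by rw [hτ, h2]; module)]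
    linear_combination -(dd (F := ℂ) e x X).im * hs

/-- Along its own direction `dρ` cancels against `rᵢ dτ`, so the derivative of `ρ + rᵢ τ` is a
multiple of `τ`, hence in `f`. Independence is `r₁ ≠ r₂`. -/
theorem isCurvatureFrame [IsManifold (𝓡 2) ∞ M]
    (h : IsIsothermicChart f qinf pt ρ τ C η e E r₁ r₂) (hf : IsLegendre f) :
    IsCurvatureFrame f e.source
      ((fun w => (ρ ∘ e.symm) w + r₁ w • (τ ∘ e.symm) w) ∘ e)
      ((fun w => (ρ ∘ e.symm) w + r₂ w • (τ ∘ e.symm) w) ∘ e)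
      (coordField e 1) (coordField e Complex.I) := by
  have hsec {r : ℂ → ℝ} (hr : ContDiffOn ℝ ∞ r e.target) :
      IsSectionOn f e.source ((fun w => (ρ ∘ e.symm) w + r w • (τ ∘ e.symm) w) ∘ e) := by
    refine ⟨(h.chart.contMDiffOn_comp (h.lift.smooth_ρ.add (hr.smul h.lift.smooth_τ))).mono
      fun x hx => ⟨hx, e.map_source hx⟩, fun x hx => ?_⟩
    have h1 := h.lift.mem_ρ _ (e.map_source hx)
    have h2 := h.lift.mem_τ _ (e.map_source hx)
    simp only [Function.comp_apply, e.left_inv hx] at h1 h2 ⊢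
    exact (f x).add_mem h1 ((f x).smul_mem _ h2)
  have hdd {r : ℂ → ℝ} (hr : ContDiffOn ℝ ∞ r e.target) {x : M} (hx : x ∈ e.source) (v : ℂ) :
      dd ((fun w => (ρ ∘ e.symm) w + r w • (τ ∘ e.symm) w) ∘ e) x (coordField e v x) =
        fderiv ℝ (ρ ∘ e.symm) (e x) v + r (e x) • fderiv ℝ (τ ∘ e.symm) (e x) v +
          fderiv ℝ r (e x) v • τ x := by
    have hw := e.map_source hx
    have hrd := (hr.contDiffAt (e.open_target.mem_nhds hw)).differentiableAt (n := ∞) (by simp)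
    have hρ := (h.lift.contDiffAt_ρ hw).differentiableAt (n := ∞) (by simp)
    have hτ := (h.lift.contDiffAt_τ hw).differentiableAt (n := ∞) (by simp)
    rw [h.chart.dd_comp hx (hρ.fun_add (hrd.fun_smul hτ)), h.chart.dd_coordField hx,
      h.lift.fderiv_add_smul hw hrd, Function.comp_apply (f := τ), e.left_inv hx]
  have hne {v : ℂ} (hv : v ≠ 0) (x : M) (hx : x ∈ e.source) : coordField e v x ≠ 0 := by
    intro h0
    apply hv
    rw [← h.chart.dd_coordField hx v, h0]
    exact map_zero _
  have hτmem {x : M} (hx : x ∈ e.source) : τ x ∈ f x := by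
    have := h.lift.mem_τ _ (e.map_source hx)
    rwa [Function.comp_apply, Function.comp_apply, e.left_inv hx] at this
  refine ⟨e.open_source, hsec h.lift.smooth_r₁, hsec h.lift.smooth_r₂, fun x hx => ?_,
    h.chart.contMDiffOn_coordField 1, h.chart.contMDiffOn_coordField _,
    hne one_ne_zero, hne Complex.I_ne_zero, fun x hx => ?_, fun x hx => ?_⟩
  · have hind := h.lift.indep (e.map_source hx)
    rw [LinearIndependent.pair_iff] at hind ⊢
    intro s t hst
    obtain ⟨h1, h2⟩ := hind (s + t) (s * r₁ (e x) + t * r₂ (e x)) (by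
      rw [← hst]
      simp only [Function.comp_apply]
      module)
    have hr := sub_ne_zero.2 (h.lift.ne _ (e.map_source hx))
    have hs : s = 0 := by
      apply mul_right_cancel₀ hr
      linear_combination h2 - r₂ (e x) * h1
    exact ⟨hs, by linarith⟩
  · rw [hf.solderKills_iff (hsec h.lift.smooth_r₁) e.open_source hx, hdd h.lift.smooth_r₁ hx,
      h.lift.deriv₁ _ (e.map_source hx), neg_smul, neg_add_cancel, zero_add]
    exact (f x).smul_mem _ (hτmem hx)
  · rw [hf.solderKills_iff (hsec h.lift.smooth_r₂) e.open_source hx, hdd h.lift.smooth_r₂ hx,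
      h.lift.deriv₂ _ (e.map_source hx), neg_smul, neg_add_cancel, zero_add]
    exact (f x).smul_mem _ (hτmem hx)

theorem exists_eta_eq (h : IsIsothermicChart f qinf pt ρ τ C η e E r₁ r₂) {x : M}
    (hx : x ∈ e.source) (Z : TangentSpace (𝓡 2) x) {S₁ S₂ : Submodule ℝ R42}
    (hS₁ : S₁ = cyclideSpace ((fun w => (ρ ∘ e.symm) w + r₁ w • (τ ∘ e.symm) w) ∘ e)
      (coordField e Complex.I) x)
    (hS₂ : S₂ = cyclideSpace ((fun w => (ρ ∘ e.symm) w + r₂ w • (τ ∘ e.symm) w) ∘ e)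
      (coordField e 1) x) :
    ∃ g ∈ wedgeSpan S₁ S₁ ⊔ wedgeSpan S₂ S₂, ∃ m ∈ wedgeSpan S₁ S₂,
      η x Z = g + m ∧ m ∈ wedgeSpan (f x) (f x) := by
  have hw := e.map_source hx
  have hρ := (h.lift.contDiffAt_ρ hw).differentiableAt (n := ∞) (by simp)
  have hτ := (h.lift.contDiffAt_τ hw).differentiableAt (n := ∞) (by simp)
  have hdd {r : ℂ → ℝ} (hr : DifferentiableAt ℝ r (e x)) (v : ℂ) :
      fderiv ℝ (fun w => (ρ ∘ e.symm) w + r w • (τ ∘ e.symm) w) (e x) v =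
        dd ((fun w => (ρ ∘ e.symm) w + r w • (τ ∘ e.symm) w) ∘ e) x (coordField e v x) := by
    rw [h.chart.dd_comp hx (hρ.fun_add (hr.fun_smul hτ)), h.chart.dd_coordField hx]
  have := h.lift.exists_isothermicForm_eq hw (h.differentiableAt_scale hw) (h.scale _ hw)
    (S₁ := S₁) (S₂ := S₂) (by rw [hS₁]; exact Submodule.subset_span (by simp))
    (by rw [hS₁, hdd (h.lift.differentiableAt_r₁ hw)]; exact Submodule.subset_span (by simp))
    (by rw [hS₂]; exact Submodule.subset_span (by simp))
    (by rw [hS₂, hdd (h.lift.differentiableAt_r₂ hw)]; exact Submodule.subset_span (by simp))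
    (dd (F := ℂ) e x Z)
  rwa [← h.eta x hx, Function.comp_apply (f := f), e.left_inv hx] at this

theorem eta_inf (h : IsIsothermicChart f qinf pt ρ τ C η e E r₁ r₂)
    (hl : IsLaguerreLift f qinf pt ρ τ) {x : M} (hx : x ∈ e.source) (Z : TangentSpace (𝓡 2) x) :
    η x Z qinf = -dd (fun x => C x • τ x) x Z := by
  have hw := e.map_source hx
  have hCτ : MDifferentiableAt (𝓡 2) 𝓘(ℝ, R42) (fun x => C x • τ x) x :=
    mdifferentiableAt_of_contMDiffOn (h.contMDiffOn_scale.smul hl.smooth_τ.contMDiffOn)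
      e.open_source hx
  rw [h.chart.dd_eq_fderiv hx hCτ, h.eta x hx,
    h.lift.isothermicForm_apply_inf hw (h.differentiableAt_scale hw) (h.scale _ hw)]
  rfl

end IsIsothermicChart

variable [IsManifold (𝓡 2) ∞ M]

/-- `η` and `C` are given on all of `M`, so each requirement is local and can be checked in a chart
about the point. The conserved quantity is `qinf + t C τ`. -/
theorem isSpecialOmega_of_isothermicCharts [Nonempty M] (hf : IsLegendre f) (hu : UmbilicFree f)
    (hl : IsLaguerreLift f qinf pt ρ τ) (hq : form qinf qinf = 0)
    (h : ∀ p, ∃ e E r₁ r₂, p ∈ e.source ∧ IsIsothermicChart f qinf pt ρ τ C η e E r₁ r₂) :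
    ∃ p : ℕ → M → R42, IsSpecialOmega f 1 p ∧
      (∀ t x, form (polyEval 1 p t x) (polyEval 1 p t x) = 0) ∧ ∀ x, p 0 x = qinf := by
  have hval : ∀ p X, η p X ∈ wedgeSpan (f p) (perp (f p)) := fun p X => by
    obtain ⟨e, E, r₁, r₂, hp, h⟩ := h p
    exact h.eta_mem hp X
  have hCτ : ContMDiff (𝓡 2) 𝓘(ℝ, R42) ∞ (fun x => C x • τ x) := fun p => by
    obtain ⟨e, E, r₁, r₂, hp, h⟩ := h p
    exact (h.contMDiffOn_scale.smul hl.smooth_τ.contMDiffOn).contMDiffAt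
      (e.open_source.mem_nhds hp)
  let P : ℕ → M → R42 := fun k x => if k = 0 then qinf else if k = 1 then C x • τ x else 0
  have hP (t : ℝ) : polyEval 1 P t = fun x => qinf + t • C x • τ x := by
    funext x
    rw [polyEval_one]
    simp [P]
  refine ⟨P, ⟨hf, hu, η, ⟨?_, hval, fun p X Y => ?_, fun p X Y => ?_, ?_⟩, fun p => ?_,
    ⟨fun k => ?_, fun k hk => ?_, fun h0 => ?_, fun t x X => ?_⟩⟩, fun t x => ?_, fun x => rfl⟩
  · refine isSmoothForm_of_pullback fun p => ?_
    obtain ⟨e, E, r₁, r₂, hp, h⟩ := h p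
    exact ⟨e, h.chart, hp, _, h.lift.smooth_isothermicForm h.smooth_scale, h.eta⟩
  · obtain ⟨e, E, r₁, r₂, hp, h⟩ := h p
    exact h.chart.extDer_eq_zero hp (h.lift.smooth_isothermicForm h.smooth_scale)
      (h.lift.closed_isothermicForm h.smooth_scale (e.map_source hp)) h.eta X Y
  · obtain ⟨e, E, r₁, r₂, hp, h⟩ := h p
    exact h.bracket hp X Y
  · obtain ⟨q, hq⟩ := hl.exists_isQuadDiffOf hf hval
    refine ⟨q, hq, fun p X hX => ?_⟩
    obtain ⟨e, E, r₁, r₂, hp, h⟩ := h p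
    obtain ⟨h1, h2⟩ := h.quadDiff_coordField hf hl hq hp X
    rw [hX] at h1 h2
    apply (h.chart.dd_bijective hp).1
    refine Eq.trans (b := (0 : ℂ)) (Complex.ext h1.symm ?_)
      (map_zero (mfderiv (𝓡 2) 𝓘(ℝ, ℂ) e p)).symm
    rw [Complex.zero_im]
    linarith
  · obtain ⟨e, E, r₁, r₂, hp, h⟩ := h p
    exact ⟨e.source, _, _, _, _, hp, h.isCurvatureFrame hf,
      fun x hx Z => h.exists_eta_eq hx Z rfl rfl⟩
  · by_cases h0 : k = 0
    · simpa [P, h0] using contMDiff_const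
    · by_cases h1 : k = 1
      · simpa [P, h1] using hCτ
      · simpa [P, h0, h1] using contMDiff_const
  · funext x
    simp [P, show k ≠ 0 by omega, show k ≠ 1 by omega]
  · obtain ⟨x⟩ := (inferInstance : Nonempty M)
    obtain ⟨e, E, r₁, r₂, hx, h⟩ := h x
    have h1 := congrFun h0 x
    simp only [P, one_ne_zero, if_false, if_true, Pi.zero_apply] at h1
    have h2 := h.scale _ (e.map_source hx)
    rw [e.left_inv hx] at h2
    have hC : C x ≠ 0 := left_ne_zero_of_mul_eq_one h2
    have h3 := hl.τ_pt x
    rw [(smul_eq_zero.1 h1).resolve_left hC] at h3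
    simp at h3
  · obtain ⟨e, E, r₁, r₂, hx, h⟩ := h x
    have hd := hCτ.contMDiffAt.mdifferentiableAt (x := x) (n := ∞) (by simp)
    have hd' : MDifferentiableAt (𝓡 2) 𝓘(ℝ, R42) (fun x => t • C x • τ x) x := hd.const_smul t
    rw [hP, dd_add mdifferentiableAt_const hd', dd_const, dd_smul hd, map_add, map_smul, map_smul,
      h.eta_inf hl hx, (hf.isotropicPlane x).wedgeSpan_apply_eq_zero (hval x X) (hl.mem_τ x)]
    module
  · rw [hP]
    simp [hq, form_comm qinf (τ x), hl.τ_inf, hf.isotropic x _ (hl.mem_τ x) _ (hl.mem_τ x)]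

end Surface

/-! ### From an `L`-isothermic surface to a special `Ω`-surface -/

theorem eq_of_forall_re_mul {a b : ℂ} (h : ∀ v : ℂ, (a * v).re = (b * v).re) : a = b := by
  apply Complex.ext
  · simpa using h 1
  · simpa using h Complex.I

section Surface

variable {M : Type*} [TopologicalSpace M] [ChartedSpace Plane M] [IsManifold (𝓡 2) ∞ M]
  {f : M → Submodule ℝ R42} {qinf pt : R42} {ρ τ : M → R42} {x : M}

/-- Points at which the principal radii of curvature coincide are umbilic. -/
theorem IsLaguerreLift.isUmbilic (hl : IsLaguerreLift f qinf pt ρ τ) (hf : IsLegendre f) {r : ℝ}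
    (hρ : ∀ Z, dd ρ x Z = -r • dd τ x Z) (hτ : ∀ Z, dd τ x Z ∈ f x → Z = 0) : IsUmbilic f x := by
  have hsec (a b : ℝ) : IsSectionOn f Set.univ (fun x => a • ρ x + b • τ x) :=
    ((hl.section_ρ _).smul a).add ((hl.section_τ _).smul b)
  have hdd (a b : ℝ) (Z) : dd (fun x => a • ρ x + b • τ x) x Z = (b - a * r) • dd τ x Z := by
    have hρd := hl.mdifferentiableAt_ρ x
    have hτd := hl.mdifferentiableAt_τ x
    have hρd' : MDifferentiableAt (𝓡 2) 𝓘(ℝ, R42) (fun x => a • ρ x) x := hρd.const_smul a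
    have hτd' : MDifferentiableAt (𝓡 2) 𝓘(ℝ, R42) (fun x => b • τ x) x := hτd.const_smul b
    rw [dd_add hρd' hτd', dd_smul hρd, dd_smul hτd, hρ]
    module
  have hkill (a b : ℝ) (Z) : SolderKills f x Z (a • ρ x + b • τ x) ↔
      (b - a * r) • dd τ x Z ∈ f x := by
    rw [← hdd]
    exact hf.solderKills_iff (hsec a b) isOpen_univ (Set.mem_univ x) Z
  have hne : ρ x + r • τ x ≠ 0 := by
    intro h0
    have := congrArg (fun v => form v qinf) h0
    simp [hl.ρ_inf, hl.τ_inf] at this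
  refine ⟨Submodule.span ℝ {ρ x + r • τ x}, ⟨?_, finrank_span_singleton hne, ⊤, ?_, ?_⟩, ?_⟩
  · rw [Submodule.span_singleton_le_iff_mem]
    exact (f x).add_mem (hl.mem_ρ x) ((f x).smul_mem _ (hl.mem_τ x))
  · exact (top_ne_bot : (⊤ : Submodule ℝ Plane) ≠ ⊥)
  · intro Z _ v hv
    obtain ⟨a, rfl⟩ := Submodule.mem_span_singleton.1 hv
    rw [smul_add, smul_smul, hkill, sub_self, zero_smul]
    exact (f x).zero_mem
  · rintro s ⟨hs, hs1, T, hT, hTs⟩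
    obtain ⟨Z, hZT, hZ⟩ := T.ne_bot_iff.1 hT
    refine Submodule.eq_of_le_of_finrank_eq (fun v hv => ?_)
      (by rw [hs1, finrank_span_singleton hne])
    have hv' := hs hv
    rw [hl.span_eq hf] at hv'
    obtain ⟨a, b, rfl⟩ := Submodule.mem_span_pair.1 hv'
    have h1 := (hkill a b Z).1 (hTs Z hZT _ hv)
    -- As `dτ` is injective modulo `f`, a section `a ρ + b τ` can be killed in a non-zero direction
    -- only if `b = a r`.
    have h2 : b - a * r = 0 := by
      by_contra h0
      exact hZ (hτ Z (((f x).smul_mem_iff h0).1 h1))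
    refine Submodule.mem_span_singleton.2 ⟨a, ?_⟩
    rw [smul_add, smul_smul, ← sub_eq_zero.1 h2]

/-- Conformal coordinates that diagonalise the second fundamental form. -/
theorem IsLaguerreLift.exists_isothermicLift (hl : IsLaguerreLift f qinf pt ρ τ)
    (hf : IsLegendre f) (hu : UmbilicFree f) {q : TwoTensor M} {μ : M → ℝ}
    (hhol : IsHolomorphicFor (fun x X Y => form (dd τ x X) (dd τ x Y)) q)
    (hμ : ∀ (U : Set M) (z : M → ℂ),
      IsConformalCoordinate (fun x X Y => form (dd τ x X) (dd τ x Y)) U z →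
      ∀ x ∈ U, ∀ a b : TangentSpace (𝓡 2) x, dd z x a = 1 → dd z x b = Complex.I →
        coeffZZ (fun x X Y => -form (dd ρ x X) (dd τ x Y)) x a b = (μ x : ℂ) * coeffZZ q x a b)
    (p : M) :
    ∃ (e : OpenPartialHomeomorph M ℂ) (E r₁ r₂ : ℂ → ℝ), IsSmoothChart e ∧ p ∈ e.source ∧
      IsIsothermicLift (f ∘ e.symm) qinf pt e.target (ρ ∘ e.symm) (τ ∘ e.symm) E r₁ r₂ ∧
      (∀ w ∈ e.target, E w * (r₁ w - r₂ w) = 4 * μ (e.symm w)) ∧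
      ∀ x ∈ e.source, ∀ X Y : TangentSpace (𝓡 2) x,
        q x X Y = 2 * (dd (F := ℂ) e x X * dd (F := ℂ) e x Y).re := by
  obtain ⟨U, z, hpU, hz, hq⟩ := hhol p
  obtain ⟨e, he, hp, heU, hez⟩ := hz.exists_smoothChart hpU
  obtain ⟨u, hu'⟩ := hz.conformal
  have hde {x : M} (hx : x ∈ e.source) (X : TangentSpace (𝓡 2) x) : dd z x X = dd e x X := by
    refine dd_congr ?_ X
    filter_upwards [e.open_source.mem_nhds hx] with x hx using (hez x hx).symm
  have hq' : ∀ x ∈ e.source, ∀ X Y : TangentSpace (𝓡 2) x,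
      q x X Y = 2 * (dd (F := ℂ) e x X * dd (F := ℂ) e x Y).re := fun x hx X Y => by
    rw [hq x (heU hx), hde hx, hde hx]
  have hρd {x : M} (hx : x ∈ e.source) (Z : TangentSpace (𝓡 2) x) :=
    he.dd_eq_fderiv hx (hl.mdifferentiableAt_ρ x) Z
  have hτd {x : M} (hx : x ∈ e.source) (Z : TangentSpace (𝓡 2) x) :=
    he.dd_eq_fderiv hx (hl.mdifferentiableAt_τ x) Z
  have hρc {x : M} (hx : x ∈ e.source) (v : ℂ) :
      fderiv ℝ (ρ ∘ e.symm) (e x) v = dd ρ x (coordField e v x) := by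
    rw [hρd hx, he.dd_coordField hx]
  have hτc {x : M} (hx : x ∈ e.source) (v : ℂ) :
      fderiv ℝ (τ ∘ e.symm) (e x) v = dd τ x (coordField e v x) := by
    rw [hτd hx, he.dd_coordField hx]
  have hsm {s : M → R42} (hs : ContMDiff (𝓡 2) 𝓘(ℝ, R42) ∞ s) :
      ContDiffOn ℝ ∞ (s ∘ e.symm) e.target :=
    (he.contDiffOn_comp_symm (hs.contMDiffOn (s := Set.univ))).mono fun w hw => ⟨hw, Set.mem_univ _⟩
  have htgt {w : ℂ} (hw : w ∈ e.target) : ∃ x ∈ e.source, e x = w :=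
    ⟨e.symm w, e.map_target hw, e.right_inv hw⟩
  have hperp {s : M → R42} (hs : ∀ U, IsSectionOn f U s) {x : M} (Z : TangentSpace (𝓡 2) x) :
      dd s x Z ∈ perp (f x) := hf.dd_mem_perp (hs Set.univ) isOpen_univ (Set.mem_univ x) Z
  set E : ℂ → ℝ := fun w => Real.exp (2 * u (e.symm w)) with hE
  have hEne (w : ℂ) : E w ≠ 0 := (Real.exp_pos _).ne'
  have hconf {x : M} (hx : x ∈ e.source) (v v' : ℂ) :
      form (dd τ x (coordField e v x)) (dd τ x (coordField e v' x)) =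
        E (e x) * (v * (starRingEnd ℂ) v').re := by
    rw [hu' x (heU hx), hde hx, hde hx, he.dd_coordField hx, he.dd_coordField hx]
    simp only [hE, e.left_inv hx]
  -- For the directions `1` and `i` these are the diagonal entries of the second fundamental form
  -- relative to the third.
  set r : ℂ → ℂ → ℝ := fun v w =>
    -form (fderiv ℝ (ρ ∘ e.symm) w v) (fderiv ℝ (τ ∘ e.symm) w v) / E w with hr
  have hrx {x : M} (hx : x ∈ e.source) (v : ℂ) : r v (e x) * E (e x) =
      -form (dd ρ x (coordField e v x)) (dd τ x (coordField e v x)) := by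
    rw [hr, ← hρc hx, ← hτc hx]
    exact div_mul_cancel₀ _ (hEne _)
  have hsym {x : M} (hx : x ∈ e.source) :
      form (dd ρ x (coordField e 1 x)) (dd τ x (coordField e Complex.I x)) =
        form (dd ρ x (coordField e Complex.I x)) (dd τ x (coordField e 1 x)) := by
    rw [← hρc hx, ← hτc hx, ← hρc hx, ← hτc hx]
    have hn := e.open_target.mem_nhds (e.map_source hx)
    refine form_fderiv_symm ((hsm hl.smooth_ρ).contDiffAt hn)
      (((hsm hl.smooth_τ).contDiffAt hn).differentiableAt (by simp)) ?_ _ _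
    filter_upwards [hn] with w hw Z
    obtain ⟨x, hx, rfl⟩ := htgt hw
    rw [hρc hx, Function.comp_apply, e.left_inv hx, form_comm]
    exact mem_perp.1 (hperp hl.section_ρ _) _ (hl.mem_τ x)
  -- Because `q = dz² + dz̄²` has `(2,0)`-coefficient one, the commuting condition equates the
  -- coefficient of the second fundamental form with the real number `μ`. Its imaginary part gives
  -- diagonality, its real part the difference of the radii; the `4` is the denominator in
  -- `coeffZZ`.
  have hcoeff {x : M} (hx : x ∈ e.source) :
      form (dd ρ x (coordField e 1 x)) (dd τ x (coordField e Complex.I x)) = 0 ∧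
        E (e x) * (r 1 (e x) - r Complex.I (e x)) = 4 * μ x := by
    have h1 := hμ U z hz x (heU hx) (coordField e 1 x) (coordField e Complex.I x)
      (by rw [hde hx, he.dd_coordField hx]) (by rw [hde hx, he.dd_coordField hx])
    simp only [coeffZZ, hq' x hx, he.dd_coordField hx, ← hsym hx] at h1
    have h2 := congrArg Complex.re h1
    have h3 := congrArg Complex.im h1
    simp at h2 h3
    refine ⟨by linarith, ?_⟩
    rw [mul_sub, mul_comm _ (r 1 (e x)), mul_comm _ (r Complex.I (e x)), hrx hx, hrx hx]
    linarith
  -- Project `d_v ρ` to `f^⊥/f`, where by `h0` only the component along `d_v τ` survives. The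
  -- remainder lies in `f` and is orthogonal to `qinf` and `pt`, so the equality holds exactly.
  have hderiv {x : M} (hx : x ∈ e.source) {v v' : ℂ} (hv : (v * (starRingEnd ℂ) v).re = 1)
      (hv' : (v' * (starRingEnd ℂ) v').re = 1) (hvv' : (v * (starRingEnd ℂ) v').re = 0)
      (h0 : form (dd ρ x (coordField e v x)) (dd τ x (coordField e v' x)) = 0) :
      dd ρ x (coordField e v x) = -r v (e x) • dd τ x (coordField e v x) := by
    have hvE := hconf hx v v
    have hv'E := hconf hx v' v'
    rw [hv, mul_one] at hvE
    rw [hv', mul_one] at hv'E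
    have hmem := (hf.isotropicPlane x).sub_proj_mem (hperp hl.section_τ (coordField e v x))
      (hperp hl.section_τ (coordField e v' x)) (hperp hl.section_ρ (coordField e v x))
      (by rw [hvE]; exact hEne _) (by rw [hv'E]; exact hEne _) (by rw [hconf hx, hvv', mul_zero])
    have hrv : form (dd ρ x (coordField e v x)) (dd τ x (coordField e v x)) =
        -r v (e x) * E (e x) := by linear_combination hrx hx v
    rw [h0, zero_div, zero_smul, sub_zero, hvE, hrv, mul_div_cancel_right₀ _ (hEne _)] at hmem
    have := hl.eq_of_mem hf hmem
    have hd {s : M → R42} (hs : MDifferentiableAt (𝓡 2) 𝓘(ℝ, R42) s x) {a : R42} {c : ℝ}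
        (hc : ∀ x, form (s x) a = c) := fun Z => form_dd_eq_zero hs hc Z
    have z1 := hd (hl.mdifferentiableAt_ρ x) hl.ρ_inf (coordField e v x)
    have z2 := hd (hl.mdifferentiableAt_ρ x) hl.ρ_pt (coordField e v x)
    have z3 := hd (hl.mdifferentiableAt_τ x) hl.τ_inf (coordField e v x)
    have z4 := hd (hl.mdifferentiableAt_τ x) hl.τ_pt (coordField e v x)
    rw [map_sub, map_smul, LinearMap.sub_apply, LinearMap.smul_apply, z1, z3,
      LinearMap.sub_apply, LinearMap.smul_apply, z2, z4, smul_zero, sub_zero, neg_zero, zero_smul,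
      zero_smul, sub_zero] at this
    exact sub_eq_zero.1 this
  have hd1 {x : M} (hx : x ∈ e.source) :=
    hderiv hx (v := 1) (v' := Complex.I) (by simp) (by simp) (by simp) (hcoeff hx).1
  have hd2 {x : M} (hx : x ∈ e.source) :=
    hderiv hx (v := Complex.I) (v' := 1) (by simp) (by simp) (by simp)
      ((hsym hx).symm.trans (hcoeff hx).1)
  refine ⟨e, E, r 1, r Complex.I, he, hp, ⟨e.open_target, hsm hl.smooth_ρ, hsm hl.smooth_τ,
    fun w _ => hf.isotropicPlane _, fun w _ => hl.mem_ρ _, fun w _ => hl.mem_τ _,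
    fun w _ => hl.ρ_inf _, fun w _ => hl.ρ_pt _, fun w _ => hl.τ_inf _, fun w _ => hl.τ_pt _,
    fun w hw v => ?_, fun w hw v v' => ?_, fun w _ => Real.exp_pos _, fun w hw => ?_,
    fun w hw => ?_, fun w hw h0 => ?_⟩, fun w hw => ?_, hq'⟩
  all_goals obtain ⟨x, hx, rfl⟩ := htgt hw
  · rw [hτc hx, Function.comp_apply, e.left_inv hx]
    exact hperp hl.section_τ _
  · rw [hτc hx, hτc hx, hconf hx]
  · rw [hρc hx, hτc hx, hd1 hx]
  · rw [hρc hx, hτc hx, hd2 hx]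
  -- Equal radii make `dρ` a multiple of `dτ` in all directions. Positivity of the third fundamental
  -- form shows that `dτ` is injective modulo `f`, so the point would be umbilic.
  · refine hu x (hl.isUmbilic hf (r := r 1 (e x)) (fun Z => ?_) fun Z hZ => ?_)
    · rw [hρd hx, hτd hx, clm_complex_apply (fderiv ℝ (ρ ∘ e.symm) (e x)),
        clm_complex_apply (fderiv ℝ (τ ∘ e.symm) (e x)) (dd (F := ℂ) e x Z), hρc hx, hρc hx, hτc hx,
        hτc hx, hd1 hx, hd2 hx, h0]
      module
    · have h1 := hu' x (heU hx) Z Z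
      rw [hf.isotropic x _ hZ _ hZ, hde hx, Complex.mul_conj, Complex.ofReal_re] at h1
      have h2 := (mul_eq_zero.1 h1.symm).resolve_left (Real.exp_pos _).ne'
      apply (he.dd_bijective hx).1
      exact (Complex.normSq_eq_zero.1 h2).trans (map_zero (mfderiv (𝓡 2) 𝓘(ℝ, ℂ) e x)).symm
  · rw [(hcoeff hx).2, e.left_inv hx]

theorem IsLIsothermic.exists_isSpecialOmega [Nonempty M] {q0 : R42} (hf : IsLegendre f)
    (hu : UmbilicFree f) (hL : IsLaguerreFrame qinf q0 pt) (h : IsLIsothermic f qinf q0 pt) :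
    ∃ p : ℕ → M → R42, IsSpecialOmega f 1 p ∧
      (∀ t x, form (polyEval 1 p t x) (polyEval 1 p t x) = 0) ∧ ∀ x, p 0 x = qinf := by
  obtain ⟨y, n, hproj, q, hhol, μ, hμ⟩ := h
  have hl := hproj.isLaguerreLift hL
  obtain ⟨hy, hn⟩ := hproj.eq_euclideanPart hL
  set ρ := fun p => y p + q0 + (form (y p) (y p) / 2) • qinf
  set τ := fun p => n p + pt + form (n p) (y p) • qinf
  have hIII : thirdFF n = fun x X Y => form (dd τ x X) (dd τ x Y) := by
    funext x X Y
    have := hl.thirdFF_eq hL.null_inf q0 x X Y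
    rwa [show (fun p => euclideanPart qinf q0 (τ p) - pt) = n from hn.symm] at this
  have hII : secondFF y n = fun x X Y => -form (dd ρ x X) (dd τ x Y) := by
    funext x X Y
    have := hl.secondFF_eq hL.null_inf q0 x X Y
    rwa [show (fun p => euclideanPart qinf q0 (ρ p) - q0) = y from hy.symm,
      show (fun p => euclideanPart qinf q0 (τ p) - pt) = n from hn.symm] at this
  rw [hIII] at hhol hμ
  rw [hII] at hμ
  have hch := hl.exists_isothermicLift hf hu hhol hμ
  have hτd {e : OpenPartialHomeomorph M ℂ} (he : IsSmoothChart e) {x : M} (hx : x ∈ e.source)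
      (Z : TangentSpace (𝓡 2) x) := he.dd_eq_fderiv hx (hl.mdifferentiableAt_τ x) Z
  -- The endomorphism `Q` is `E⁻¹` times complex conjugation in any such chart. Characterising it by
  -- `q` and the third fundamental form alone makes the potential independent of the chart.
  have hQ : ∀ x, ∃ Q : TangentSpace (𝓡 2) x →L[ℝ] TangentSpace (𝓡 2) x,
      ∀ Z W, form (dd τ x (Q Z)) (dd τ x W) = q x Z W / 2 := by
    intro x
    obtain ⟨e, E, r₁, r₂, he, hx, hI, -, hq⟩ := hch x
    have hw := e.map_source hx
    let Q : TangentSpace (𝓡 2) x →L[ℝ] TangentSpace (𝓡 2) x :=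
      ((mfderiv 𝓘(ℝ, ℂ) (𝓡 2) e.symm (e x) : ℂ →L[ℝ] TangentSpace (𝓡 2) x).comp
        ((E (e x))⁻¹ • Complex.conjCLE.toContinuousLinearMap)).comp
          (mfderiv (𝓡 2) 𝓘(ℝ, ℂ) e x : TangentSpace (𝓡 2) x →L[ℝ] ℂ)
    refine ⟨Q, fun Z W => ?_⟩
    have h1 : dd (F := ℂ) e x (Q Z) = (E (e x))⁻¹ • (starRingEnd ℂ) (dd (F := ℂ) e x Z) :=
      he.dd_coordField hx _
    have hne := (hI.pos _ hw).ne'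
    rw [hτd he hx, hτd he hx, hI.conformal _ hw, h1, hq x hx]
    simp
    field_simp
  choose Q hQ using hQ
  -- In each chart `4 μ = E (r₁ - r₂)`, so this is the required scale factor, described without
  -- coordinates.
  let C : M → ℝ := fun x => (4 * μ x)⁻¹
  let dG : (x : M) → TangentSpace (𝓡 2) x →L[ℝ] R42 →L[ℝ] R42 := fun x =>
    mfderiv (𝓡 2) 𝓘(ℝ, R42 →L[ℝ] R42) (fun x => C x • wedge (ρ x) (τ x)) x
  let dτ : (x : M) → TangentSpace (𝓡 2) x →L[ℝ] R42 := fun x => mfderiv (𝓡 2) 𝓘(ℝ, R42) τ x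
  let η : OneForm M := fun x => dG x - (wedgeL (τ x)).comp ((dτ x).comp (Q x))
  refine isSpecialOmega_of_isothermicCharts (C := C) (η := η) hf hu hl hL.null_inf fun p => ?_
  obtain ⟨e, E, r₁, r₂, he, hp, hI, hE, hq⟩ := hch p
  have hscale : ∀ w ∈ e.target, C (e.symm w) * (E w * (r₁ w - r₂ w)) = 1 := fun w hw => by
    have hne : E w * (r₁ w - r₂ w) ≠ 0 :=
      mul_ne_zero (hI.pos w hw).ne' (sub_ne_zero.2 (hI.ne w hw))
    rw [hE w hw] at hne ⊢
    exact inv_mul_cancel₀ hne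
  refine ⟨e, E, r₁, r₂, hp, he, hI, hscale, fun x hx Z => ?_⟩
  have hw := e.map_source hx
  have hG : MDifferentiableAt (𝓡 2) 𝓘(ℝ, R42 →L[ℝ] R42) (fun x => C x • wedge (ρ x) (τ x)) x := by
    refine mdifferentiableAt_of_contMDiffOn (U := e.source) ?_ e.open_source hx
    have := hI.smooth_scale_wedge (C := C ∘ e.symm) (hI.smooth_scale hscale)
    refine ((he.contMDiffOn_comp this).mono fun x hx => ⟨hx, e.map_source hx⟩).congr
      fun x hx => ?_
    simp only [Function.comp_apply, e.left_inv hx]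
  -- The chart here may differ from the one that produced `Q x`; the defining property of `Q`
  -- determines `dz(Q Z)` in every chart.
  have hQZ : dd (F := ℂ) e x (Q x Z) = (E (e x))⁻¹ • (starRingEnd ℂ) (dd (F := ℂ) e x Z) := by
    have hne := (hI.pos _ hw).ne'
    refine eq_of_forall_re_mul fun v => ?_
    obtain ⟨W, hW⟩ := (he.dd_bijective hx).2 ((starRingEnd ℂ) v)
    have h1 := hQ x Z W
    rw [hτd he hx, hτd he hx, hI.conformal _ hw, hq x hx] at h1
    simp only at hW
    rw [hW, Complex.conj_conj] at h1
    rw [eq_comm, ← mul_right_inj' hne, h1]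
    simp
    field_simp
  have h1 : η x Z = dd (fun x => C x • wedge (ρ x) (τ x)) x Z -
      wedge (τ x) (dd τ x (Q x Z)) := rfl
  rw [h1, isothermicForm_apply, he.dd_eq_fderiv hx hG, hτd he hx, hQZ, map_smul,
    Function.comp_apply (f := τ), e.left_inv hx]
  rfl

end Surface

end LieSphere

end

open scoped Manifold ContDiff in
theorem mainTheorem3 {M : Type*} [TopologicalSpace M] [T2Space M] [SecondCountableTopology M]
    [ConnectedSpace M] [ChartedSpace (EuclideanSpace ℝ (Fin 2)) M] [IsManifold (𝓡 2) ∞ M]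
    (f : M → Submodule ℝ LieSphere.R42) :
    (∀ p : ℕ → M → LieSphere.R42, LieSphere.IsSpecialOmega f 1 p →
      (∀ (t : ℝ) (x : M),
        LieSphere.form (LieSphere.polyEval 1 p t x) (LieSphere.polyEval 1 p t x) = 0) →
      ∃ qinf : LieSphere.R42, qinf ≠ 0 ∧ LieSphere.form qinf qinf = 0 ∧
        (∀ x : M, p 0 x = qinf) ∧
        ∀ q0 pt : LieSphere.R42, LieSphere.IsLaguerreFrame qinf q0 pt →
          LieSphere.IsLIsothermic f qinf q0 pt) ∧
    (LieSphere.IsLegendre f → LieSphere.UmbilicFree f →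
      ∀ qinf q0 pt : LieSphere.R42, LieSphere.IsLaguerreFrame qinf q0 pt →
        LieSphere.IsLIsothermic f qinf q0 pt →
          ∃ p : ℕ → M → LieSphere.R42, LieSphere.IsSpecialOmega f 1 p ∧
            (∀ (t : ℝ) (x : M),
              LieSphere.form (LieSphere.polyEval 1 p t x) (LieSphere.polyEval 1 p t x) = 0) ∧
            ∀ x : M, p 0 x = qinf) := by
  exact ⟨fun p hp hnull => hp.exists_isLIsothermic hnull,
    fun hf hu qinf q0 pt hL h => h.exists_isSpecialOmega hf hu hL⟩
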